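/- **Model.** Let $\alpha,\beta,\mathcal N,\varepsilon,\gamma,\kappa$ be real with $\alpha>\gamma$, $\beta\ge 1$, $\mathcal N>0$, $0<\varepsilon<1$. A network consists of $n$ stations at distinct points of a metric space in which, for all $d>0$ and all integers $a\ge 1$, every ball of radius $ad$ is covered by at most $\kappa a^{\gamma}$ balls of radius $d$ (bounded growth of dimension $\gamma$). All stations have the same power $P=\mathcal N\beta$ (so the communication range is $1$). Time is divided into synchronous rounds. If $T$ is the set of stations transmitting in a round, station $u$ receives the message of station $v$ iff $v\in T$, $u\notin T$ and $$\frac{P\,\mathrm{dist}(v,u)^{-\alpha}}{\mathcal N+\sum_{w\in T\setminus\{v\}}P\,\mathrm{dist}(w,u)^{-\alpha}}\ \ge\ \beta .$$ The communication graph joins distinct stations at distance at most $1-\varepsilon$; it is assumed to be connected, and $D$ is its diameter. Initially only a source station $s$ is awake and holds a message; every other station sleeps, without transmitting, until it receives a message for the first time (no spontaneous wake-up). All stations run the same randomized algorithm, which knows $n$ and the constants only; the only input of a station during the execution is the message it receives in a round, if any (no location knowledge, no carrier sensing). The message is transmitted together with the number of elapsed rounds. **Algorithm NoSBroadcast** (write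 $\log=\log_2$). It has positive constants $c_0,c_1,c_2,c_3,c_\varepsilon,C_1,C_2,c,c_T$ and a positive integer $c'$; put $p_{\mathrm{start}}=C_1/(2n)$ and $p_{\max}=C_2/c_\varepsilon$. It proceeds in consecutive phases of equal fixed length; the stations that know the message at the beginning of a phase are active in this phase, all others are silent. A phase has two parts. 1. (StabilizeProbability.) Every active station $v$ sets $p_v=p_{\mathrm{start}}$. While $p_v<p_{\max}$: it performs $c'$ times a DensityTest ($\lceil c_0\log n\rceil$ rounds, in each of which it transmits with probability $p_v$; passed if it heard at least $c_1\log n$ messages) followed by a Playoff ($\lceil c_2\log n\rceil$ rounds with transmission probability $c_\varepsilon p_v$; passed if it heard at least $c_3\log n$ messages), and then doubles $p_v$. In these counts a station also hears its own transmissions. If $v$ passes a DensityTest and the Playoff directly after it, it quits with the current value of $p_v$ as its color and is silent for the rest of this part. A station that has not quit when the loop ends gets the color $2p_{\max}$. 2. For $\lceil c_T\log^2 n\rceil$ rounds, every active station with color $p_v$ transmits with probability $p_v/(c\,\varepsilon\log n)$. **Theorem.** For all $\alpha,\beta,\mathcal N,\varepsilon,\gamma,\kappa$ as above, the constants of NoSBroadcast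 can be chosen, and there is a constant $K>0$, both depending only on $\alpha,\beta,\mathcal N,\varepsilon,\gamma,\kappa$, such that for every such network and every source $s$, with probability at least $1-1/n$ all stations hold the source message after $K\,D\log^2 n$ rounds (that is, after $t$ rounds for every integer $t\ge K D\log^2 n$), counted from the activation of the source. Moreover, up to that time the number attached to the transmitted messages has at most $K\log n$ bits. -/

import Mathlib

/-! ### The metric space and the SINR model -/

/-- Bounded growth of dimension `γ` with constant `κ`: for every `d > 0` and every integer `c ≥ 1`,
every ball of radius `c * d` is covered by at most `κ * c ^ γ` balls of radius `d`. -/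
def BoundedGrowth (X : Type*) [MetricSpace X] (γ κ : ℝ) : Prop :=
  ∀ (x : X) (d : ℝ), 0 < d → ∀ c : ℕ, 1 ≤ c →
    ∃ S : Finset X, (S.card : ℝ) ≤ κ * (c : ℝ) ^ γ ∧
      Metric.closedBall x (c * d) ⊆ ⋃ y ∈ S, Metric.closedBall y d

/-- Parameters of the SINR model: path loss `α`, threshold `β`, ambient noise `noise`, and the
parameter `ε` of the communication graph. -/
structure SINRParams where
  α : ℝ
  β : ℝ
  noise : ℝ
  ε : ℝ

namespace SINRParams

/-- The common transmission power of all stations, normalised so that the communication range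
`(power / (noise * β)) ^ (1 / α)` is `1`. -/
def power (M : SINRParams) : ℝ := M.noise * M.β

variable {X : Type*} [MetricSpace X] {n : ℕ}

/-- The strength at station `u` of the signal emitted by station `w`. -/
noncomputable def signal (M : SINRParams) (pos : Fin n → X) (w u : Fin n) : ℝ :=
  M.power * dist (pos w) (pos u) ^ (-M.α)

/-- The signal-to-interference-and-noise ratio at `u` of the signal of `v`, when `T` is the set of
transmitting stations. -/
noncomputable def sinr (M : SINRParams) (pos : Fin n → X) (v u : Fin n) (T : Finset (Fin n)) : ℝ :=
  M.signal pos v u / (M.noise + ∑ w ∈ T.erase v, M.signal pos w u)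

/-- Station `u` successfully receives the message of station `v`, when `T` is the set of
transmitting stations. -/
def Receives (M : SINRParams) (pos : Fin n → X) (T : Finset (Fin n)) (v u : Fin n) : Prop :=
  v ∈ T ∧ u ∉ T ∧ M.β ≤ M.sinr pos v u T

/-- For `β ≥ 1` a station receives the message of at most one station per round. -/
theorem Receives.unique {M : SINRParams} (hβ : 1 ≤ M.β) (hN : 0 < M.noise) {pos : Fin n → X}
    {T : Finset (Fin n)} {v w u : Fin n} (hv : M.Receives pos T v u) (hw : M.Receives pos T w u) :
    v = w := by
  by_contra hne
  have h0 : ∀ x, 0 ≤ M.signal pos x u := fun x =>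
    mul_nonneg (mul_nonneg hN.le (by linarith)) (Real.rpow_nonneg dist_nonneg _)
  have key : ∀ a b : Fin n, a ≠ b → b ∈ T → M.β ≤ M.sinr pos a u T →
      M.noise + M.signal pos b u ≤ M.signal pos a u := by
    intro a b hab hb h
    have hle : M.signal pos b u ≤ ∑ x ∈ T.erase a, M.signal pos x u :=
      Finset.single_le_sum (f := fun x => M.signal pos x u) (fun x _ => h0 x)
        (Finset.mem_erase.2 ⟨hab.symm, hb⟩)
    have hpos : 0 < M.noise + ∑ x ∈ T.erase a, M.signal pos x u := by linarith [h0 b]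
    have h2 := (le_div_iff₀ hpos).1 h
    nlinarith
  have h1 := key v w hne hw.1 hv.2.2
  have h2 := key w v (Ne.symm hne) hv.1 hw.2.2
  linarith

/-- The communication graph: two distinct stations are adjacent if and only if their distance is at
most `1 - ε`. -/
def commGraph (M : SINRParams) (pos : Fin n → X) : SimpleGraph (Fin n) where
  Adj u v := u ≠ v ∧ dist (pos u) (pos v) ≤ 1 - M.ε
  symm := ⟨fun u v h => ⟨h.1.symm, by rw [dist_comm]; exact h.2⟩⟩
  loopless := ⟨fun _ h => h.1 rfl⟩

end SINRParams

/-! ### Randomised distributed protocols without spontaneous wake-up -/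

/-- A packet consists of the broadcast message and an attached natural number. -/
abbrev Packet (Msg : Type) : Type := Msg × ℕ

/-- A randomised protocol, run by every station. In each round a station transmits with a probability
that is a function of its local state, independently of the other stations. The only feedback of
the channel is the packet that the station receives in the round, if any; the new state is a
function of the old state, of the station's own decision whether to transmit, and of this
feedback. In particular, a station has no access to its identity, to its position, to distances or
to the strength of signals. -/
structure Protocol (Msg : Type) where
  State : Type
  /-- The initial state of the source that holds the given message. -/
  source : Msg → State
  /-- The state of a station that has been woken up by the first packet it received. -/
  wake : Packet Msg → State
  /-- The packet sent by a station that transmits. Its first component is the copy of the broadcast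
  message stored by the station. -/
  packet : State → Packet Msg
  txProb : State → unitInterval
  update : State → (transmitted : Bool) → (received : Option (Packet Msg)) → State

/-- The law of the random set that contains each `v` with probability `p v`, independently. -/
noncomputable def randomSet {n : ℕ} (p : Fin n → unitInterval) : PMF (Finset (Fin n)) :=
  PMF.ofFintype
    (fun T => ENNReal.ofReal ((∏ v ∈ T, (p v : ℝ)) * ∏ v ∈ Finset.univ \ T, (1 - (p v : ℝ))))
    (by
      rw [← ENNReal.ofReal_sum_of_nonneg]
      · rw [← Finset.powerset_univ, ← Finset.prod_add]
        simp
      · intro T _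
        exact mul_nonneg (Finset.prod_nonneg fun v _ => (p v).2.1)
          (Finset.prod_nonneg fun v _ => sub_nonneg.2 (p v).2.2))

namespace Protocol

variable {Msg : Type} {X : Type*} [MetricSpace X] {n : ℕ}

/-- The states of all stations; `none` is the state of a sleeping station, which has not received
any packet so far. -/
abbrev Config (A : Protocol Msg) (n : ℕ) : Type := Fin n → Option A.State

/-- Only the source, with the broadcast message, is awake at the beginning. -/
def initConfig (A : Protocol Msg) (s : Fin n) (m : Msg) : A.Config n :=
  fun v => if v = s then some (A.source m) else none

/-- Sleeping stations do not transmit. -/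
def stationTxProb (A : Protocol Msg) : Option A.State → unitInterval
  | none => 0
  | some st => A.txProb st

open Classical in
/-- The packet received by `u`, if any, when `T` is the set of transmitting stations. By
`SINRParams.Receives.unique` there is at most one possible sender. -/
noncomputable def received (A : Protocol Msg) (M : SINRParams) (pos : Fin n → X)
    (cfg : A.Config n) (T : Finset (Fin n)) (u : Fin n) : Option (Packet Msg) :=
  if h : ∃ v, M.Receives pos T v u then (cfg h.choose).map A.packet else none

/-- The configuration after a round in which `T` is the set of transmitting stations. -/
noncomputable def next (A : Protocol Msg) (M : SINRParams) (pos : Fin n → X)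
    (cfg : A.Config n) (T : Finset (Fin n)) : A.Config n :=
  fun v => match cfg v with
    | none => (A.received M pos cfg T v).map A.wake
    | some st => some (A.update st (decide (v ∈ T)) (A.received M pos cfg T v))

/-- The law of the configuration after `t` rounds, counted from the activation of the source `s`
holding the message `m`. -/
noncomputable def run (A : Protocol Msg) (M : SINRParams) (pos : Fin n → X) (s : Fin n) (m : Msg) :
    ℕ → PMF (A.Config n)
  | 0 => PMF.pure (A.initConfig s m)
  | t + 1 => (A.run M pos s m t).bind fun cfg =>
      (randomSet fun v => A.stationTxProb (cfg v)).map (A.next M pos cfg)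

/-- Every station holds the message `m`. -/
def Informed (A : Protocol Msg) (m : Msg) (cfg : A.Config n) : Prop :=
  ∀ v, ∃ st, cfg v = some st ∧ (A.packet st).1 = m

end Protocol

/-! ### The algorithm NoSBroadcast -/

/-- The constants of the algorithm: `c₀, c₁` belong to DensityTest, `c₂, c₃, cEps` to Playoff,
`C₁, C₂, c'` to StabilizeProbability, and `c, cT` to the second part of a phase. -/
structure NoSConstants where
  c₀ : ℝ
  c₁ : ℝ
  c₂ : ℝ
  c₃ : ℝ
  cEps : ℝ
  C₁ : ℝ
  C₂ : ℝ
  c : ℝ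
  cT : ℝ
  c' : ℕ

namespace NoSConstants

/-- All constants are positive. -/
def Positive (k : NoSConstants) : Prop :=
  0 < k.c₀ ∧ 0 < k.c₁ ∧ 0 < k.c₂ ∧ 0 < k.c₃ ∧ 0 < k.cEps ∧ 0 < k.C₁ ∧ 0 < k.C₂ ∧ 0 < k.c ∧
    0 < k.cT ∧ 0 < k.c'

/-- The initial value of `p_v` in StabilizeProbability. -/
noncomputable def pStart (k : NoSConstants) (n : ℕ) : ℝ := k.C₁ / (2 * n)

noncomputable def pMax (k : NoSConstants) : ℝ := k.C₂ / k.cEps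

/-- The number of rounds of DensityTest. -/
noncomputable def densityLen (k : NoSConstants) (n : ℕ) : ℕ := ⌈k.c₀ * Real.logb 2 n⌉₊

/-- The number of rounds of Playoff. -/
noncomputable def playoffLen (k : NoSConstants) (n : ℕ) : ℕ := ⌈k.c₂ * Real.logb 2 n⌉₊

/-- The number of rounds of DensityTest followed by Playoff. -/
noncomputable def testLen (k : NoSConstants) (n : ℕ) : ℕ := k.densityLen n + k.playoffLen n

/-- The number of iterations of the loop "while `p_v < pMax`", in which `p_v` starts from `pStart`
and is doubled at the end of each iteration, that is, the least `i` with
`pMax ≤ 2 ^ i * pStart`. -/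
noncomputable def loops (k : NoSConstants) (n : ℕ) : ℕ := ⌈Real.logb 2 (k.pMax / k.pStart n)⌉₊

/-- The number of rounds of StabilizeProbability, the first part of a phase: in each iteration of
the loop both tests are executed `c'` times. -/
noncomputable def part1Len (k : NoSConstants) (n : ℕ) : ℕ := k.loops n * (k.c' * k.testLen n)

/-- The number of rounds of the second part of a phase. -/
noncomputable def part2Len (k : NoSConstants) (n : ℕ) : ℕ := ⌈k.cT * Real.logb 2 n ^ 2⌉₊

noncomputable def phaseLen (k : NoSConstants) (n : ℕ) : ℕ := k.part1Len n + k.part2Len n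

/-- The value of `p_v`, for a station that has not quit, in round `r` of StabilizeProbability: it is
`pStart`, doubled once for every completed iteration of the loop. -/
noncomputable def prob (k : NoSConstants) (n r : ℕ) : ℝ :=
  2 ^ (r / (k.c' * k.testLen n)) * k.pStart n

end NoSConstants

/-- The local state of a station that knows the broadcast message. -/
structure NoSState (Msg : Type) where
  msg : Msg
  /-- The number of rounds elapsed since the beginning of the algorithm. -/
  clock : ℕ
  /-- Does the station participate in the current phase? -/
  active : Bool
  /-- The color with which the station has quit the loop of StabilizeProbability; `none` if it has
  not quit in the current phase. -/
  color : Option ℝ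
  /-- The number of messages heard so far in the current test. -/
  count : ℕ
  /-- The result of the most recent DensityTest. -/
  dense : Bool

namespace NoSState

variable {Msg : Type}

/-- The state at the beginning of a phase of a station that knows the message. -/
def fresh (m : Msg) (clock : ℕ) : NoSState Msg where
  msg := m
  clock := clock
  active := true
  color := none
  count := 0
  dense := false

/-- The state after a round of StabilizeProbability, the round having number `r` within the phase,
of an active station that has not quit. `heard` tells whether the station received a message in
the round or transmitted one itself. After DensityTest the count is compared with `c₁ log n`. After
Playoff it is compared with `c₃ log n`, and the station quits with its current `p_v` as color if
both tests were passed. -/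
noncomputable def testStep (k : NoSConstants) (n : ℕ) (st : NoSState Msg) (r : ℕ) (heard : Bool) :
    NoSState Msg :=
  open Classical in
  let count := st.count + if heard then 1 else 0
  let i := r % k.testLen n
  if i + 1 = k.densityLen n then
    { st with clock := st.clock + 1, count := 0, dense := decide (k.c₁ * Real.logb 2 n ≤ count) }
  else if i + 1 = k.testLen n then
    { st with
      clock := st.clock + 1
      count := 0
      dense := false
      color := if st.dense = true ∧ k.c₃ * Real.logb 2 n ≤ count then some (k.prob n r) else none }
  else
    { st with clock := st.clock + 1, count := count }

end NoSState

/-- The algorithm NoSBroadcast with constants `k` for `n` stations and communication graph parameter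
`ε`. It runs in consecutive phases of `k.phaseLen n` rounds; the stations that know the message
at the beginning of a phase are active in it. In the first part of the phase the active stations
execute StabilizeProbability: those that have not quit transmit with probability `p_v` in
DensityTest and `p_v * cEps` in Playoff; those that have quit are silent. A station that never
quits in a test has color `2 * pMax` at the end. In the second part an active station with color
`p_v` transmits with probability `p_v / (c ε log n)`. The number of elapsed rounds is attached to
every message, so that woken stations know the current round. -/
noncomputable def NoSBroadcast (Msg : Type) (k : NoSConstants) (ε : ℝ) (n : ℕ) : Protocol Msg where
  State := NoSState Msg
  source m := NoSState.fresh m 0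
  wake q := { NoSState.fresh q.1 (q.2 + 1) with active := decide ((q.2 + 1) % k.phaseLen n = 0) }
  packet st := (st.msg, st.clock)
  txProb st :=
    let r := st.clock % k.phaseLen n
    Set.projIcc 0 1 zero_le_one <|
      if st.active = false then 0
      else if r < k.part1Len n then
        if st.color.isSome then 0
        else if r % k.testLen n < k.densityLen n then k.prob n r
        else k.prob n r * k.cEps
      else st.color.getD (2 * k.pMax) / (k.c * ε * Real.logb 2 n)
  update st transmitted received :=
    let r := st.clock % k.phaseLen n
    if r + 1 = k.phaseLen n then NoSState.fresh st.msg (st.clock + 1)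
    else if st.active = true ∧ r < k.part1Len n ∧ st.color = none then
      st.testStep k n r (transmitted || received.isSome)
    else { st with clock := st.clock + 1 }

/-! In one phase the awake stations acquire colors such that, with high probability, (a) every unit
ball carries total color `O(log n)`, and (b) within distance `ε/2` of every active station the total
color is at least a constant, `nearProb`. Once colors are divided by a large multiple of `log n`,
(a) and `γ < α` keep the expected interference everywhere below any chosen constant (`sum_far_le`).
By (b), a graph neighbour of an active station then receives the message in each round of the second
part with probability of order `1 / log n`, so `log² n` rounds suffice (`leads_spread`). The set of
awake stations thus gains one hop of the graph per phase, and a phase has `O(log² n)` rounds.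

Reason for (b): passing DensityTest shows that the unit ball around the station has transmission
mass bounded below. In Playoff this mass is multiplied by the large constant `cEps`, so many
stations of the unit ball transmit, and their interference drowns every sender farther than `ε/2`.
Passing Playoff as well therefore forces mass within `ε/2` (`rprob_hears_le_near_add`,
`nearProb_le_of_hears`). A station that never quits has a large enough color by itself.

Reason for (a): the mass of the stations still running is kept at most `C₁` in every unit ball. If
it exceeds `C₁/2`, a descent to smaller scales finds a ball that is heavy for Playoff while all
balls of half the radius in a large neighbourhood are light (`exists_heavy_minimal`). Interference
there is tame at its own scale, so all its stations hear well in both tests and quit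
(`exists_subset_receives`). They carry Playoff mass at least `1`, and a ball of radius `2` contains
only bounded mass, so boundedly many repetitions push the mass below `C₁/2`, and the doubling is
harmless. A doubling adds at most `C₁/2` to the total color of a unit ball, and there are `O(log n)`
of them. `Stable` is this invariant.

The tests concentrate because all transmission probabilities are fixed during a test: stations quit
only in the last round of a Playoff. Exponential potentials of the counters give failure probability
`n^(-s)` per station and test (`leads_block`), and a union bound over stations, tests and at most
`n` phases finishes. Probabilities of a run are iterates of the one-step expectation `expect`, and
`Leads` composes them.

The constants must reconcile two demands on the mass `cEps * C₁`: at the scale ratio `y = 2^l` it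
has to exceed a multiple of `y^γ`, for the descent to start, and stay below a small multiple of
`y^α`, for far interference to be negligible. The exponent `(γ + α) / 2` does both
(`exists_pow_scale`). -/

/-! ### Expectations over the transmitting set of a round -/

/-- The indicator of a proposition, as a real number. -/
noncomputable def ind (Q : Prop) : ℝ :=
  open Classical in if Q then 1 else 0

theorem ind_of {Q : Prop} (h : Q) : ind Q = 1 := by simp [ind, h]

theorem ind_of_not {Q : Prop} (h : ¬Q) : ind Q = 0 := by simp [ind, h]

theorem ind_nonneg (Q : Prop) : 0 ≤ ind Q := by
  by_cases h : Q <;> simp [ind, h]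

theorem ind_le_one (Q : Prop) : ind Q ≤ 1 := by
  by_cases h : Q <;> simp [ind, h]

theorem ind_mono {Q R : Prop} (h : Q → R) : ind Q ≤ ind R := by
  by_cases hQ : Q
  · rw [ind_of hQ, ind_of (h hQ)]
  · rw [ind_of_not hQ]; exact ind_nonneg R

theorem ind_not (Q : Prop) : ind (¬Q) = 1 - ind Q := by
  by_cases h : Q <;> simp [ind, h]

theorem ind_or_le (Q R : Prop) : ind (Q ∨ R) ≤ ind Q + ind R := by
  by_cases h : Q <;> by_cases h' : R <;> simp [ind, h, h']

theorem ind_exists_le {ι : Type*} (s : Finset ι) (Q : ι → Prop) :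
    ind (∃ i ∈ s, Q i) ≤ ∑ i ∈ s, ind (Q i) := by
  by_cases h : ∃ i ∈ s, Q i
  · obtain ⟨i, hi, hQ⟩ := h
    rw [ind_of ⟨i, hi, hQ⟩, ← ind_of hQ]
    exact Finset.single_le_sum (f := fun i => ind (Q i)) (fun j _ => ind_nonneg _) hi
  · rw [ind_of_not h]
    exact Finset.sum_nonneg fun i _ => ind_nonneg _

section Round

variable {n : ℕ}

/-- The probability that `T` is the random set which contains each `v` with probability `p v`. -/
noncomputable def setWeight (p : Fin n → unitInterval) (T : Finset (Fin n)) : ℝ :=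
  (∏ v ∈ T, (p v : ℝ)) * ∏ v ∈ Finset.univ \ T, (1 - (p v : ℝ))

/-- The expectation of `f T` for the random set `T` which contains each `v` with probability
`p v`. -/
noncomputable def rexp (p : Fin n → unitInterval) (f : Finset (Fin n) → ℝ) : ℝ :=
  ∑ T, setWeight p T * f T

/-- The probability of `Q T` for the random set `T` which contains each `v` with probability
`p v`. -/
noncomputable def rprob (p : Fin n → unitInterval) (Q : Finset (Fin n) → Prop) : ℝ :=
  rexp p fun T => ind (Q T)

variable (p : Fin n → unitInterval)

theorem setWeight_nonneg (T : Finset (Fin n)) : 0 ≤ setWeight p T :=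
  mul_nonneg (Finset.prod_nonneg fun v _ => (p v).2.1)
    (Finset.prod_nonneg fun v _ => sub_nonneg.2 (p v).2.2)

theorem setWeight_eq_zero {T : Finset (Fin n)} {v : Fin n} (hv : v ∈ T) (h : p v = 0) :
    setWeight p T = 0 := by
  rw [setWeight, Finset.prod_eq_zero hv (by simp [h]), zero_mul]

/-- Independence in generating function form: expanding the product over all stations gives one term
for each transmitting set. Cylinder probabilities and exponential moments are both special cases. -/
theorem rexp_prod (a b : Fin n → ℝ) :
    rexp p (fun T => (∏ v ∈ T, a v) * ∏ v ∈ Finset.univ \ T, b v) =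
      ∏ v, ((p v : ℝ) * a v + (1 - (p v : ℝ)) * b v) := by
  rw [Finset.prod_add, Finset.powerset_univ]
  refine Finset.sum_congr rfl fun T _ => ?_
  rw [setWeight, Finset.prod_mul_distrib, Finset.prod_mul_distrib]
  ring

theorem rexp_const (c : ℝ) : rexp p (fun _ => c) = c := by
  have h := rexp_prod p (fun _ => 1) (fun _ => 1)
  simp only [Finset.prod_const_one, mul_one, add_sub_cancel] at h
  have h2 : rexp p (fun _ => c) = rexp p (fun _ => 1) * c := by
    simp [rexp, Finset.sum_mul]
  rw [h2, h, one_mul]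

theorem rexp_add (f g : Finset (Fin n) → ℝ) :
    rexp p (fun T => f T + g T) = rexp p f + rexp p g := by
  simp [rexp, mul_add, Finset.sum_add_distrib]

theorem rexp_sub (f g : Finset (Fin n) → ℝ) :
    rexp p (fun T => f T - g T) = rexp p f - rexp p g := by
  simp [rexp, mul_sub, Finset.sum_sub_distrib]

theorem rexp_const_mul (c : ℝ) (f : Finset (Fin n) → ℝ) :
    rexp p (fun T => c * f T) = c * rexp p f := by
  simp only [rexp, Finset.mul_sum]
  exact Finset.sum_congr rfl fun T _ => by ring

theorem rexp_mul_const (c : ℝ) (f : Finset (Fin n) → ℝ) :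
    rexp p (fun T => f T * c) = rexp p f * c := by
  simp only [rexp, Finset.sum_mul]
  exact Finset.sum_congr rfl fun T _ => by ring

theorem rexp_sum {ι : Type*} (s : Finset ι) (f : ι → Finset (Fin n) → ℝ) :
    rexp p (fun T => ∑ i ∈ s, f i T) = ∑ i ∈ s, rexp p (f i) := by
  simp only [rexp, Finset.mul_sum]
  exact Finset.sum_comm

/-- A set containing a station of probability `0` has weight `0`, so the comparison is needed only
for sets of stations that can transmit. This is how silent and sleeping stations are excluded later.
-/
theorem rexp_mono {f g : Finset (Fin n) → ℝ}
    (h : ∀ T, (∀ v ∈ T, p v ≠ 0) → f T ≤ g T) : rexp p f ≤ rexp p g := by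
  refine Finset.sum_le_sum fun T _ => ?_
  by_cases hT : ∀ v ∈ T, p v ≠ 0
  · exact mul_le_mul_of_nonneg_left (h T hT) (setWeight_nonneg p T)
  · push Not at hT
    obtain ⟨v, hv, h0⟩ := hT
    simp [setWeight_eq_zero p hv h0]

theorem rprob_nonneg (Q : Finset (Fin n) → Prop) : 0 ≤ rprob p Q := by
  have := rexp_mono p (f := fun _ => 0) (g := fun T => ind (Q T)) fun T _ => ind_nonneg _
  rwa [rexp_const] at this

theorem rprob_mono {Q R : Finset (Fin n) → Prop} (h : ∀ T, (∀ v ∈ T, p v ≠ 0) → Q T → R T) :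
    rprob p Q ≤ rprob p R :=
  rexp_mono p fun T hT => ind_mono (h T hT)

/-- The indicator of the event factors over the stations, a factor `0` marking each forbidden
choice, so `rexp_prod` applies. -/
theorem rprob_cylinder {A B : Finset (Fin n)} (h : Disjoint A B) :
    rprob p (fun T => A ⊆ T ∧ Disjoint B T) =
      (∏ v ∈ A, (p v : ℝ)) * ∏ v ∈ B, (1 - (p v : ℝ)) := by
  classical
  have key : ∀ T : Finset (Fin n), ind (A ⊆ T ∧ Disjoint B T) =
      (∏ v ∈ T, if v ∈ B then (0 : ℝ) else 1) *
        ∏ v ∈ Finset.univ \ T, if v ∈ A then (0 : ℝ) else 1 := by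
    intro T
    by_cases h1 : Disjoint B T
    · rw [Finset.prod_eq_one (s := T) fun v hv => if_neg fun hB => Finset.disjoint_left.1 h1 hB hv]
      by_cases h2 : A ⊆ T
      · rw [ind_of ⟨h2, h1⟩, Finset.prod_eq_one, one_mul]
        intro v hv
        exact if_neg fun hA => (Finset.mem_sdiff.1 hv).2 (h2 hA)
      · rw [ind_of_not fun h => h2 h.1]
        obtain ⟨v, hv, hvT⟩ := Finset.not_subset.1 h2
        have h3 : (∏ v ∈ Finset.univ \ T, if v ∈ A then (0 : ℝ) else 1) = 0 :=
          Finset.prod_eq_zero (i := v) (by simp [hvT]) (if_pos hv)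
        rw [h3, mul_zero]
    · rw [ind_of_not fun h => h1 h.2]
      obtain ⟨v, hv, hvT⟩ := Finset.not_disjoint_iff.1 h1
      have h3 : (∏ v ∈ T, if v ∈ B then (0 : ℝ) else 1) = 0 :=
        Finset.prod_eq_zero hvT (if_pos hv)
      rw [h3, zero_mul]
  rw [rprob]
  simp only [key]
  rw [rexp_prod, ← Finset.prod_filter_mul_prod_filter_not Finset.univ (fun v => v ∈ A),
    ← Finset.prod_filter_mul_prod_filter_not (Finset.univ.filter fun v => v ∉ A) (fun v => v ∈ B)]
  have e1 : (∏ v ∈ Finset.univ with v ∈ A, ((p v : ℝ) * (if v ∈ B then (0 : ℝ) else 1) +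
      (1 - (p v : ℝ)) * (if v ∈ A then (0 : ℝ) else 1))) = ∏ v ∈ A, (p v : ℝ) := by
    rw [show (Finset.univ.filter fun v => v ∈ A) = A by ext; simp]
    refine Finset.prod_congr rfl fun v hv => ?_
    simp [hv, Finset.disjoint_left.1 h hv]
  have e2 : (∏ v ∈ (Finset.univ.filter fun v => v ∉ A) with v ∈ B,
      ((p v : ℝ) * (if v ∈ B then (0 : ℝ) else 1) +
      (1 - (p v : ℝ)) * (if v ∈ A then (0 : ℝ) else 1))) = ∏ v ∈ B, (1 - (p v : ℝ)) := by
    have : ((Finset.univ.filter fun v => v ∉ A).filter fun v => v ∈ B) = B := by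
      ext v
      simp only [Finset.mem_filter, Finset.mem_univ, true_and, and_iff_right_iff_imp]
      exact fun hB hA => Finset.disjoint_left.1 h hA hB
    rw [this]
    refine Finset.prod_congr rfl fun v hv => ?_
    simp [hv, Finset.disjoint_right.1 h hv]
  have e3 : (∏ v ∈ (Finset.univ.filter fun v => v ∉ A) with v ∉ B,
      ((p v : ℝ) * (if v ∈ B then (0 : ℝ) else 1) +
      (1 - (p v : ℝ)) * (if v ∈ A then (0 : ℝ) else 1))) = 1 := by
    refine Finset.prod_eq_one fun v hv => ?_
    simp only [Finset.mem_filter, Finset.mem_univ, true_and] at hv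
    simp [hv.1, hv.2]
  rw [e1, e2, e3, mul_one]

theorem rprob_mem (v : Fin n) : rprob p (fun T => v ∈ T) = p v := by
  have := rprob_cylinder p (A := {v}) (B := ∅) (by simp)
  simpa using this

theorem rprob_exists_mem_le (F : Finset (Fin n)) :
    rprob p (fun T => ∃ v ∈ F, v ∈ T) ≤ ∑ v ∈ F, (p v : ℝ) := by
  calc rprob p (fun T => ∃ v ∈ F, v ∈ T)
      ≤ rexp p (fun T => ∑ v ∈ F, ind (v ∈ T)) := rexp_mono p fun T _ => ind_exists_le F _
    _ = ∑ v ∈ F, (p v : ℝ) := by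
        rw [rexp_sum]
        exact Finset.sum_congr rfl fun v _ => rprob_mem p v

theorem rprob_or_le (Q R : Finset (Fin n) → Prop) :
    rprob p (fun T => Q T ∨ R T) ≤ rprob p Q + rprob p R := by
  rw [rprob, rprob, rprob, ← rexp_add]
  exact rexp_mono p fun T _ => ind_or_le _ _

/-- A lower tail bound for the number of transmitters in `F`. -/
theorem rprob_card_le (F : Finset (Fin n)) (k : ℝ) :
    rprob p (fun T => ((T ∩ F).card : ℝ) ≤ k) ≤
      2 ^ k * Real.exp (-(∑ v ∈ F, (p v : ℝ)) / 2) := by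
  classical
  -- Markov's inequality for `2 ^ (k - |T ∩ F|)`: each member of `F` that transmits contributes a
  -- factor `1/2`.
  have h1 : ∀ T : Finset (Fin n), ind (((T ∩ F).card : ℝ) ≤ k) ≤
      2 ^ k * ((∏ v ∈ T, if v ∈ F then (1 / 2 : ℝ) else 1) *
        ∏ v ∈ Finset.univ \ T, (fun _ => (1 : ℝ)) v) := by
    intro T
    rw [Finset.prod_ite, Finset.prod_const, Finset.prod_const_one, Finset.prod_const_one, mul_one,
      mul_one, Finset.filter_mem_eq_inter]
    by_cases h : ((T ∩ F).card : ℝ) ≤ k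
    · rw [ind_of h, one_div, inv_pow, ← Real.rpow_natCast, ← Real.rpow_neg (by norm_num),
        ← Real.rpow_add (by norm_num)]
      exact Real.one_le_rpow (by norm_num) (by linarith)
    · rw [ind_of_not h]; positivity
  calc rprob p (fun T => ((T ∩ F).card : ℝ) ≤ k)
      ≤ rexp p (fun T => 2 ^ k * ((∏ v ∈ T, if v ∈ F then (1 / 2 : ℝ) else 1) *
        ∏ v ∈ Finset.univ \ T, (fun _ => (1 : ℝ)) v)) := rexp_mono p fun T _ => h1 T
    _ = 2 ^ k * ∏ v, ((p v : ℝ) * (if v ∈ F then (1 / 2 : ℝ) else 1) + (1 - (p v : ℝ)) * 1) := by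
        rw [rexp_const_mul, rexp_prod]
    _ = 2 ^ k * ∏ v ∈ F, (1 - (p v : ℝ) / 2) := by
        congr 1
        rw [← Finset.prod_subset (Finset.subset_univ F)]
        · refine Finset.prod_congr rfl fun v hv => ?_
          rw [if_pos hv]; ring
        · intro v _ hv
          rw [if_neg hv]; ring
    _ ≤ 2 ^ k * Real.exp (-(∑ v ∈ F, (p v : ℝ)) / 2) := by
        refine mul_le_mul_of_nonneg_left ?_ (by positivity)
        rw [← Finset.sum_neg_distrib, Finset.sum_div, Real.exp_sum]
        refine Finset.prod_le_prod (fun v _ => ?_) fun v _ => ?_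
        · linarith [(p v).2.2]
        · have := Real.add_one_le_exp (-(p v : ℝ) / 2)
          linarith

end Round

/-! ### Markov chains driven by random sets -/

section Chain

variable {n : ℕ} {Ω : Type*} (p : Ω → Fin n → unitInterval) (nx : Ω → Finset (Fin n) → Ω)

/-- The expectation of `f` after one step of the chain which moves from `ω` to `nx ω T`, where `T`
is the random set containing each `v` with probability `p ω v`. -/
noncomputable def expect (f : Ω → ℝ) (ω : Ω) : ℝ := rexp (p ω) fun T => f (nx ω T)

theorem expect_mono {f g : Ω → ℝ} (h : ∀ ω, f ω ≤ g ω) (ω : Ω) :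
    expect p nx f ω ≤ expect p nx g ω :=
  rexp_mono _ fun _ _ => h _

theorem expect_iterate_mono {f g : Ω → ℝ} (h : ∀ ω, f ω ≤ g ω) (a : ℕ) (ω : Ω) :
    (expect p nx)^[a] f ω ≤ (expect p nx)^[a] g ω := by
  induction a generalizing f g with
  | zero => exact h ω
  | succ a ih => exact ih fun ω => expect_mono p nx h ω

theorem expect_iterate_add (f g : Ω → ℝ) (a : ℕ) (ω : Ω) :
    (expect p nx)^[a] (fun ω => f ω + g ω) ω =
      (expect p nx)^[a] f ω + (expect p nx)^[a] g ω := by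
  induction a generalizing f g with
  | zero => rfl
  | succ a ih =>
    simp only [Function.iterate_succ, Function.comp]
    rw [← ih, show (expect p nx fun ω => f ω + g ω) = fun ω => expect p nx f ω + expect p nx g ω from
      funext fun ω => rexp_add _ _ _]

theorem expect_iterate_const (c : ℝ) (a : ℕ) (ω : Ω) :
    (expect p nx)^[a] (fun _ => c) ω = c := by
  induction a with
  | zero => rfl
  | succ a ih =>
    rw [Function.iterate_succ, Function.comp]
    convert ih using 2
    funext ω
    exact rexp_const _ _

/-- From every state in `I`, the chain is in `J` after `a` steps, except with probability at most
`δ`. -/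
def Leads (a : ℕ) (I J : Ω → Prop) (δ : ℝ) : Prop :=
  ∀ ω, I ω → (expect p nx)^[a] (fun ω => ind (¬J ω)) ω ≤ δ

variable {p nx}

theorem Leads.mono {a : ℕ} {I I' J J' : Ω → Prop} {δ δ' : ℝ} (h : Leads p nx a I J δ)
    (hI : ∀ ω, I' ω → I ω) (hJ : ∀ ω, J ω → J' ω) (hδ : δ ≤ δ') : Leads p nx a I' J' δ' :=
  fun ω hω => (expect_iterate_mono p nx (fun ω => ind_mono (mt (hJ ω))) a ω).trans
    ((h ω (hI ω hω)).trans hδ)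

theorem Leads.refl (I : Ω → Prop) : Leads p nx 0 I I 0 := fun ω hω => by
  simp [ind, hω]

/-- The Markov property: from a state in `J` the second stretch fails with probability at most `δ'`,
and from any other state failure is bounded by `1`. Hence `ind (¬J) + δ'` dominates the failure
after the first stretch. -/
theorem Leads.trans {a b : ℕ} {I J R : Ω → Prop} {δ δ' : ℝ} (h : Leads p nx a I J δ)
    (h' : Leads p nx b J R δ') (hδ : 0 ≤ δ') : Leads p nx (a + b) I R (δ + δ') := by
  intro ω hω
  rw [Function.iterate_add_apply]
  calc (expect p nx)^[a] ((expect p nx)^[b] fun ω => ind (¬R ω)) ω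
      ≤ (expect p nx)^[a] (fun ω => ind (¬J ω) + δ') ω := by
        refine expect_iterate_mono p nx (fun ω => ?_) a ω
        by_cases hJ : J ω
        · have := h' ω hJ
          linarith [ind_nonneg (¬J ω)]
        · rw [ind_of hJ]
          have := expect_iterate_mono p nx (f := fun ω => ind (¬R ω)) (g := fun _ => 1)
            (fun ω => ind_le_one _) b ω
          rw [expect_iterate_const] at this
          linarith
    _ ≤ δ + δ' := by
        rw [expect_iterate_add, expect_iterate_const]
        linarith [h ω hω]

theorem Leads.and {a : ℕ} {I J J' : Ω → Prop} {δ δ' : ℝ} (h : Leads p nx a I J δ)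
    (h' : Leads p nx a I J' δ') : Leads p nx a I (fun ω => J ω ∧ J' ω) (δ + δ') := by
  intro ω hω
  refine (expect_iterate_mono p nx (g := fun ω => ind (¬J ω) + ind (¬J' ω)) (fun ω => ?_) a ω).trans
    ?_
  · exact (ind_mono (by tauto)).trans (ind_or_le (¬J ω) (¬J' ω))
  · rw [expect_iterate_add]
    linarith [h ω hω, h' ω hω]

theorem Leads.forall_finset {ι : Type*} {a : ℕ} {I : Ω → Prop} {J : ι → Ω → Prop} {δ : ℝ}
    (s : Finset ι) (h : ∀ i ∈ s, Leads p nx a I (J i) δ) :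
    Leads p nx a I (fun ω => ∀ i ∈ s, J i ω) (s.card * δ) := by
  classical
  induction s using Finset.induction_on with
  | empty =>
    intro ω _
    simp only [Finset.notMem_empty, false_imp_iff, implies_true, not_true_eq_false]
    rw [show (fun _ : Ω => ind False) = fun _ => 0 from funext fun _ => by simp [ind],
      expect_iterate_const]
    simp
  | insert i s hi ih =>
    have h1 := (h i (by simp)).and (ih fun j hj => h j (by simp [hj]))
    refine h1.mono (fun _ h => h) (fun ω hω j hj => ?_) ?_
    · rcases Finset.mem_insert.1 hj with rfl | hj
      · exact hω.1
      · exact hω.2 j hj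
    · rw [Finset.card_insert_of_notMem hi]
      push_cast
      linarith

theorem Leads.step {I J : Ω → Prop}
    (h : ∀ ω, I ω → ∀ T : Finset (Fin n), (∀ v ∈ T, p ω v ≠ 0) → J (nx ω T)) :
    Leads p nx 1 I J 0 := by
  intro ω hω
  refine (rexp_mono (p ω) (g := fun _ => 0) fun T hT => ?_).trans (rexp_const _ _).le
  exact (ind_of_not (not_not.2 (h ω hω T hT))).le

theorem Leads.of_invariant {I : ℕ → Ω → Prop} {a : ℕ}
    (h : ∀ i < a, ∀ ω, I i ω → ∀ T : Finset (Fin n), (∀ v ∈ T, p ω v ≠ 0) → I (i + 1) (nx ω T)) :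
    Leads p nx a (I 0) (I a) 0 := by
  induction a with
  | zero => exact Leads.refl _
  | succ a ih =>
    have := (ih fun i hi => h i (by omega)).trans (Leads.step (h a (by omega))) le_rfl
    simpa using this

theorem Leads.iterate {I : ℕ → Ω → Prop} {a b : ℕ} {δ : ℝ} (hδ : 0 ≤ δ)
    (h : ∀ i < b, Leads p nx a (I i) (I (i + 1)) δ) :
    Leads p nx (b * a) (I 0) (I b) (b * δ) := by
  induction b with
  | zero => simpa using Leads.refl (p := p) (nx := nx) (I 0)
  | succ b ih =>
    have := (ih fun i hi => h i (by omega)).trans (h b (by omega)) hδ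
    rw [add_mul, one_mul]
    refine this.mono (fun _ h => h) (fun _ h => h) ?_
    push_cast
    linarith

/-- If a potential is multiplied by `g T` in every step, up to the last one, and the transmission
probabilities do not change, then its expectation decreases geometrically. -/
theorem expect_iterate_le_of_potential {I : ℕ → Ω → Prop} {ℓ : ℕ} {φ : Ω → ℝ} {B : Ω → Prop}
    {q : Fin n → unitInterval} {g : Finset (Fin n) → ℝ} {r : ℝ} (hφ : ∀ ω, 0 ≤ φ ω)
    (hr : rexp q g ≤ r) (hr0 : 0 ≤ r)
    (hq : ∀ i < ℓ, ∀ ω, I i ω → p ω = q)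
    (hstep : ∀ i, i + 1 < ℓ → ∀ ω, I i ω → ∀ T : Finset (Fin n), (∀ v ∈ T, q v ≠ 0) →
      I (i + 1) (nx ω T) ∧ φ (nx ω T) ≤ φ ω * g T)
    (hlast : ∀ i, i + 1 = ℓ → ∀ ω, I i ω → ∀ T : Finset (Fin n), (∀ v ∈ T, q v ≠ 0) →
      ind (B (nx ω T)) ≤ φ ω * g T) :
    ∀ (m i : ℕ), i + (m + 1) = ℓ → ∀ ω, I i ω →
      (expect p nx)^[m + 1] (fun ω => ind (B ω)) ω ≤ φ ω * r ^ (m + 1) := by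
  intro m
  induction m with
  -- The last round is the base case and uses `hlast` instead of `hstep`: in a test the counter is
  -- reset in that round, so the potential afterwards no longer records it.
  | zero =>
    intro i hi ω hω
    simp only [zero_add, Function.iterate_one, pow_one]
    rw [expect, hq i (by omega) ω hω]
    refine (rexp_mono q fun T hT => hlast i (by omega) ω hω T hT).trans ?_
    rw [rexp_const_mul]
    exact mul_le_mul_of_nonneg_left hr (hφ ω)
  | succ m ih =>
    intro i hi ω hω
    rw [Function.iterate_succ_apply', expect, hq i (by omega) ω hω]
    calc rexp q (fun T => (expect p nx)^[m + 1] (fun ω => ind (B ω)) (nx ω T))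
        ≤ rexp q (fun T => (φ ω * r ^ (m + 1)) * g T) := by
          refine rexp_mono q fun T hT => ?_
          obtain ⟨h1, h2⟩ := hstep i (by omega) ω hω T hT
          refine (ih (i + 1) (by omega) _ h1).trans ?_
          have := mul_le_mul_of_nonneg_right h2 (pow_nonneg hr0 (m + 1))
          linarith
      _ = (φ ω * r ^ (m + 1)) * rexp q g := rexp_const_mul _ _ _
      _ ≤ (φ ω * r ^ (m + 1)) * r :=
          mul_le_mul_of_nonneg_left hr (mul_nonneg (hφ ω) (pow_nonneg hr0 _))
      _ = φ ω * r ^ (m + 1 + 1) := by ring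

end Chain

/-! ### The law of a run -/

section Run

variable {Msg : Type} {X : Type*} [MetricSpace X] {n : ℕ}

theorem tsum_randomSet_mul (p : Fin n → unitInterval) {f : Finset (Fin n) → ℝ}
    (hf : ∀ T, 0 ≤ f T) :
    ∑' T, randomSet p T * ENNReal.ofReal (f T) = ENNReal.ofReal (rexp p f) := by
  rw [tsum_fintype, rexp, ENNReal.ofReal_sum_of_nonneg
    fun T _ => mul_nonneg (setWeight_nonneg p T) (hf T)]
  refine Finset.sum_congr rfl fun T _ => ?_
  rw [ENNReal.ofReal_mul (setWeight_nonneg p T)]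
  rfl

/-- The transmission probabilities of all stations. -/
noncomputable def Protocol.txProbs (A : Protocol Msg) (cfg : A.Config n) (v : Fin n) :
    unitInterval :=
  A.stationTxProb (cfg v)

/-- The forward law of the run is dual to the backward iteration of `expect`. The recursion peels
off the last round of the run, which is the first application of `expect` to `f`; the induction
therefore runs over all `f`. -/
theorem tsum_run_mul (A : Protocol Msg) (M : SINRParams) (pos : Fin n → X) (s : Fin n) (m : Msg)
    (t : ℕ) {f : A.Config n → ℝ} (hf : ∀ cfg, 0 ≤ f cfg) :
    ∑' cfg, A.run M pos s m t cfg * ENNReal.ofReal (f cfg) =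
      ENNReal.ofReal ((expect A.txProbs (A.next M pos))^[t] f (A.initConfig s m)) := by
  classical
  induction t generalizing f with
  | zero =>
    simp only [Protocol.run, Function.iterate_zero, id]
    rw [tsum_eq_single (A.initConfig s m)]
    · simp
    · intro c hc
      simp [hc]
  | succ t ih =>
    have h0 : ∀ cfg, 0 ≤ expect A.txProbs (A.next M pos) f cfg := by
      intro cfg
      rw [expect, rexp]
      exact Finset.sum_nonneg fun T _ => mul_nonneg (setWeight_nonneg _ T) (hf _)
    rw [Function.iterate_succ_apply, ← ih h0]
    simp only [Protocol.run, PMF.bind_apply, PMF.map_apply]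
    simp_rw [← ENNReal.tsum_mul_right]
    rw [ENNReal.tsum_comm]
    refine tsum_congr fun c => ?_
    simp_rw [mul_assoc]
    rw [ENNReal.tsum_mul_left]
    congr 1
    rw [expect, ← tsum_randomSet_mul _ (fun T => hf _)]
    simp_rw [← ENNReal.tsum_mul_right]
    rw [ENNReal.tsum_comm]
    refine tsum_congr fun T => ?_
    rw [tsum_eq_single (A.next M pos c T)]
    · simp; rfl
    · intro c' hc'
      simp [hc']

theorem toReal_run_eq (A : Protocol Msg) (M : SINRParams) (pos : Fin n → X) (s : Fin n) (m : Msg)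
    (t : ℕ) (B : A.Config n → Prop) :
    ((A.run M pos s m t).toOuterMeasure {cfg | B cfg}).toReal =
      (expect A.txProbs (A.next M pos))^[t] (fun cfg => ind (B cfg)) (A.initConfig s m) := by
  have h := tsum_run_mul A M pos s m t (f := fun cfg => ind (B cfg)) fun _ => ind_nonneg _
  have h0 : 0 ≤ (expect A.txProbs (A.next M pos))^[t] (fun cfg => ind (B cfg))
      (A.initConfig s m) := by
    have := expect_iterate_mono A.txProbs (A.next M pos) (f := fun _ => 0)
      (g := fun cfg => ind (B cfg)) (fun _ => ind_nonneg _) t (A.initConfig s m)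
    rwa [expect_iterate_const] at this
  rw [PMF.toOuterMeasure_apply, ← ENNReal.toReal_ofReal h0, ← h]
  congr 1
  refine tsum_congr fun c => ?_
  by_cases hc : B c
  · simp [hc, ind]
  · simp [hc, ind]

end Run

/-! ### Reception in a single round -/

section Reception

variable {X : Type*} [MetricSpace X] {n : ℕ}

namespace SINRParams

variable {M : SINRParams} {pos : Fin n → X}

theorem power_pos (hβ : 1 ≤ M.β) (hN : 0 < M.noise) : 0 < M.power :=
  mul_pos hN (by linarith)

theorem signal_nonneg (hβ : 1 ≤ M.β) (hN : 0 < M.noise) (w u : Fin n) :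
    0 ≤ M.signal pos w u :=
  mul_nonneg (power_pos hβ hN).le (Real.rpow_nonneg dist_nonneg _)

theorem Receives.mul_le (hβ : 1 ≤ M.β) (hN : 0 < M.noise) {T : Finset (Fin n)} {v u : Fin n}
    (h : M.Receives pos T v u) :
    M.β * (M.noise + ∑ w ∈ T.erase v, M.signal pos w u) ≤ M.signal pos v u := by
  have hpos : 0 < M.noise + ∑ w ∈ T.erase v, M.signal pos w u :=
    add_pos_of_pos_of_nonneg hN (Finset.sum_nonneg fun w _ => signal_nonneg hβ hN w u)
  exact (le_div_iff₀ hpos).1 h.2.2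

/-- A station only receives messages of stations in its communication range. -/
theorem Receives.dist_le (hβ : 1 ≤ M.β) (hN : 0 < M.noise) (hα : 0 < M.α) {T : Finset (Fin n)}
    {v u : Fin n} (h : M.Receives pos T v u) : dist (pos v) (pos u) ≤ 1 := by
  by_contra! hd
  have h1 := h.mul_le hβ hN
  have h2 : dist (pos v) (pos u) ^ (-M.α) < 1 :=
    Real.rpow_lt_one_of_one_lt_of_neg hd (by linarith)
  have h3 : 0 ≤ ∑ w ∈ T.erase v, M.signal pos w u :=
    Finset.sum_nonneg fun w _ => signal_nonneg hβ hN w u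
  have h4 : M.signal pos v u < M.power := by
    have := mul_lt_mul_of_pos_left h2 (power_pos hβ hN)
    rwa [mul_one] at this
  have h5 : M.power = M.noise * M.β := rfl
  nlinarith

/-- `u` receives the message of some station if `T` is the set of transmitting stations. -/
def Receives' (M : SINRParams) (pos : Fin n → X) (T : Finset (Fin n)) (u : Fin n) : Prop :=
  ∃ v, M.Receives pos T v u

/-- `u` transmits or receives a message if `T` is the set of transmitting stations. -/
def Hears (M : SINRParams) (pos : Fin n → X) (T : Finset (Fin n)) (u : Fin n) : Prop :=
  u ∈ T ∨ M.Receives' pos T u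

/-- The stations in `Q` at distance at most `r` from the point `x`. -/
noncomputable def nbhd (pos : Fin n → X) (Q : Finset (Fin n)) (x : X) (r : ℝ) : Finset (Fin n) :=
  open Classical in Q.filter fun v => dist (pos v) x ≤ r

theorem mem_nbhd {Q : Finset (Fin n)} {x : X} {r : ℝ} {v : Fin n} :
    v ∈ nbhd pos Q x r ↔ v ∈ Q ∧ dist (pos v) x ≤ r := by
  simp [nbhd]

theorem nbhd_mono {Q Q' : Finset (Fin n)} {x : X} {r r' : ℝ} (hQ : Q ⊆ Q') (hr : r ≤ r') :
    nbhd pos Q x r ⊆ nbhd pos Q' x r' := fun _ h =>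
  mem_nbhd.2 ⟨hQ (mem_nbhd.1 h).1, (mem_nbhd.1 h).2.trans hr⟩

/-- A lower bound for the probability that `u` receives a message: `W` is a set of near stations,
`F` a set that contains all near stations, and the interference of the other stations is small on
average. -/
theorem rprob_receives_ge (hβ : 1 ≤ M.β) (hN : 0 < M.noise) (p : Fin n → unitInterval)
    {u : Fin n} {F W : Finset (Fin n)} {B : ℝ} (hB : 0 < B) (hu : u ∈ F) (huW : u ∉ W)
    (hWF : W ⊆ F) (hW : ∀ w ∈ W, M.β * (M.noise + B) ≤ M.signal pos w u)
    (hfar : ∑ z ∈ Finset.univ \ F, (p z : ℝ) * M.signal pos z u ≤ B / 2) :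
    (∑ w ∈ W, (p w : ℝ)) * (∏ z ∈ F, (1 - (p z : ℝ))) / 2 ≤
      rprob p fun T => M.Receives' pos T u := by
  classical
  set s : Fin n → ℝ := fun z => M.signal pos z u with hs
  have hs0 : ∀ z, 0 ≤ s z := fun z => signal_nonneg hβ hN z u
  -- `cyl w` says that `w` is the only transmitter in `F`. For different `w` in `W` these events
  -- exclude each other.
  set cyl : Fin n → Finset (Fin n) → Prop := fun w T => {w} ⊆ T ∧ Disjoint (F.erase w) T with hcyl
  have hcyl_uniq : ∀ T, ∀ w ∈ W, ∀ w' ∈ W, cyl w T → cyl w' T → w = w' := by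
    intro T w hw w' hw' h h'
    by_contra hne
    exact Finset.disjoint_left.1 h.2 (Finset.mem_erase.2 ⟨Ne.symm hne, hWF hw'⟩)
      (Finset.singleton_subset_iff.1 h'.1)
  -- A pointwise form of Markov's inequality. On `cyl w` all interferers lie outside `F`; if they
  -- contribute more than `B` in total, the subtracted sum exceeds `1` and the left side is
  -- negative, and otherwise `u` receives from `w`.
  have h1 : ∀ T, ∑ w ∈ W, (ind (cyl w T) -
      (∑ z ∈ Finset.univ \ F, s z / B * ind ({w, z} ⊆ T ∧ Disjoint (F.erase w) T))) ≤
        ind (M.Receives' pos T u) := by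
    intro T
    by_cases hex : ∃ w ∈ W, cyl w T
    · obtain ⟨w, hw, hwT⟩ := hex
      rw [Finset.sum_eq_single w]
      · rw [ind_of hwT]
        have hwT' : w ∈ T := Finset.singleton_subset_iff.1 hwT.1
        by_cases hI : ∑ z ∈ T.erase w, s z ≤ B
        · rw [ind_of]
          · have : 0 ≤ ∑ z ∈ Finset.univ \ F,
                s z / B * ind ({w, z} ⊆ T ∧ Disjoint (F.erase w) T) :=
              Finset.sum_nonneg fun z _ =>
                mul_nonneg (div_nonneg (hs0 z) hB.le) (ind_nonneg _)
            linarith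
          · refine ⟨w, hwT', ?_, ?_⟩
            · intro huT
              exact Finset.disjoint_left.1 hwT.2
                (Finset.mem_erase.2 ⟨fun h : u = w => huW (h ▸ hw), hu⟩) huT
            · rw [sinr, le_div_iff₀ (add_pos_of_pos_of_nonneg hN
                (Finset.sum_nonneg fun z _ => hs0 z))]
              refine le_trans ?_ (hW w hw)
              refine mul_le_mul_of_nonneg_left ?_ (by linarith)
              linarith
        · have h2 : ∑ z ∈ T.erase w, s z ≤
              B * ∑ z ∈ Finset.univ \ F, s z / B * ind ({w, z} ⊆ T ∧ Disjoint (F.erase w) T) := by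
            rw [Finset.mul_sum]
            have hsub : T.erase w ⊆ Finset.univ \ F := by
              intro z hz
              rw [Finset.mem_erase] at hz
              simp only [Finset.mem_sdiff, Finset.mem_univ, true_and]
              exact fun hzF => Finset.disjoint_left.1 hwT.2
                (Finset.mem_erase.2 ⟨hz.1, hzF⟩) hz.2
            refine (Finset.sum_le_sum fun z hz => ?_).trans
              (Finset.sum_le_sum_of_subset_of_nonneg hsub fun z _ _ =>
                mul_nonneg hB.le (mul_nonneg (div_nonneg (hs0 z) hB.le) (ind_nonneg _)))
            have hwz : {w, z} ⊆ T := by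
              intro x hx
              rcases Finset.mem_insert.1 hx with rfl | hx
              · exact hwT'
              · rw [Finset.mem_singleton.1 hx]; exact (Finset.mem_erase.1 hz).2
            rw [ind_of ⟨hwz, hwT.2⟩, mul_one]
            exact le_of_eq (by field_simp)
          push Not at hI
          have h3 : 1 < ∑ z ∈ Finset.univ \ F,
              s z / B * ind ({w, z} ⊆ T ∧ Disjoint (F.erase w) T) := by
            by_contra! hle
            nlinarith
          linarith [ind_nonneg (M.Receives' pos T u)]
      · intro w' hw' hne
        have hn : ¬cyl w' T := fun h => hne (hcyl_uniq T w' hw' w hw h hwT)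
        rw [ind_of_not hn, Finset.sum_eq_zero, sub_zero]
        intro z _
        rw [ind_of_not, mul_zero]
        exact fun h => hn ⟨(Finset.singleton_subset_iff.2 (h.1 (by simp))), h.2⟩
      · exact fun h => (h hw).elim
    · push Not at hex
      rw [Finset.sum_eq_zero]
      · exact ind_nonneg _
      · intro w hw
        rw [ind_of_not (hex w hw), Finset.sum_eq_zero, sub_zero]
        intro z _
        rw [ind_of_not, mul_zero]
        exact fun h => hex w hw ⟨(Finset.singleton_subset_iff.2 (h.1 (by simp))), h.2⟩
  refine le_trans ?_ (rexp_mono p fun T _ => h1 T)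
  rw [rexp_sum, Finset.sum_mul, Finset.sum_div]
  refine Finset.sum_le_sum fun w hw => ?_
  rw [rexp_sub, rexp_sum]
  set a : ℝ := p w * ∏ z ∈ F.erase w, (1 - (p z : ℝ)) with ha
  have ha0 : 0 ≤ a := mul_nonneg (p w).2.1
    (Finset.prod_nonneg fun z _ => sub_nonneg.2 (p z).2.2)
  have e1 : rexp p (fun T => ind (cyl w T)) = a := by
    have := rprob_cylinder p (A := {w}) (B := F.erase w) (by simp)
    rw [Finset.prod_singleton] at this
    exact this
  -- A station `z` outside `F` is independent of `cyl w`, so the mean interference given `cyl w` is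
  -- still at most `B / 2`. Half of the probability of `cyl w` survives.
  have e2 : ∀ z ∈ Finset.univ \ F,
      rexp p (fun T => s z / B * ind ({w, z} ⊆ T ∧ Disjoint (F.erase w) T)) =
        (p z * s z) * (a / B) := by
    intro z hz
    have hzF : z ∉ F := (Finset.mem_sdiff.1 hz).2
    have hwz : w ≠ z := fun h => hzF (h ▸ hWF hw)
    have := rprob_cylinder p (A := {w, z}) (B := F.erase w) (by simp [hzF])
    rw [rexp_const_mul]
    rw [rprob] at this
    rw [this, Finset.prod_pair hwz]
    rw [ha]
    ring
  rw [e1, Finset.sum_congr rfl e2, ← Finset.sum_mul]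
  have h3 : (∑ z ∈ Finset.univ \ F, (p z : ℝ) * s z) * (a / B) ≤ B / 2 * (a / B) :=
    mul_le_mul_of_nonneg_right hfar (div_nonneg ha0 hB.le)
  have h4 : B / 2 * (a / B) = a / 2 := by field_simp
  have h5 : (p w : ℝ) * ∏ z ∈ F, (1 - (p z : ℝ)) ≤ a := by
    rw [ha, ← Finset.mul_prod_erase F _ (hWF hw)]
    refine mul_le_mul_of_nonneg_left ?_ (p w).2.1
    refine mul_le_of_le_one_left (Finset.prod_nonneg fun z _ => sub_nonneg.2 (p z).2.2) ?_
    linarith [(p w).2.1]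
  linarith

/-- The probability of hearing is at most the total transmission probability in the range. -/
theorem rprob_hears_le_sum (hβ : 1 ≤ M.β) (hN : 0 < M.noise) (hα : 0 < M.α)
    (p : Fin n → unitInterval) {Q : Finset (Fin n)} (hQ : ∀ v, p v ≠ 0 → v ∈ Q) (u : Fin n) :
    rprob p (fun T => M.Hears pos T u) ≤ ∑ v ∈ nbhd pos Q (pos u) 1, (p v : ℝ) := by
  refine (rprob_mono p fun T hT h => ?_).trans (rprob_exists_mem_le p _)
  rcases h with h | ⟨v, h⟩
  · exact ⟨u, mem_nbhd.2 ⟨hQ u (hT u h), by simp⟩, h⟩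
  · exact ⟨v, mem_nbhd.2 ⟨hQ v (hT v h.1), h.dist_le hβ hN hα⟩, h.1⟩

/-- If there are few transmitters near `u` on average, but many in its range, then `u` hears
a message only with small probability. -/
theorem rprob_hears_le_near_add (hβ : 1 ≤ M.β) (hN : 0 < M.noise) (hα : 0 < M.α)
    (p : Fin n → unitInterval) {Q : Finset (Fin n)} (hQ : ∀ v, p v ≠ 0 → v ∈ Q) (u : Fin n)
    (hinj : Function.Injective pos) {r : ℝ} (hr : 0 < r) :
    rprob p (fun T => M.Hears pos T u) ≤ ∑ v ∈ nbhd pos Q (pos u) r, (p v : ℝ) +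
      2 ^ (1 + r ^ (-M.α)) *
        Real.exp (-(∑ v ∈ nbhd pos Q (pos u) 1, (p v : ℝ)) / 2) := by
  classical
  refine (rprob_mono p (R := fun T => (∃ v ∈ nbhd pos Q (pos u) r, v ∈ T) ∨
    ((T ∩ nbhd pos Q (pos u) 1).card : ℝ) ≤ 1 + r ^ (-M.α)) fun T hT h => ?_).trans
    ((rprob_or_le p _ _).trans (add_le_add (rprob_exists_mem_le p _) (rprob_card_le p _ _)))
  -- With no transmitter within `r`, the station `u` does not transmit, and the sender it hears is
  -- farther than `r`. Its signal is too weak to beat more than `r ^ (-α)` other transmitters in the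
  -- unit ball, each of which contributes at least `power`.
  by_cases hnear : ∃ v ∈ nbhd pos Q (pos u) r, v ∈ T
  · exact Or.inl hnear
  right
  push Not at hnear
  have huT : u ∉ T := fun huT =>
    hnear u (mem_nbhd.2 ⟨hQ u (hT u huT), by simpa using hr.le⟩) huT
  obtain ⟨v, hv⟩ := h.resolve_left huT
  have hvr : r < dist (pos v) (pos u) := by
    by_contra! hle
    exact hnear v (mem_nbhd.2 ⟨hQ v (hT v hv.1), hle⟩) hv.1
  have hP := power_pos hβ hN
  have h1 := hv.mul_le hβ hN
  have h2 : M.signal pos v u ≤ M.power * r ^ (-M.α) :=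
    mul_le_mul_of_nonneg_left (Real.rpow_le_rpow_of_nonpos hr hvr.le (by linarith)) hP.le
  have h3 : ∑ w ∈ (T ∩ nbhd pos Q (pos u) 1).erase v, M.power ≤
      ∑ w ∈ T.erase v, M.signal pos w u := by
    refine (Finset.sum_le_sum fun w hw => ?_).trans
      (Finset.sum_le_sum_of_subset_of_nonneg
        (Finset.erase_subset_erase v Finset.inter_subset_left)
        fun w _ _ => signal_nonneg hβ hN w u)
    obtain ⟨hwv, hw⟩ := Finset.mem_erase.1 hw
    obtain ⟨hwT, hw⟩ := Finset.mem_inter.1 hw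
    have hd := (mem_nbhd.1 hw).2
    have hne : pos w ≠ pos u := fun h => huT (hinj h ▸ hwT)
    have : 1 ≤ dist (pos w) (pos u) ^ (-M.α) :=
      Real.one_le_rpow_of_pos_of_le_one_of_nonpos (dist_pos.2 hne) hd (by linarith)
    calc M.power = M.power * 1 := (mul_one _).symm
      _ ≤ _ := mul_le_mul_of_nonneg_left this hP.le
  rw [Finset.sum_const, nsmul_eq_mul] at h3
  have h4 : ((T ∩ nbhd pos Q (pos u) 1).card : ℝ) ≤
      ((T ∩ nbhd pos Q (pos u) 1).erase v).card + 1 := by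
    have := Finset.pred_card_le_card_erase (s := T ∩ nbhd pos Q (pos u) 1) (a := v)
    exact_mod_cast (by omega : (T ∩ nbhd pos Q (pos u) 1).card ≤
      ((T ∩ nbhd pos Q (pos u) 1).erase v).card + 1)
  set c : ℝ := (((T ∩ nbhd pos Q (pos u) 1).erase v).card : ℝ)
  -- Here `β ≥ 1` enters: the interference is at most `β` times noise plus interference, hence at
  -- most the signal of `v`.
  have h5 : M.power * c ≤ M.power * r ^ (-M.α) := by
    set I := ∑ w ∈ T.erase v, M.signal pos w u
    have hc : 0 ≤ c := Nat.cast_nonneg _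
    have hI : 0 ≤ I := (mul_nonneg hc hP.le).trans h3
    have := mul_nonneg (sub_nonneg.2 hβ) (add_nonneg hN.le hI)
    linarith
  have h6 := le_of_mul_le_mul_left h5 hP
  linarith

/-! ### Bounded growth -/

/-- A bound for the weight of all balls of radius `d` gives a bound for larger balls. -/
theorem sum_nbhd_le {γ κ : ℝ} (hX : BoundedGrowth X γ κ) {w : Fin n → ℝ} (hw : ∀ z, 0 ≤ w z)
    {Q : Finset (Fin n)} {d μ : ℝ} (hd : 0 < d) (hμ : 0 ≤ μ)
    (h : ∀ y, ∑ z ∈ nbhd pos Q y d, w z ≤ μ) (x : X) {a : ℕ} (ha : 1 ≤ a) :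
    ∑ z ∈ nbhd pos Q x (a * d), w z ≤ κ * (a : ℝ) ^ γ * μ := by
  classical
  obtain ⟨S, hS, hcov⟩ := hX x d hd a ha
  have hsub : nbhd pos Q x (a * d) ⊆ S.biUnion fun y => nbhd pos Q y d := by
    intro z hz
    have : pos z ∈ ⋃ y ∈ S, Metric.closedBall y d := hcov (mem_nbhd.1 hz).2
    simp only [Set.mem_iUnion, Metric.mem_closedBall, exists_prop] at this
    obtain ⟨y, hy, hzy⟩ := this
    exact Finset.mem_biUnion.2 ⟨y, hy, mem_nbhd.2 ⟨(mem_nbhd.1 hz).1, hzy⟩⟩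
  calc ∑ z ∈ nbhd pos Q x (a * d), w z
      ≤ ∑ z ∈ S.biUnion fun y => nbhd pos Q y d, w z :=
        Finset.sum_le_sum_of_subset_of_nonneg hsub fun z _ _ => hw z
    _ ≤ ∑ y ∈ S, ∑ z ∈ nbhd pos Q y d, w z := by
        clear hS hcov hsub
        induction S using Finset.induction_on with
        | empty => simp
        | insert y S hy ih =>
          rw [Finset.biUnion_insert, Finset.sum_insert hy]
          refine le_trans ?_ (add_le_add_right ih _)
          rw [← Finset.sum_union_inter]
          exact le_add_of_nonneg_right (Finset.sum_nonneg fun z _ => hw z)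
    _ ≤ ∑ y ∈ S, μ := Finset.sum_le_sum fun y _ => h y
    _ = S.card * μ := by rw [Finset.sum_const, nsmul_eq_mul]
    _ ≤ κ * (a : ℝ) ^ γ * μ := mul_le_mul_of_nonneg_right hS hμ

/-- The constant in the bound for the interference of far stations. -/
noncomputable def farConst (α γ κ : ℝ) : ℝ := κ * 2 ^ γ / (1 - 2 ^ (γ - α))

/-- If all balls of radius `d` have weight at most `μ`, then the interference at `x` of the
stations at distance more than `ρ * d` is small. -/
theorem sum_far_le {α γ κ : ℝ} (hα : γ < α) (hα0 : 0 < α) (hκ : 0 ≤ κ)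
    (hX : BoundedGrowth X γ κ) {w : Fin n → ℝ} (hw : ∀ z, 0 ≤ w z)
    {Q : Finset (Fin n)} {d μ : ℝ} (hd : 0 < d) (hμ : 0 ≤ μ)
    (h : ∀ y, ∑ z ∈ nbhd pos Q y d, w z ≤ μ) (x : X) {ρ : ℕ} (hρ : 1 ≤ ρ) :
    ∑ z ∈ Q \ nbhd pos Q x (ρ * d), w z * dist (pos z) x ^ (-α) ≤
      farConst α γ κ * ((ρ : ℝ) ^ (γ - α) * d ^ (-α) * μ) := by
  classical
  have hρ0 : (0 : ℝ) < ρ := by exact_mod_cast hρ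
  set e : ℝ := 2 ^ (γ - α) with he
  have he0 : 0 < e := Real.rpow_pos_of_pos (by norm_num) _
  have he1 : e < 1 := Real.rpow_lt_one_of_one_lt_of_neg (by norm_num) (by linarith)
  set G : ℝ := κ * 2 ^ γ * ((ρ : ℝ) ^ (γ - α) * d ^ (-α) * μ) with hG
  have hG0 : 0 ≤ G := by positivity
  -- Dyadic annuli: the ball of radius `ρ * 2^(N+1) * d` has weight of order `(ρ * 2^(N+1))^γ * μ`,
  -- and beyond radius `ρ * 2^N * d` each unit of weight counts at most `(ρ * 2^N * d)^(-α)`. The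
  -- annuli form a geometric series of ratio `2^(γ-α) < 1`.
  have key : ∀ N : ℕ, ∑ z ∈ nbhd pos Q x ((ρ * 2 ^ N : ℕ) * d) \ nbhd pos Q x (ρ * d),
      w z * dist (pos z) x ^ (-α) ≤ G * ∑ i ∈ Finset.range N, e ^ i := by
    intro N
    induction N with
    | zero => simp
    | succ N ih =>
      set r : ℝ := (ρ * 2 ^ N : ℕ) * d with hr
      have hr0 : 0 < r := by positivity
      have hsub : nbhd pos Q x ((ρ * 2 ^ (N + 1) : ℕ) * d) \ nbhd pos Q x (ρ * d) ⊆
          (nbhd pos Q x r \ nbhd pos Q x (ρ * d)) ∪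
            (nbhd pos Q x ((ρ * 2 ^ (N + 1) : ℕ) * d) \ nbhd pos Q x r) := by
        intro z hz
        rw [Finset.mem_sdiff] at hz
        by_cases hzr : z ∈ nbhd pos Q x r
        · exact Finset.mem_union_left _ (Finset.mem_sdiff.2 ⟨hzr, hz.2⟩)
        · exact Finset.mem_union_right _ (Finset.mem_sdiff.2 ⟨hz.1, hzr⟩)
      have hdisj : Disjoint (nbhd pos Q x r \ nbhd pos Q x (ρ * d))
          (nbhd pos Q x ((ρ * 2 ^ (N + 1) : ℕ) * d) \ nbhd pos Q x r) :=
        Finset.disjoint_left.2 fun z h1 h2 =>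
          (Finset.mem_sdiff.1 h2).2 (Finset.mem_sdiff.1 h1).1
      have hterm : ∑ z ∈ nbhd pos Q x ((ρ * 2 ^ (N + 1) : ℕ) * d) \ nbhd pos Q x r,
          w z * dist (pos z) x ^ (-α) ≤ G * e ^ N := by
        calc ∑ z ∈ nbhd pos Q x ((ρ * 2 ^ (N + 1) : ℕ) * d) \ nbhd pos Q x r,
              w z * dist (pos z) x ^ (-α)
            ≤ ∑ z ∈ nbhd pos Q x ((ρ * 2 ^ (N + 1) : ℕ) * d), w z * r ^ (-α) := by
              refine (Finset.sum_le_sum fun z hz => ?_).trans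
                (Finset.sum_le_sum_of_subset_of_nonneg Finset.sdiff_subset fun z _ _ =>
                  mul_nonneg (hw z) (Real.rpow_nonneg hr0.le _))
              refine mul_le_mul_of_nonneg_left ?_ (hw z)
              refine Real.rpow_le_rpow_of_nonpos hr0 ?_ (by linarith)
              rw [Finset.mem_sdiff] at hz
              by_contra! hlt
              exact hz.2 (mem_nbhd.2 ⟨(mem_nbhd.1 hz.1).1, hlt.le⟩)
          _ ≤ κ * ((ρ * 2 ^ (N + 1) : ℕ) : ℝ) ^ γ * μ * r ^ (-α) := by
              rw [← Finset.sum_mul]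
              exact mul_le_mul_of_nonneg_right
                (sum_nbhd_le hX hw hd hμ h x (Nat.one_le_iff_ne_zero.2 (by positivity)))
                (Real.rpow_nonneg hr0.le _)
          _ = G * e ^ N := by
              have e1 : e ^ N = ((2 : ℝ) ^ N) ^ γ * ((2 : ℝ) ^ N) ^ (-α) := by
                rw [← Real.rpow_add (by positivity), ← sub_eq_add_neg, he, ← Real.rpow_natCast,
                  ← Real.rpow_mul (by norm_num), ← Real.rpow_natCast,
                  ← Real.rpow_mul (by norm_num), mul_comm]
              rw [e1, hr, hG]
              push_cast
              rw [Real.mul_rpow (by positivity) hd.le, Real.mul_rpow hρ0.le (by positivity),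
                Real.mul_rpow hρ0.le (by positivity), pow_succ,
                Real.mul_rpow (by positivity) (by norm_num), sub_eq_add_neg,
                Real.rpow_add hρ0]
              ring
      rw [Finset.sum_range_succ, mul_add]
      refine (Finset.sum_le_sum_of_subset_of_nonneg hsub fun z _ _ =>
        mul_nonneg (hw z) (Real.rpow_nonneg dist_nonneg _)).trans ?_
      rw [Finset.sum_union hdisj]
      exact add_le_add ih hterm
  obtain ⟨N, hN⟩ : ∃ N : ℕ, ∀ z ∈ Q, dist (pos z) x ≤ (ρ * 2 ^ N : ℕ) * d := by
    obtain ⟨b, hb⟩ := (Finset.finite_toSet (Finset.univ.image fun z => dist (pos z) x)).bddAbove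
    obtain ⟨N, hN⟩ := exists_nat_gt (b / d)
    refine ⟨N, fun z _ => ?_⟩
    have h1 : dist (pos z) x ≤ b := hb (by simp)
    have h2 : (N : ℝ) ≤ (ρ * 2 ^ N : ℕ) := by
      exact_mod_cast Nat.lt_two_pow_self.le.trans (Nat.le_mul_of_pos_left _ hρ)
    rw [div_lt_iff₀ hd] at hN
    nlinarith
  have hQ : nbhd pos Q x ((ρ * 2 ^ N : ℕ) * d) = Q := by
    ext z
    rw [mem_nbhd]
    exact ⟨fun h => h.1, fun h => ⟨h, hN z h⟩⟩
  have := key N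
  rw [hQ] at this
  refine this.trans ?_
  have hgeom : ∑ i ∈ Finset.range N, e ^ i ≤ 1 / (1 - e) := by
    rw [geom_sum_eq he1.ne, ← neg_div_neg_eq]
    rw [neg_sub, neg_sub]
    exact div_le_div_of_nonneg_right (by linarith [pow_pos he0 N]) (by linarith)
  refine (mul_le_mul_of_nonneg_left hgeom hG0).trans (le_of_eq ?_)
  rw [farConst, hG]
  ring

end SINRParams

end Reception

section Geometry

variable {X : Type*} [MetricSpace X] {n : ℕ}

/-- Every station of `S` transmits with probability `y`, the other stations are silent. -/
noncomputable def uniformOn (S : Finset (Fin n)) (y : unitInterval) (v : Fin n) : unitInterval :=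
  open Classical in if v ∈ S then y else 0

theorem uniformOn_of_mem {S : Finset (Fin n)} {y : unitInterval} {v : Fin n} (h : v ∈ S) :
    uniformOn S y v = y := if_pos h

theorem uniformOn_of_notMem {S : Finset (Fin n)} {y : unitInterval} {v : Fin n} (h : v ∉ S) :
    uniformOn S y v = 0 := if_neg h

theorem mem_of_uniformOn_ne_zero {S : Finset (Fin n)} {y : unitInterval} {v : Fin n}
    (h : uniformOn S y v ≠ 0) : v ∈ S := by
  by_contra hv
  exact h (uniformOn_of_notMem hv)

theorem sum_uniformOn {S A : Finset (Fin n)} (y : unitInterval) (h : A ⊆ S) :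
    ∑ v ∈ A, (uniformOn S y v : ℝ) = y * A.card := by
  rw [Finset.sum_congr rfl fun v hv => by rw [uniformOn_of_mem (h hv)], Finset.sum_const,
    nsmul_eq_mul, mul_comm]

namespace SINRParams

variable {M : SINRParams} {pos : Fin n → X}

/-- A descent to smaller scales: below a ball of radius `2⁻ⁱ⁰` that contains at least `c` stations
there is a smaller one such that no ball of half the radius in its neighbourhood has this
property. -/
theorem exists_heavy_minimal (hinj : Function.Injective pos) (S : Finset (Fin n)) {c L : ℝ}
    (hc : 1 < c) (hL : 0 ≤ L) {v₀ : Fin n} (hv₀ : v₀ ∈ S) {i₀ : ℕ}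
    (h₀ : c ≤ (nbhd pos S (pos v₀) ((1 / 2) ^ i₀)).card) :
    ∃ v ∈ S, ∃ i ≥ i₀, c ≤ (nbhd pos S (pos v) ((1 / 2) ^ i)).card ∧
      dist (pos v) (pos v₀) ≤ 2 * L * (1 / 2) ^ i₀ ∧
      ∀ w ∈ S, dist (pos w) (pos v) ≤ L * (1 / 2) ^ i →
        ((nbhd pos S (pos w) ((1 / 2) ^ (i + 1))).card : ℝ) < c := by
  by_contra! hcon
  -- If no candidate is minimal, the descent never stops. It halves the radius and moves by at most
  -- `L` times the current radius each time, so the moves sum to at most `2 * L * (1/2)^i₀`.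
  have key : ∀ j : ℕ, ∃ v ∈ S, c ≤ (nbhd pos S (pos v) ((1 / 2) ^ (i₀ + j))).card ∧
      dist (pos v) (pos v₀) ≤ 2 * L * ((1 / 2) ^ i₀ - (1 / 2) ^ (i₀ + j)) := by
    intro j
    induction j with
    | zero => exact ⟨v₀, hv₀, h₀, by simp⟩
    | succ j ih =>
      obtain ⟨v, hv, hcv, hd⟩ := ih
      have hpow : (0 : ℝ) ≤ (1 / 2) ^ (i₀ + j) := by positivity
      obtain ⟨w, hw, hwv, hcw⟩ := hcon v hv (i₀ + j) (by omega) hcv (hd.trans (by nlinarith))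
      refine ⟨w, hw, hcw, (dist_triangle _ (pos v) _).trans ((add_le_add hwv hd).trans ?_)⟩
      rw [← add_assoc, pow_succ]
      linarith
  -- Finitely many distinct points have a positive minimal distance. Balls below this scale hold a
  -- single station, fewer than `c`, which contradicts an endless descent.
  obtain ⟨δ, hδ, hsep⟩ : ∃ δ > 0, ∀ v w : Fin n, dist (pos v) (pos w) ≤ δ → v = w := by
    classical
    obtain h | ⟨a, ha⟩ := ((Finset.univ : Finset (Fin n × Fin n)).filter
      fun a => a.1 ≠ a.2).eq_empty_or_nonempty
    · refine ⟨1, one_pos, fun v w _ => ?_⟩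
      by_contra hne
      have : (v, w) ∈ ((Finset.univ : Finset (Fin n × Fin n)).filter fun a => a.1 ≠ a.2) := by
        simp [hne]
      simp [h] at this
    · obtain ⟨b, hb, hmin⟩ := Finset.exists_min_image _
        (fun a : Fin n × Fin n => dist (pos a.1) (pos a.2)) ⟨a, ha⟩
      have hb' : 0 < dist (pos b.1) (pos b.2) :=
        dist_pos.2 fun h => (Finset.mem_filter.1 hb).2 (hinj h)
      refine ⟨dist (pos b.1) (pos b.2) / 2, by linarith, fun v w hvw => ?_⟩
      by_contra hne
      have := hmin (v, w) (by simp [hne])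
      simp only at this
      linarith
  obtain ⟨N, hN⟩ := exists_pow_lt_of_lt_one hδ (by norm_num : (1 / 2 : ℝ) < 1)
  obtain ⟨v, hv, hcv, -⟩ := key N
  have : (nbhd pos S (pos v) ((1 / 2) ^ (i₀ + N))).card ≤ 1 := by
    rw [Finset.card_le_one]
    have hv' : ∀ a ∈ nbhd pos S (pos v) ((1 / 2) ^ (i₀ + N)), a = v := fun a ha =>
      hsep a v ((mem_nbhd.1 ha).2.trans
        ((pow_le_pow_of_le_one (by norm_num) (by norm_num) (by omega)).trans hN.le))
    intro a ha b hb
    rw [hv' a ha, hv' b hb]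
  have : ((nbhd pos S (pos v) ((1 / 2) ^ (i₀ + N))).card : ℝ) ≤ 1 := by exact_mod_cast this
  linarith

theorem farConst_pos {α γ κ : ℝ} (hα : γ < α) (hκ : 0 < κ) : 0 < farConst α γ κ := by
  have : (2 : ℝ) ^ (γ - α) < 1 := Real.rpow_lt_one_of_one_lt_of_neg (by norm_num) (by linarith)
  exact div_pos (by positivity) (by linarith)

/-- The SINR condition after division by `power = noise * β`: in units of `power`, noise times `β`
becomes `1` and interference `b` becomes `β * b`. -/
theorem le_signal (hβ : 1 ≤ M.β) (hN : 0 < M.noise) (hα : 0 < M.α)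
    (hinj : Function.Injective pos) {w u : Fin n} (hne : w ≠ u) {r b : ℝ}
    (hr : dist (pos w) (pos u) ≤ r) (hb : 1 + M.β * b ≤ r ^ (-M.α)) :
    M.β * (M.noise + M.power * b) ≤ M.signal pos w u := by
  have hP := power_pos hβ hN
  have h1 : r ^ (-M.α) ≤ dist (pos w) (pos u) ^ (-M.α) :=
    Real.rpow_le_rpow_of_nonpos (dist_pos.2 (hinj.ne hne)) hr (by linarith)
  have h2 : M.power * (1 + M.β * b) ≤ M.power * dist (pos w) (pos u) ^ (-M.α) :=
    mul_le_mul_of_nonneg_left (hb.trans h1) hP.le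
  refine le_trans (le_of_eq ?_) h2
  rw [power]
  ring

theorem one_sub_sum_le_prod (p : Fin n → unitInterval) (F : Finset (Fin n)) :
    1 - ∑ z ∈ F, (p z : ℝ) ≤ ∏ z ∈ F, (1 - (p z : ℝ)) := by
  classical
  induction F using Finset.induction_on with
  | empty => simp
  | insert a F ha ih =>
    rw [Finset.sum_insert ha, Finset.prod_insert ha]
    have h1 := mul_le_mul_of_nonneg_left ih (sub_nonneg.2 (p a).2.2)
    have h2 : 0 ≤ (p a : ℝ) * ∑ z ∈ F, (p z : ℝ) :=
      mul_nonneg (p a).2.1 (Finset.sum_nonneg fun z _ => (p z).2.1)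
    linarith

/-- If all balls of radius `1` have a small total transmission probability, then a station can
hear all stations which are a little closer than the communication range. -/
theorem rprob_receives_ge_of_unit_balls {γ κ : ℝ} (hβ : 1 ≤ M.β) (hN : 0 < M.noise)
    (hα : γ < M.α) (hα0 : 0 < M.α) (hκ : 0 < κ) (hX : BoundedGrowth X γ κ)
    (hinj : Function.Injective pos) (p : Fin n → unitInterval) {μ : ℝ} (hμ : 0 < μ)
    (hμ1 : μ ≤ 1 / 2) (h : ∀ x, ∑ z ∈ nbhd pos Finset.univ x 1, (p z : ℝ) ≤ μ) {u : Fin n}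
    {W : Finset (Fin n)} {r : ℝ} (hr : r ≤ 1)
    (hW : ∀ w ∈ W, w ≠ u ∧ dist (pos w) (pos u) ≤ r)
    (hnum : 1 + M.β * (2 * farConst M.α γ κ * μ) ≤ r ^ (-M.α)) :
    (∑ w ∈ W, (p w : ℝ)) / 4 ≤ rprob p fun T => M.Receives' pos T u := by
  have hP := power_pos hβ hN
  have hH := farConst_pos hα hκ
  set F := nbhd pos Finset.univ (pos u) 1 with hF
  have hfar := sum_far_le hα hα0 hκ.le hX (w := fun z => (p z : ℝ)) (fun z => (p z).2.1)
    one_pos hμ.le h (pos u) (le_refl 1)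
  simp only [Nat.cast_one, Real.one_rpow, one_mul] at hfar
  -- The tolerated interference `B` is twice the bound `hfar` on the mean, as the hypothesis with `B
  -- / 2` requires.
  have hge := rprob_receives_ge (M := M) (pos := pos) hβ hN p (u := u) (F := F) (W := W)
    (B := M.power * (2 * farConst M.α γ κ * μ)) (by positivity)
    (mem_nbhd.2 ⟨Finset.mem_univ _, by simp⟩) (fun hu => (hW u hu).1 rfl)
    (fun w hw => mem_nbhd.2 ⟨Finset.mem_univ _, (hW w hw).2.trans hr⟩)
    (fun w hw => le_signal hβ hN hα0 hinj (hW w hw).1 (hW w hw).2 hnum)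
    (by
      calc ∑ z ∈ Finset.univ \ F, (p z : ℝ) * M.signal pos z u
          = M.power * ∑ z ∈ Finset.univ \ F, (p z : ℝ) * dist (pos z) (pos u) ^ (-M.α) := by
            rw [Finset.mul_sum]
            exact Finset.sum_congr rfl fun z _ => by rw [signal]; ring
        _ ≤ M.power * (farConst M.α γ κ * μ) := mul_le_mul_of_nonneg_left hfar hP.le
        _ = _ := by ring)
  refine le_trans ?_ hge
  -- The unit ball is silent with probability at least `1 - μ ≥ 1/2`. With the factor `1/2` for far
  -- interference this gives the `1/4`.
  have hprod : 1 / 2 ≤ ∏ z ∈ F, (1 - (p z : ℝ)) := by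
    have := one_sub_sum_le_prod p F
    linarith [h (pos u)]
  have hsum : 0 ≤ ∑ w ∈ W, (p w : ℝ) := Finset.sum_nonneg fun w _ => (p w).2.1
  nlinarith

theorem exp_neg_two_mul_le {y : ℝ} (h0 : 0 ≤ y) (h1 : y ≤ 1 / 2) : Real.exp (-(2 * y)) ≤ 1 - y := by
  rw [Real.exp_neg, inv_le_comm₀ (Real.exp_pos _) (by linarith)]
  refine le_trans ?_ (Real.add_one_le_exp _)
  rw [inv_le_iff_one_le_mul₀ (by linarith)]
  nlinarith

/-- Inside a ball with many transmitters on average such that all smaller balls in the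
neighbourhood contain only few, every station hears a message with constant probability. -/
theorem rprob_receives_ge_of_light {γ κ : ℝ} (hβ : 1 ≤ M.β) (hN : 0 < M.noise)
    (hα : γ < M.α) (hα0 : 0 < M.α) (hκ : 0 < κ) (hX : BoundedGrowth X γ κ)
    (hinj : Function.Injective pos) (S : Finset (Fin n)) {y : unitInterval} (hy : (y : ℝ) ≤ 1 / 4)
    {μ : ℝ} (hμ : 0 < μ) (h : ∀ x, y * ((nbhd pos S x 1).card : ℝ) ≤ μ)
    {v : Fin n} {x L : ℝ} (hx : 0 < x) {ρ : ℕ} (hρ : 2 ≤ ρ) (hL : ρ + 1 ≤ L) (hLx : (L - 1) * x ≤ 1)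
    (hheavy : 1 ≤ y * ((nbhd pos S (pos v) x).card : ℝ))
    (hlight : ∀ w ∈ S, dist (pos w) (pos v) ≤ L * x →
      y * ((nbhd pos S (pos w) (x / 2)).card : ℝ) ≤ 1)
    (hnum : 1 + M.β * (2 * farConst M.α γ κ * (((4 * ρ : ℕ) : ℝ) ^ (γ - M.α) * (x / 4) ^ (-M.α) +
      ((L - 1) * x) ^ (-M.α) * μ)) ≤ (2 * x) ^ (-M.α))
    {u : Fin n} (hu : u ∈ nbhd pos S (pos v) x) :
    3 / 8 * Real.exp (-(2 * (κ * ((4 * ρ : ℕ) : ℝ) ^ γ))) ≤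
      rprob (uniformOn S y) fun T => M.Receives' pos T u := by
  classical
  have hP := power_pos hβ hN
  have hH := farConst_pos hα hκ
  have hy0 := y.2.1
  have hρ' : (2 : ℝ) ≤ ρ := by exact_mod_cast hρ
  obtain ⟨huS, hud⟩ := mem_nbhd.1 hu
  set Q := nbhd pos S (pos v) (L * x) with hQ
  have hQS : Q ⊆ S := fun z hz => (mem_nbhd.1 hz).1
  set F := nbhd pos S (pos u) (ρ * x) with hF
  have hFS : F ⊆ S := fun z hz => (mem_nbhd.1 hz).1
  have hscale : ((4 * ρ : ℕ) : ℝ) * (x / 4) = ρ * x := by push_cast; ring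
  have hFQ : F = nbhd pos Q (pos u) ((4 * ρ : ℕ) * (x / 4)) := by
    rw [hscale]
    ext z
    simp only [hF, hQ, mem_nbhd]
    refine ⟨fun hz => ⟨⟨hz.1, ?_⟩, hz.2⟩, fun hz => ⟨hz.1.1, hz.2⟩⟩
    have := dist_triangle (pos z) (pos u) (pos v)
    nlinarith [hz.2]
  -- Lightness is known only around stations. A ball of radius `x/4` that meets `Q` lies in the ball
  -- of radius `x/2` around a station of `Q`, so arbitrary centres are covered at scale `x/4`; this
  -- is the source of the factors `4 * ρ`.
  have hsmall : ∀ a, ∑ z ∈ nbhd pos Q a (x / 4), (y : ℝ) ≤ 1 := by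
    intro a
    obtain h0 | ⟨w, hw⟩ := (nbhd pos Q a (x / 4)).eq_empty_or_nonempty
    · simp [h0]
    · obtain ⟨hwQ, hwa⟩ := mem_nbhd.1 hw
      refine le_trans ?_ (hlight w (hQS hwQ) (mem_nbhd.1 hwQ).2)
      rw [Finset.sum_const, nsmul_eq_mul, mul_comm]
      refine mul_le_mul_of_nonneg_left ?_ hy0
      refine Nat.cast_le.2 (Finset.card_le_card fun z hz => ?_)
      obtain ⟨hzQ, hza⟩ := mem_nbhd.1 hz
      refine mem_nbhd.2 ⟨hQS hzQ, (dist_triangle_right _ _ a).trans ?_⟩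
      linarith
  have hcardF : y * (F.card : ℝ) ≤ κ * ((4 * ρ : ℕ) : ℝ) ^ γ := by
    have := sum_nbhd_le hX (w := fun _ => (y : ℝ)) (fun _ => hy0) (by positivity) zero_le_one
      hsmall (pos u) (a := 4 * ρ) (by omega)
    rwa [← hFQ, Finset.sum_const, nsmul_eq_mul, mul_comm, mul_one] at this
  set W := (nbhd pos S (pos v) x).erase u with hW
  have hWd : ∀ w ∈ W, w ≠ u ∧ w ∈ S ∧ dist (pos w) (pos u) ≤ 2 * x := by
    intro w hw
    obtain ⟨hwu, hw⟩ := Finset.mem_erase.1 hw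
    refine ⟨hwu, (mem_nbhd.1 hw).1, (dist_triangle_right _ _ (pos v)).trans ?_⟩
    linarith [(mem_nbhd.1 hw).2]
  -- The station `u` cannot receive from itself; removing it costs `y ≤ 1/4`.
  have hWsum : 3 / 4 ≤ y * (W.card : ℝ) := by
    rw [hW, Finset.card_erase_of_mem hu, Nat.cast_sub (Finset.card_pos.2 ⟨u, hu⟩)]
    push_cast
    linarith
  -- Interference is split at distance `L * x` from `v`. Inside, lightness at scale `x/4` controls
  -- it.
  have hfar1 := sum_far_le hα hα0 hκ.le hX (w := fun _ => (y : ℝ)) (fun _ => hy0)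
    (by positivity) zero_le_one hsmall (pos u) (ρ := 4 * ρ) (by omega)
  rw [← hFQ, mul_one] at hfar1
  have hL1 : 0 < (L - 1) * x := mul_pos (by linarith) hx
  -- Outside, a station is at distance more than `(L - 1) * x` from `u`, and only the crude bound
  -- `μ` for unit balls, hence for balls of radius `(L - 1) * x ≤ 1`, is available.
  have hfar2 := sum_far_le hα hα0 hκ.le hX (Q := S) (w := fun _ => (y : ℝ)) (fun _ => hy0) hL1 hμ.le
    (fun a => by
      rw [Finset.sum_const, nsmul_eq_mul, mul_comm]
      refine (mul_le_mul_of_nonneg_left ?_ hy0).trans (h a)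
      exact Nat.cast_le.2 (Finset.card_le_card (nbhd_mono subset_rfl hLx))) (pos u) (le_refl 1)
  simp only [Nat.cast_one, Real.one_rpow, one_mul] at hfar2
  have hge := rprob_receives_ge (M := M) (pos := pos) hβ hN (uniformOn S y) (u := u) (F := F)
    (W := W) (B := M.power * (2 * farConst M.α γ κ * (((4 * ρ : ℕ) : ℝ) ^ (γ - M.α) *
      (x / 4) ^ (-M.α) + ((L - 1) * x) ^ (-M.α) * μ))) (by positivity)
    (mem_nbhd.2 ⟨huS, by rw [dist_self]; positivity⟩) (Finset.notMem_erase _ _)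
    (fun w hw => mem_nbhd.2 ⟨(hWd w hw).2.1, (hWd w hw).2.2.trans (by nlinarith)⟩)
    (fun w hw => le_signal hβ hN hα0 hinj (hWd w hw).1 (hWd w hw).2.2 hnum)
    (by
      set f : Fin n → ℝ := fun z => (y : ℝ) * dist (pos z) (pos u) ^ (-M.α) with hf
      have hf0 : ∀ z, 0 ≤ f z := fun z => mul_nonneg hy0 (Real.rpow_nonneg dist_nonneg _)
      calc ∑ z ∈ Finset.univ \ F, (uniformOn S y z : ℝ) * M.signal pos z u
          = ∑ z ∈ S \ F, (uniformOn S y z : ℝ) * M.signal pos z u := by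
            symm
            refine Finset.sum_subset (Finset.sdiff_subset_sdiff (Finset.subset_univ S) subset_rfl)
              fun z hz hz' => ?_
            have : z ∉ S := fun h => hz' (Finset.mem_sdiff.2 ⟨h, (Finset.mem_sdiff.1 hz).2⟩)
            rw [uniformOn_of_notMem this]
            simp
        _ = M.power * ∑ z ∈ S \ F, f z := by
            rw [Finset.mul_sum]
            refine Finset.sum_congr rfl fun z hz => ?_
            rw [uniformOn_of_mem (Finset.mem_sdiff.1 hz).1, signal, hf]
            ring
        _ ≤ M.power * (∑ z ∈ Q \ F, f z + ∑ z ∈ S \ nbhd pos S (pos u) ((L - 1) * x), f z) := by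
            refine mul_le_mul_of_nonneg_left ?_ hP.le
            rw [← Finset.sum_union_inter]
            refine (Finset.sum_le_sum_of_subset_of_nonneg (fun z hz => ?_) fun z _ _ => hf0 z).trans
              (le_add_of_nonneg_right (Finset.sum_nonneg fun z _ => hf0 z))
            obtain ⟨hzS, hzF⟩ := Finset.mem_sdiff.1 hz
            by_cases hzQ : z ∈ Q
            · exact Finset.mem_union_left _ (Finset.mem_sdiff.2 ⟨hzQ, hzF⟩)
            · refine Finset.mem_union_right _ (Finset.mem_sdiff.2 ⟨hzS, fun hz' => hzQ ?_⟩)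
              refine mem_nbhd.2 ⟨hzS, (dist_triangle _ (pos u) _).trans ?_⟩
              have := (mem_nbhd.1 hz').2
              linarith
        _ ≤ M.power * (farConst M.α γ κ * (((4 * ρ : ℕ) : ℝ) ^ (γ - M.α) * (x / 4) ^ (-M.α)) +
              farConst M.α γ κ * (((L - 1) * x) ^ (-M.α) * μ)) :=
            mul_le_mul_of_nonneg_left (add_le_add hfar1 hfar2) hP.le
        _ = _ := by ring)
  refine le_trans ?_ hge
  rw [sum_uniformOn y fun w hw => (hWd w hw).2.1,
    Finset.prod_congr rfl fun z hz => by rw [uniformOn_of_mem (hFS hz)], Finset.prod_const]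
  have hpow : Real.exp (-(2 * (κ * ((4 * ρ : ℕ) : ℝ) ^ γ))) ≤ (1 - (y : ℝ)) ^ F.card := by
    calc Real.exp (-(2 * (κ * ((4 * ρ : ℕ) : ℝ) ^ γ)))
        ≤ Real.exp (-(2 * (y * F.card))) := Real.exp_le_exp.2 (by linarith)
      _ = Real.exp (-(2 * y)) ^ F.card := by
          rw [← Real.exp_nat_mul]
          congr 1
          ring
      _ ≤ _ := pow_le_pow_left₀ (Real.exp_pos _).le
          (exp_neg_two_mul_le hy0 (by linarith)) _
  have := mul_le_mul hWsum hpow (Real.exp_pos _).le (by positivity)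
  linarith

/-- In a ball of radius `1` with large total transmission probability `p * card` there are many
stations with good chances to hear messages, both if all stations of `S` transmit with
probability `p` and if they transmit with probability `y = cE * p`. -/
theorem exists_subset_receives {γ κ : ℝ} (hβ : 1 ≤ M.β) (hN : 0 < M.noise)
    (hα : γ < M.α) (hα0 : 0 < M.α) (hκ : 0 < κ) (hX : BoundedGrowth X γ κ)
    (hinj : Function.Injective pos) (S : Finset (Fin n)) {p y : unitInterval} {cE C₁ : ℝ}
    (hcE : 0 < cE) (hpy : (y : ℝ) = cE * p) (hy : (y : ℝ) ≤ 1 / 4) (hC₁ : 0 < C₁)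
    (hC₁' : C₁ ≤ 1 / 2) (h : ∀ x, p * ((nbhd pos S x 1).card : ℝ) ≤ C₁) {ρ l : ℕ} (hρ : 2 ≤ ρ)
    (hl : ρ + 1 ≤ 2 ^ l)
    (hnum1 : 1 + M.β * (2 * farConst M.α γ κ * C₁) ≤ (1 / 2) ^ (-M.α))
    (hnum2 : ∀ x : ℝ, 0 < x → x ≤ (1 / 2) ^ (l + 4) →
      1 + M.β * (2 * farConst M.α γ κ * (((4 * ρ : ℕ) : ℝ) ^ (γ - M.α) * (x / 4) ^ (-M.α) +
        ((2 ^ l - 1) * x) ^ (-M.α) * (cE * C₁))) ≤ (2 * x) ^ (-M.α))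
    (hnum3 : 2 * κ * 8 ^ γ * (κ * ((2 ^ (l + 2) : ℕ) : ℝ) ^ γ) ≤ cE * C₁) {x₀ : X}
    (hx₀ : C₁ / 2 < p * ((nbhd pos S x₀ 1).card : ℝ)) :
    ∃ b ⊆ nbhd pos S x₀ 2, 1 ≤ cE * (p * (b.card : ℝ)) ∧ ∀ u ∈ b,
      3 / 16 * (C₁ / (2 * κ * 8 ^ γ)) ≤
        rprob (uniformOn S p) (fun T => M.Receives' pos T u) ∧
      3 / 8 * Real.exp (-(2 * (κ * ((4 * ρ : ℕ) : ℝ) ^ γ))) ≤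
        rprob (uniformOn S y) fun T => M.Receives' pos T u := by
  classical
  have hp0 := p.2.1
  have hmul : ∀ A : Finset (Fin n), ∑ _z ∈ A, (p : ℝ) = p * A.card := fun A => by
    rw [Finset.sum_const, nsmul_eq_mul, mul_comm]
  have h8 : (0 : ℝ) < 8 ^ γ := Real.rpow_pos_of_pos (by norm_num) _
  have hl0 : (0 : ℝ) < ((2 ^ (l + 2) : ℕ) : ℝ) ^ γ := Real.rpow_pos_of_pos (by positivity) _
  set m : ℝ := C₁ / (2 * κ * 8 ^ γ) with hm
  have hm0 : 0 < m := by positivity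
  -- Pigeonhole over a cover by balls of radius `1/8`. Stations clustered this tightly are audible,
  -- in DensityTest, throughout a neighbourhood of the cluster.
  obtain ⟨z, hz⟩ : ∃ z, m < p * ((nbhd pos (nbhd pos S x₀ 1) z (1 / 8)).card : ℝ) := by
    by_contra! hcon
    have := sum_nbhd_le hX (w := fun _ => (p : ℝ)) (fun _ => hp0) (by norm_num) hm0.le
      (fun a => (hmul _).le.trans (hcon a)) x₀ (a := 8) (by norm_num)
    have e : nbhd pos (nbhd pos S x₀ 1) x₀ ((8 : ℕ) * (1 / 8)) = nbhd pos S x₀ 1 := by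
      ext a
      simp only [mem_nbhd]
      norm_num
    rw [e, hmul, hm] at this
    have e2 : κ * ((8 : ℕ) : ℝ) ^ γ * (C₁ / (2 * κ * 8 ^ γ)) = C₁ / 2 := by
      push_cast
      field_simp
    linarith
  set Z := nbhd pos (nbhd pos S x₀ 1) z (1 / 8) with hZ
  have hZS : ∀ a ∈ Z, a ∈ S ∧ dist (pos a) x₀ ≤ 1 ∧ dist (pos a) z ≤ 1 / 8 := fun a ha =>
    ⟨(mem_nbhd.1 (mem_nbhd.1 ha).1).1, (mem_nbhd.1 (mem_nbhd.1 ha).1).2, (mem_nbhd.1 ha).2⟩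
  set d : ℝ := (1 / 2) ^ (l + 5) with hd
  have hd0 : 0 < d := by positivity
  -- A second pigeonhole, at scale `2^(-(l+5))`. By `hnum3` some ball has Playoff mass more than
  -- `1`, so the descent can start at `v₀` with radius `2 * d`.
  obtain ⟨z', hz'⟩ : ∃ z', 1 / cE < p * ((nbhd pos Z z' d).card : ℝ) := by
    by_contra! hcon
    have := sum_nbhd_le hX (w := fun _ => (p : ℝ)) (fun _ => hp0) hd0 (by positivity)
      (fun a => (hmul _).le.trans (hcon a)) z (a := 2 ^ (l + 2)) Nat.one_le_two_pow
    have e0 : ((2 ^ (l + 2) : ℕ) : ℝ) * d = 1 / 8 := by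
      rw [hd]
      push_cast
      rw [show l + 5 = (l + 2) + 3 from rfl, pow_add (1 / 2 : ℝ) (l + 2) 3, ← mul_assoc, ← mul_pow]
      norm_num
    have e : nbhd pos Z z (((2 ^ (l + 2) : ℕ) : ℝ) * d) = Z := by
      rw [e0]
      ext a
      rw [mem_nbhd]
      exact ⟨fun h => h.1, fun h => ⟨h, (hZS a h).2.2⟩⟩
    rw [e, hmul] at this
    have h1 : κ * ((2 ^ (l + 2) : ℕ) : ℝ) ^ γ * (1 / cE) ≤ m := by
      rw [hm, le_div_iff₀ (by positivity), mul_one_div, div_mul_eq_mul_div, div_le_iff₀ hcE]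
      linarith
    linarith
  obtain ⟨v₀, hv₀⟩ : (nbhd pos Z z' d).Nonempty := by
    rw [Finset.nonempty_iff_ne_empty]
    intro h0
    rw [h0] at hz'
    simp only [Finset.card_empty, Nat.cast_zero, mul_zero] at hz'
    have : 0 < 1 / cE := by positivity
    linarith
  have hv₀Z := (mem_nbhd.1 hv₀).1
  have hv₀S := (hZS v₀ hv₀Z).1
  have h2d : (1 / 2 : ℝ) ^ (l + 4) = 2 * d := by
    rw [hd, pow_succ _ (l + 4)]; ring
  have hsub : nbhd pos Z z' d ⊆ nbhd pos S (pos v₀) ((1 / 2) ^ (l + 4)) := by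
    intro a ha
    refine mem_nbhd.2 ⟨(hZS a (mem_nbhd.1 ha).1).1, (dist_triangle_right _ _ z').trans ?_⟩
    linarith [(mem_nbhd.1 ha).2, (mem_nbhd.1 hv₀).2]
  have hp : 0 < (p : ℝ) := by
    rcases hp0.eq_or_lt with h0 | h0
    · rw [← h0, zero_mul] at hz'
      have : 0 < 1 / cE := by positivity
      linarith
    · exact h0
  have hy0 : 0 < (y : ℝ) := by rw [hpy]; positivity
  -- With `c = 1 / y`, heavy means Playoff mass at least `1`. The descent ends within `1/8` of `v₀`,
  -- because `2 * 2^l * 2^(-(l+4)) = 1/8`.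
  obtain ⟨v, hv, i, hi, hheavy, hvd, hlight⟩ := exists_heavy_minimal hinj S (c := 1 / y)
    (L := 2 ^ l) (by rw [lt_div_iff₀ hy0]; linarith) (by positivity) hv₀S (i₀ := l + 4) (by
      rw [div_le_iff₀ hy0, mul_comm, hpy, mul_assoc]
      have h1 : 1 ≤ cE * (p * ((nbhd pos Z z' d).card : ℝ)) := by
        rw [div_lt_iff₀ hcE] at hz'
        linarith
      refine h1.trans ?_
      gcongr)
  set x : ℝ := (1 / 2) ^ i with hx
  have hx0 : 0 < x := by positivity
  have hxd : x ≤ (1 / 2) ^ (l + 4) := pow_le_pow_of_le_one (by norm_num) (by norm_num) hi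
  have hLd : (2 : ℝ) ^ l * (1 / 2) ^ (l + 4) = 1 / 16 := by
    rw [pow_add, ← mul_assoc, ← mul_pow]; norm_num
  have hL1 : (1 : ℝ) ≤ 2 ^ l := one_le_pow₀ (by norm_num)
  have hLx : (2 : ℝ) ^ l * x ≤ 1 / 16 :=
    (mul_le_mul_of_nonneg_left hxd (by positivity)).trans hLd.le
  have hx16 : x ≤ 1 / 16 := (le_mul_of_one_le_left hx0.le hL1).trans hLx
  have hheavy' : 1 ≤ y * ((nbhd pos S (pos v) x).card : ℝ) := by
    rw [div_le_iff₀ hy0] at hheavy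
    linarith
  have hub : ∀ u ∈ nbhd pos S (pos v) x, u ∈ S ∧ dist (pos u) (pos v₀) ≤ 1 / 4 := by
    intro u hu
    refine ⟨(mem_nbhd.1 hu).1, (dist_triangle _ (pos v) _).trans ?_⟩
    have h1 := (mem_nbhd.1 hu).2
    have h2 : 2 * 2 ^ l * (1 / 2 : ℝ) ^ (l + 4) = 1 / 8 := by rw [mul_assoc, hLd]; norm_num
    linarith
  refine ⟨nbhd pos S (pos v) x, fun u hu => mem_nbhd.2 ⟨(hub u hu).1, ?_⟩, ?_, fun u hu => ⟨?_, ?_⟩⟩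
  · refine (dist_triangle _ (pos v₀) _).trans ?_
    linarith [(hub u hu).2, (hZS v₀ hv₀Z).2.1]
  · rw [← mul_assoc, ← hpy]; exact hheavy'
  -- For DensityTest the senders are the cluster `Z`: it lies within `1/4` of `v₀`, and so does `u`,
  -- hence all distances are at most `1/2`.
  · have hW := rprob_receives_ge_of_unit_balls hβ hN hα hα0 hκ hX hinj (uniformOn S p) hC₁ hC₁'
      (fun a => by
        calc ∑ w ∈ nbhd pos Finset.univ a 1, (uniformOn S p w : ℝ)
            = ∑ w ∈ nbhd pos S a 1, (uniformOn S p w : ℝ) := by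
              symm
              refine Finset.sum_subset (nbhd_mono (Finset.subset_univ S) le_rfl) fun w hw hw' => ?_
              rw [uniformOn_of_notMem]
              · simp
              · exact fun hwS => hw' (mem_nbhd.2 ⟨hwS, (mem_nbhd.1 hw).2⟩)
          _ ≤ C₁ := by
              rw [sum_uniformOn p fun w hw => (mem_nbhd.1 hw).1]
              exact h a) (u := u) (W := Z.erase u) (r := 1 / 2) (by norm_num) (fun w hw => by
        refine ⟨Finset.ne_of_mem_erase hw, ?_⟩
        have h1 := (hZS w (Finset.mem_of_mem_erase hw)).2.2
        have h2 := (hZS v₀ hv₀Z).2.2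
        have h3 := (hub u hu).2
        have h4 := dist_triangle_right (pos w) (pos v₀) z
        have h5 := dist_triangle_right (pos w) (pos u) (pos v₀)
        linarith) hnum1
    refine le_trans ?_ hW
    rw [sum_uniformOn p fun w hw => (hZS w (Finset.mem_of_mem_erase hw)).1]
    have h1 : (Z.card : ℝ) ≤ ((Z.erase u).card : ℝ) + 1 := by
      have := Finset.pred_card_le_card_erase (s := Z) (a := u)
      exact_mod_cast (by omega : Z.card ≤ (Z.erase u).card + 1)
    -- If `u` lies in `Z`, its own share is lost. It is at most a quarter of the mass of `Z`, since
    -- `4 * p ≤ 1 / cE` while `Z` has mass more than `1 / cE`; this turns `1/4` into `3/16`.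
    have h2 : 4 * (p : ℝ) ≤ p * Z.card := by
      have h3 : p * ((nbhd pos Z z' d).card : ℝ) ≤ p * Z.card := by
        gcongr
        exact fun a ha => (mem_nbhd.1 ha).1
      have h4 : 4 * (p : ℝ) ≤ 1 / cE := by
        rw [le_div_iff₀ hcE]
        rw [hpy] at hy
        linarith
      linarith
    have h3 := mul_le_mul_of_nonneg_left h1 hp0
    linarith
  · refine rprob_receives_ge_of_light hβ hN hα hα0 hκ hX hinj S hy (μ := cE * C₁) (by positivity)
      (fun a => ?_) (v := v) (L := 2 ^ l) hx0 hρ (by exact_mod_cast hl) ?_ hheavy' ?_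
      (hnum2 x hx0 hxd) hu
    · rw [hpy, mul_assoc]
      exact mul_le_mul_of_nonneg_left (h a) hcE.le
    · linarith
    · intro w hw hwv
      have h1 := hlight w hw hwv
      rw [lt_div_iff₀ hy0, pow_succ, mul_one_div] at h1
      linarith

end SINRParams

end Geometry

/-! ### The dynamics of NoSBroadcast -/

namespace NoSConstants

variable {k : NoSConstants} {n : ℕ}

theorem one_le_logb (hn : 2 ≤ n) : 1 ≤ Real.logb 2 n := by
  rw [Real.le_logb_iff_rpow_le (by norm_num) (by positivity), Real.rpow_one]
  exact_mod_cast hn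

theorem densityLen_pos (hk : k.Positive) (hn : 2 ≤ n) : 0 < k.densityLen n :=
  Nat.ceil_pos.2 (mul_pos hk.1 (by linarith [one_le_logb hn]))

theorem playoffLen_pos (hk : k.Positive) (hn : 2 ≤ n) : 0 < k.playoffLen n :=
  Nat.ceil_pos.2 (mul_pos hk.2.2.1 (by linarith [one_le_logb hn]))

theorem part2Len_pos (hk : k.Positive) (hn : 2 ≤ n) : 0 < k.part2Len n :=
  Nat.ceil_pos.2 (mul_pos hk.2.2.2.2.2.2.2.2.1 (by have := one_le_logb hn; positivity))

end NoSConstants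

section Dynamics

variable {Msg : Type} {X : Type*} [MetricSpace X] {n : ℕ}

/-- The configuration of NoSBroadcast after a round in which `T` is the set of transmitters. -/
noncomputable def nosNext (M : SINRParams) (pos : Fin n → X) (k : NoSConstants)
    (cfg : Fin n → Option (NoSState Msg)) (T : Finset (Fin n)) : Fin n → Option (NoSState Msg) :=
  (NoSBroadcast Msg k M.ε n).next M pos cfg T

/-- The transmission probabilities of NoSBroadcast. -/
noncomputable def nosTx (M : SINRParams) (k : NoSConstants)
    (cfg : Fin n → Option (NoSState Msg)) : Fin n → unitInterval :=
  (NoSBroadcast Msg k M.ε n).txProbs cfg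

/-- The packet that `u` receives in NoSBroadcast. -/
noncomputable def nosReceived (M : SINRParams) (pos : Fin n → X) (k : NoSConstants)
    (cfg : Fin n → Option (NoSState Msg)) (T : Finset (Fin n)) (u : Fin n) : Option (Packet Msg) :=
  (NoSBroadcast Msg k M.ε n).received M pos cfg T u

variable {M : SINRParams} {pos : Fin n → X} {k : NoSConstants}
  {cfg : Fin n → Option (NoSState Msg)} {T : Finset (Fin n)} {m : Msg} {t : ℕ}

/-- The new state of an awake station. -/
noncomputable def nosUpdate (k : NoSConstants) (n : ℕ) (st : NoSState Msg) (transmitted : Bool)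
    (received : Option (Packet Msg)) : NoSState Msg :=
  open Classical in
  if st.clock % k.phaseLen n + 1 = k.phaseLen n then NoSState.fresh st.msg (st.clock + 1)
  else if st.active = true ∧ st.clock % k.phaseLen n < k.part1Len n ∧ st.color = none then
    st.testStep k n (st.clock % k.phaseLen n) (transmitted || received.isSome)
  else { st with clock := st.clock + 1 }

/-- The state of a station that is woken up. -/
noncomputable def nosWake (k : NoSConstants) (n : ℕ) (q : Packet Msg) : NoSState Msg :=
  { NoSState.fresh q.1 (q.2 + 1) with active := decide ((q.2 + 1) % k.phaseLen n = 0) }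

theorem nosNext_of_none {v : Fin n} (h : cfg v = none) :
    nosNext M pos k cfg T v = (nosReceived M pos k cfg T v).map (nosWake k n) := by
  unfold nosNext Protocol.next
  split
  · rfl
  · rename_i st hst
    exact absurd (hst.symm.trans h) (Option.some_ne_none st)

theorem nosNext_of_some {v : Fin n} {st : NoSState Msg} (h : cfg v = some st) :
    nosNext M pos k cfg T v = some (nosUpdate k n st (decide (v ∈ T))
      (nosReceived M pos k cfg T v)) := by
  unfold nosNext Protocol.next
  split
  · rename_i hst
    exact absurd (hst.symm.trans h) (Option.some_ne_none st).symm
  · rename_i st' hst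
    obtain rfl : st' = st := Option.some.inj (hst.symm.trans h)
    unfold nosUpdate
    simp only [NoSBroadcast]
    congr

theorem nosTx_of_none {v : Fin n} (h : cfg v = none) : nosTx M k cfg v = 0 := by
  have h1 : nosTx M k cfg v = (NoSBroadcast Msg k M.ε n).stationTxProb (cfg v) := rfl
  rw [h1, h]
  rfl

theorem nosTx_of_some {v : Fin n} {st : NoSState Msg} (h : cfg v = some st) :
    nosTx M k cfg v = Set.projIcc 0 1 zero_le_one
      (if st.active = false then 0
      else if st.clock % k.phaseLen n < k.part1Len n then
        if st.color.isSome then 0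
        else if st.clock % k.phaseLen n % k.testLen n < k.densityLen n then
          k.prob n (st.clock % k.phaseLen n)
        else k.prob n (st.clock % k.phaseLen n) * k.cEps
      else st.color.getD (2 * k.pMax) / (k.c * M.ε * Real.logb 2 n)) := by
  have h1 : nosTx M k cfg v = (NoSBroadcast Msg k M.ε n).stationTxProb (cfg v) := rfl
  rw [h1, h]
  rfl

open Classical in
theorem nosReceived_eq {u : Fin n} : nosReceived M pos k cfg T u =
    if h : ∃ v, M.Receives pos T v u then
      (cfg h.choose).map fun st => ((st.msg, st.clock) : Packet Msg)
    else none := rfl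

theorem nosNext_ne_none {v : Fin n} (h : cfg v ≠ none) : nosNext M pos k cfg T v ≠ none := by
  obtain ⟨st, hst⟩ := Option.ne_none_iff_exists'.1 h
  rw [nosNext_of_some hst]
  simp

/-- All awake stations hold the message `m` and agree that `t` rounds have elapsed. -/
def Sync (m : Msg) (t : ℕ) (cfg : Fin n → Option (NoSState Msg)) : Prop :=
  ∀ v st, cfg v = some st → st.msg = m ∧ st.clock = t

theorem Sync.received_eq (h : Sync m t cfg) {u : Fin n} {q : Packet Msg}
    (hq : nosReceived M pos k cfg T u = some q) : q = (m, t) ∧ M.Receives' pos T u := by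
  classical
  rw [nosReceived_eq] at hq
  split at hq
  · rename_i hex
    obtain ⟨st, hst, rfl⟩ := Option.map_eq_some_iff.1 hq
    obtain ⟨h1, h2⟩ := h _ _ hst
    exact ⟨Prod.ext h1 h2, hex⟩
  · simp at hq

theorem Sync.received_isSome (hT : ∀ v ∈ T, cfg v ≠ none) {u : Fin n} :
    (nosReceived M pos k cfg T u).isSome = true ↔ M.Receives' pos T u := by
  classical
  rw [nosReceived_eq]
  split
  · rename_i hex
    obtain ⟨st, hst⟩ := Option.ne_none_iff_exists'.1 (hT _ hex.choose_spec.1)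
    rw [hst]
    exact iff_of_true rfl hex
  · rename_i hex
    exact iff_of_false Bool.false_ne_true hex

theorem testStep_msg (st : NoSState Msg) (r : ℕ) (b : Bool) :
    (st.testStep k n r b).msg = st.msg := by
  simp only [NoSState.testStep]; split_ifs <;> rfl

theorem testStep_clock (st : NoSState Msg) (r : ℕ) (b : Bool) :
    (st.testStep k n r b).clock = st.clock + 1 := by
  simp only [NoSState.testStep]; split_ifs <;> rfl

theorem testStep_active (st : NoSState Msg) (r : ℕ) (b : Bool) :
    (st.testStep k n r b).active = st.active := by
  simp only [NoSState.testStep]; split_ifs <;> rfl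

theorem update_msg_clock (st : NoSState Msg) (b : Bool) (q : Option (Packet Msg)) :
    (nosUpdate k n st b q).msg = st.msg ∧ (nosUpdate k n st b q).clock = st.clock + 1 := by
  rw [nosUpdate]
  split_ifs
  · exact ⟨rfl, rfl⟩
  · exact ⟨testStep_msg _ _ _, testStep_clock _ _ _⟩
  · exact ⟨rfl, rfl⟩

theorem Sync.next (h : Sync m t cfg) : Sync m (t + 1) (nosNext M pos k cfg T) := by
  intro v st hst
  rcases hv : cfg v with _ | st'
  · rw [nosNext_of_none hv] at hst
    obtain ⟨q, hq, rfl⟩ := Option.map_eq_some_iff.1 hst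
    obtain ⟨rfl, -⟩ := h.received_eq hq
    exact ⟨rfl, rfl⟩
  · rw [nosNext_of_some hv] at hst
    obtain rfl := Option.some.inj hst
    obtain ⟨h1, h2⟩ := h v st' hv
    obtain ⟨h3, h4⟩ := update_msg_clock (n := n) (k := k) st' (decide (v ∈ T))
      (nosReceived M pos k cfg T v)
    exact ⟨h3.trans h1, h4.trans (by rw [h2])⟩

/-- Is the station active? -/
def activeOf (o : Option (NoSState Msg)) : Bool := o.elim false NoSState.active

/-- The color of the station, if it has quit. -/
def colorOf (o : Option (NoSState Msg)) : Option ℝ := o.elim none NoSState.color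

/-- The number of messages that the station has heard in the current test. -/
def countOf (o : Option (NoSState Msg)) : ℕ := o.elim 0 NoSState.count

/-- The result of the most recent DensityTest of the station. -/
def denseOf (o : Option (NoSState Msg)) : Bool := o.elim false NoSState.dense

/-- In round `t`, the set of active stations is `V`. -/
def InPhase (m : Msg) (t : ℕ) (V : Finset (Fin n)) (cfg : Fin n → Option (NoSState Msg)) : Prop :=
  Sync m t cfg ∧ ∀ v, activeOf (cfg v) = true ↔ v ∈ V

variable {V : Finset (Fin n)}

theorem InPhase.exists_state (h : InPhase m t V cfg) {v : Fin n} (hv : v ∈ V) :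
    ∃ st, cfg v = some st ∧ st.active = true ∧ st.clock = t ∧ st.msg = m := by
  have h1 := (h.2 v).2 hv
  rcases hst : cfg v with _ | st
  · rw [hst] at h1; simp [activeOf] at h1
  · rw [hst] at h1
    exact ⟨st, rfl, h1, (h.1 v st hst).2, (h.1 v st hst).1⟩

theorem InPhase.nosTx_of_notMem (h : InPhase m t V cfg) {v : Fin n} (hv : v ∉ V) :
    nosTx M k cfg v = 0 := by
  have h1 : ¬activeOf (cfg v) = true := fun h' => hv ((h.2 v).1 h')
  rcases hst : cfg v with _ | st
  · exact nosTx_of_none hst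
  · rw [hst] at h1
    have h2 : st.active = false := by simpa [activeOf] using h1
    rw [nosTx_of_some hst, if_pos h2, Set.projIcc_of_le_left _ le_rfl]
    rfl

theorem InPhase.subset_of_tx (h : InPhase m t V cfg) (hT : ∀ v ∈ T, nosTx M k cfg v ≠ 0) :
    T ⊆ V := by
  intro v hv
  by_contra hv'
  exact hT v hv (h.nosTx_of_notMem hv')

theorem InPhase.received_isSome (h : InPhase m t V cfg) (hT : T ⊆ V) {u : Fin n} :
    (nosReceived M pos k cfg T u).isSome = true ↔ M.Receives' pos T u := by
  refine Sync.received_isSome fun v hv => ?_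
  obtain ⟨st, hst, -⟩ := h.exists_state (hT hv)
  simp [hst]

/-- A station woken inside a phase computes from the received clock that no phase begins now, so it
stays inactive and the active set is constant until the phase ends. -/
theorem InPhase.next (h : InPhase m t V cfg) (ht : t % k.phaseLen n + 1 ≠ k.phaseLen n) :
    InPhase m (t + 1) V (nosNext M pos k cfg T) := by
  refine ⟨h.1.next, fun v => ?_⟩
  rw [← h.2 v]
  have hmod : (t + 1) % k.phaseLen n ≠ 0 := by
    intro h0
    rcases Nat.eq_zero_or_pos (k.phaseLen n) with hp | hp
    · rw [hp, Nat.mod_zero] at h0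
      omega
    · have h1 := Nat.mod_lt t hp
      rw [Nat.add_mod, Nat.mod_eq_of_lt (a := 1) (by omega), Nat.mod_eq_of_lt (by omega)] at h0
      omega
  rcases hv : cfg v with _ | st
  · rw [nosNext_of_none hv]
    rcases hq : nosReceived M pos k cfg T v with _ | q
    · rfl
    · obtain ⟨rfl, -⟩ := h.1.received_eq hq
      simp [activeOf, nosWake, hmod]
  · rw [nosNext_of_some hv]
    obtain ⟨-, hc⟩ := h.1 v st hv
    simp only [activeOf, Option.elim_some, nosUpdate, hc, if_neg ht]
    split_ifs
    · rw [testStep_active]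
    · rfl

theorem InPhase.color_next (h : InPhase m t V cfg) (ht : t % k.phaseLen n + 1 ≠ k.phaseLen n)
    {v : Fin n} (hv : v ∈ V) (hc : k.part1Len n ≤ t % k.phaseLen n ∨ colorOf (cfg v) ≠ none) :
    colorOf (nosNext M pos k cfg T v) = colorOf (cfg v) := by
  obtain ⟨st, hst, ha, hcl, -⟩ := h.exists_state hv
  rw [nosNext_of_some hst, hst]
  simp only [colorOf, Option.elim_some, nosUpdate, hcl, if_neg ht]
  rw [if_neg]
  rintro ⟨-, h1, h2⟩
  rcases hc with hc | hc
  · omega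
  · rw [hst] at hc
    exact hc h2

/-- The progress of a test of a station that has not quit. -/
theorem InPhase.test_next (h : InPhase m t V cfg) (hT : T ⊆ V)
    (ht : t % k.phaseLen n + 1 ≠ k.phaseLen n) (ht1 : t % k.phaseLen n < k.part1Len n)
    {v : Fin n} (hv : v ∈ V) (hc : colorOf (cfg v) = none) :
    ∃ (st : NoSState Msg) (b : Bool), cfg v = some st ∧ (b = true ↔ M.Hears pos T v) ∧
      nosNext M pos k cfg T v = some (st.testStep k n (t % k.phaseLen n) b) := by
  obtain ⟨st, hst, ha, hcl, -⟩ := h.exists_state hv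
  refine ⟨st, decide (v ∈ T) || (nosReceived M pos k cfg T v).isSome, hst, ?_, ?_⟩
  · rw [Bool.or_eq_true, h.received_isSome hT, decide_eq_true_iff]
    rfl
  · rw [nosNext_of_some hst]
    rw [hst] at hc
    simp only [nosUpdate, hcl, if_neg ht]
    rw [if_pos ⟨ha, ht1, hc⟩]

theorem ind_eq_of_bool {b : Bool} {Q : Prop} (h : b = true ↔ Q) :
    ((if b = true then 1 else 0 : ℕ) : ℝ) = ind Q := by
  by_cases hQ : Q
  · rw [ind_of hQ, if_pos (h.2 hQ)]; norm_num
  · rw [ind_of_not hQ, if_neg (mt h.1 hQ)]; norm_num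

theorem InPhase.count_next (h : InPhase m t V cfg) (hT : T ⊆ V)
    (ht : t % k.phaseLen n + 1 ≠ k.phaseLen n) (ht1 : t % k.phaseLen n < k.part1Len n)
    {v : Fin n} (hv : v ∈ V) (hc : colorOf (cfg v) = none)
    (hi1 : t % k.phaseLen n % k.testLen n + 1 ≠ k.densityLen n)
    (hi2 : t % k.phaseLen n % k.testLen n + 1 ≠ k.testLen n) :
    colorOf (nosNext M pos k cfg T v) = none ∧
      denseOf (nosNext M pos k cfg T v) = denseOf (cfg v) ∧
      (countOf (nosNext M pos k cfg T v) : ℝ) = countOf (cfg v) + ind (M.Hears pos T v) := by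
  obtain ⟨st, b, hst, hb, hnext⟩ := h.test_next (pos := pos) hT ht ht1 hv hc
  rw [hst] at hc
  rw [hnext, hst, ← ind_eq_of_bool hb]
  simp only [NoSState.testStep, if_neg hi1, if_neg hi2]
  refine ⟨hc, rfl, ?_⟩
  simp [countOf]

theorem InPhase.density_next (h : InPhase m t V cfg) (hT : T ⊆ V)
    (ht : t % k.phaseLen n + 1 ≠ k.phaseLen n) (ht1 : t % k.phaseLen n < k.part1Len n)
    {v : Fin n} (hv : v ∈ V) (hc : colorOf (cfg v) = none)
    (hi : t % k.phaseLen n % k.testLen n + 1 = k.densityLen n) :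
    colorOf (nosNext M pos k cfg T v) = none ∧ countOf (nosNext M pos k cfg T v) = 0 ∧
      (denseOf (nosNext M pos k cfg T v) = true ↔
        k.c₁ * Real.logb 2 n ≤ countOf (cfg v) + ind (M.Hears pos T v)) := by
  obtain ⟨st, b, hst, hb, hnext⟩ := h.test_next (pos := pos) hT ht ht1 hv hc
  rw [hst] at hc
  rw [hnext, hst, ← ind_eq_of_bool hb]
  simp only [NoSState.testStep, if_pos hi]
  refine ⟨hc, rfl, ?_⟩
  simp [countOf, denseOf]

theorem InPhase.playoff_next (h : InPhase m t V cfg) (hT : T ⊆ V)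
    (ht : t % k.phaseLen n + 1 ≠ k.phaseLen n) (ht1 : t % k.phaseLen n < k.part1Len n)
    {v : Fin n} (hv : v ∈ V) (hc : colorOf (cfg v) = none)
    (hi1 : t % k.phaseLen n % k.testLen n + 1 ≠ k.densityLen n)
    (hi2 : t % k.phaseLen n % k.testLen n + 1 = k.testLen n) :
    countOf (nosNext M pos k cfg T v) = 0 ∧
      (colorOf (nosNext M pos k cfg T v) = none ∨
        colorOf (nosNext M pos k cfg T v) = some (k.prob n (t % k.phaseLen n))) ∧
      (colorOf (nosNext M pos k cfg T v) ≠ none ↔ denseOf (cfg v) = true ∧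
        k.c₃ * Real.logb 2 n ≤ countOf (cfg v) + ind (M.Hears pos T v)) := by
  obtain ⟨st, b, hst, hb, hnext⟩ := h.test_next (pos := pos) hT ht ht1 hv hc
  rw [hst] at hc
  rw [hnext, hst, ← ind_eq_of_bool hb]
  simp only [NoSState.testStep, if_neg hi1, if_pos hi2]
  refine ⟨rfl, ?_, ?_⟩
  · simp only [colorOf, Option.elim_some]
    exact (ite_eq_or_eq _ _ _).symm
  · simp only [colorOf, Option.elim_some, denseOf, countOf, ne_eq, ite_eq_right_iff, reduceCtorEq,
      imp_false, not_not, Nat.cast_add]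

/-- The active stations that have not quit. -/
noncomputable def running (V : Finset (Fin n)) (cfg : Fin n → Option (NoSState Msg)) :
    Finset (Fin n) :=
  open Classical in V.filter fun v => colorOf (cfg v) = none

theorem mem_running {v : Fin n} : v ∈ running V cfg ↔ v ∈ V ∧ colorOf (cfg v) = none := by
  simp [running]

/-- All running stations share the same `p_v`, since they started together and doubled together. The
reception estimates are therefore needed only for a uniform probability on a set. -/
theorem InPhase.nosTx_part1 (h : InPhase m t V cfg) (ht1 : t % k.phaseLen n < k.part1Len n) :
    nosTx M k cfg = uniformOn (running V cfg) (Set.projIcc 0 1 zero_le_one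
      (if t % k.phaseLen n % k.testLen n < k.densityLen n then k.prob n (t % k.phaseLen n)
        else k.prob n (t % k.phaseLen n) * k.cEps)) := by
  funext v
  by_cases hv : v ∈ V
  · obtain ⟨st, hst, ha, hcl, -⟩ := h.exists_state hv
    rw [nosTx_of_some hst]
    simp only [ha, hcl, Bool.true_eq_false, if_false, if_pos ht1]
    by_cases hc : st.color = none
    · rw [uniformOn_of_mem (mem_running.2 ⟨hv, by rw [hst]; exact hc⟩), hc]
      simp
    · rw [uniformOn_of_notMem fun hr => hc (by have := (mem_running.1 hr).2; rwa [hst] at this)]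
      rw [if_pos (Option.isSome_iff_ne_none.2 hc), Set.projIcc_of_le_left _ le_rfl]
      rfl
  · rw [h.nosTx_of_notMem hv, uniformOn_of_notMem fun hr => hv (mem_running.1 hr).1]

theorem InPhase.nosTx_part2 (h : InPhase m t V cfg) (ht1 : k.part1Len n ≤ t % k.phaseLen n)
    {v : Fin n} (hv : v ∈ V) :
    nosTx M k cfg v = Set.projIcc 0 1 zero_le_one
      ((colorOf (cfg v)).getD (2 * k.pMax) / (k.c * M.ε * Real.logb 2 n)) := by
  obtain ⟨st, hst, ha, hcl, -⟩ := h.exists_state hv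
  rw [nosTx_of_some hst, hst]
  simp only [ha, hcl, Bool.true_eq_false, if_false, if_neg (not_lt.2 ht1)]
  rfl

end Dynamics

/-! ### Exponential tail bounds for the counters of the tests -/

section Chernoff

variable {n : ℕ}

theorem rprob_le_one (p : Fin n → unitInterval) (Q : Finset (Fin n) → Prop) : rprob p Q ≤ 1 :=
  (rexp_mono p (g := fun _ => 1) fun _ _ => ind_le_one _).trans (rexp_const p 1).le

/-- Base `2` makes the exponential moment of an indicator affine, so its expectation depends only on
the probability. -/
theorem two_rpow_ind (Q : Prop) : (2 : ℝ) ^ ind Q = 1 + ind Q := by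
  by_cases h : Q
  · rw [ind_of h]; norm_num
  · rw [ind_of_not h]; norm_num

theorem two_rpow_neg_ind (Q : Prop) : (2 : ℝ) ^ (-ind Q) = 1 - ind Q / 2 := by
  by_cases h : Q
  · rw [ind_of h, Real.rpow_neg_one]; norm_num
  · rw [ind_of_not h]; norm_num

variable {Ω : Type*} {p : Ω → Fin n → unitInterval} {nx : Ω → Finset (Fin n) → Ω}
  {J : ℕ → Ω → Prop} {ℓ : ℕ} {q : Fin n → unitInterval} {hd : Finset (Fin n) → Prop} {cnt : Ω → ℕ}
  {θ π : ℝ} {B : Ω → Prop}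

/-- An upper tail bound for the number of rounds, out of `ℓ`, in which the event `hd` occurs. -/
theorem expect_count_ge_le (hℓ : 0 < ℓ) (hq : ∀ i < ℓ, ∀ ω, J i ω → p ω = q)
    (hstep : ∀ i, i + 1 < ℓ → ∀ ω, J i ω → ∀ T : Finset (Fin n), (∀ v ∈ T, q v ≠ 0) →
      J (i + 1) (nx ω T) ∧ (cnt (nx ω T) : ℝ) = cnt ω + ind (hd T))
    (hlast : ∀ i, i + 1 = ℓ → ∀ ω, J i ω → ∀ T : Finset (Fin n), (∀ v ∈ T, q v ≠ 0) →
      B (nx ω T) → θ ≤ cnt ω + ind (hd T))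
    (hπ : rprob q hd ≤ π) {ω : Ω} (hω : J 0 ω) (h0 : cnt ω = 0) :
    (expect p nx)^[ℓ] (fun ω => ind (B ω)) ω ≤ 2 ^ (-θ) * (1 + π) ^ ℓ := by
  have hr : rexp q (fun T => 1 + ind (hd T)) ≤ 1 + π := by
    rw [rexp_add, rexp_const]
    have : rexp q (fun T => ind (hd T)) ≤ π := hπ
    linarith
  have hmul : ∀ ω T, (2 : ℝ) ^ ((cnt ω : ℝ) + ind (hd T) - θ) =
      2 ^ ((cnt ω : ℝ) - θ) * (1 + ind (hd T)) := by
    intro ω T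
    rw [← two_rpow_ind, ← Real.rpow_add (by norm_num)]
    congr 1
    ring
  have := expect_iterate_le_of_potential (p := p) (nx := nx) (I := J) (ℓ := ℓ)
    (φ := fun ω => 2 ^ ((cnt ω : ℝ) - θ)) (B := B) (q := q) (g := fun T => 1 + ind (hd T))
    (r := 1 + π) (fun ω => by positivity) hr
    (by linarith [rprob_nonneg q hd]) hq
    (fun i hi ω hω T hT => by
      obtain ⟨h1, h2⟩ := hstep i hi ω hω T hT
      refine ⟨h1, ?_⟩
      simp only [h2, hmul]
      exact le_rfl)
    (fun i hi ω hω T hT => by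
      simp only [← hmul]
      by_cases hB : B (nx ω T)
      · rw [ind_of hB]
        exact Real.one_le_rpow (by norm_num) (by linarith [hlast i hi ω hω T hT hB])
      · rw [ind_of_not hB]; positivity)
    (ℓ - 1) 0 (by omega) ω hω
  rw [Nat.sub_add_cancel hℓ] at this
  simpa [h0] using this

/-- A lower tail bound for the number of rounds, out of `ℓ`, in which the event `hd` occurs. -/
theorem expect_count_le_le (hℓ : 0 < ℓ) (hq : ∀ i < ℓ, ∀ ω, J i ω → p ω = q)
    (hstep : ∀ i, i + 1 < ℓ → ∀ ω, J i ω → ∀ T : Finset (Fin n), (∀ v ∈ T, q v ≠ 0) →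
      J (i + 1) (nx ω T) ∧ (cnt (nx ω T) : ℝ) = cnt ω + ind (hd T))
    (hlast : ∀ i, i + 1 = ℓ → ∀ ω, J i ω → ∀ T : Finset (Fin n), (∀ v ∈ T, q v ≠ 0) →
      B (nx ω T) → cnt ω + ind (hd T) ≤ θ)
    (hπ : π ≤ rprob q hd) {ω : Ω} (hω : J 0 ω) (h0 : cnt ω = 0) :
    (expect p nx)^[ℓ] (fun ω => ind (B ω)) ω ≤ 2 ^ θ * (1 - π / 2) ^ ℓ := by
  have hr : rexp q (fun T => 1 - ind (hd T) / 2) ≤ 1 - π / 2 := by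
    have h1 : (fun T => 1 - ind (hd T) / 2) = fun T => 1 - ind (hd T) * (1 / 2) :=
      funext fun T => by ring
    rw [h1, rexp_sub, rexp_const, rexp_mul_const]
    have : π ≤ rexp q (fun T => ind (hd T)) := hπ
    linarith
  have hmul : ∀ ω T, (2 : ℝ) ^ (θ - ((cnt ω : ℝ) + ind (hd T))) =
      2 ^ (θ - (cnt ω : ℝ)) * (1 - ind (hd T) / 2) := by
    intro ω T
    rw [← two_rpow_neg_ind, ← Real.rpow_add (by norm_num)]
    congr 1
    ring
  have := expect_iterate_le_of_potential (p := p) (nx := nx) (I := J) (ℓ := ℓ)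
    (φ := fun ω => 2 ^ (θ - (cnt ω : ℝ))) (B := B) (q := q) (g := fun T => 1 - ind (hd T) / 2)
    (r := 1 - π / 2) (fun ω => by positivity) hr
    (by linarith [rprob_le_one q hd]) hq
    (fun i hi ω hω T hT => by
      obtain ⟨h1, h2⟩ := hstep i hi ω hω T hT
      refine ⟨h1, ?_⟩
      simp only [h2, hmul]
      exact le_rfl)
    (fun i hi ω hω T hT => by
      simp only [← hmul]
      by_cases hB : B (nx ω T)
      · rw [ind_of hB]
        exact Real.one_le_rpow (by norm_num) (by linarith [hlast i hi ω hω T hT hB])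
      · rw [ind_of_not hB]; positivity)
    (ℓ - 1) 0 (by omega) ω hω
  rw [Nat.sub_add_cancel hℓ] at this
  simpa [h0] using this

theorem two_rpow_mul_logb (hn : 2 ≤ n) (a : ℝ) : (2 : ℝ) ^ (a * Real.logb 2 n) = (n : ℝ) ^ a := by
  rw [mul_comm, Real.rpow_mul (by norm_num), Real.rpow_logb (by norm_num) (by norm_num)
    (by positivity)]

theorem exp_neg_le_two_rpow {x : ℝ} (hx : 0 ≤ x) : Real.exp (-x) ≤ 2 ^ (-x) := by
  rw [Real.rpow_def_of_pos (by norm_num)]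
  refine Real.exp_le_exp.2 ?_
  have := Real.log_two_lt_d9
  nlinarith

theorem exp_le_two_rpow {x : ℝ} (hx : 0 ≤ x) : Real.exp x ≤ 2 ^ (2 * x) := by
  rw [Real.rpow_def_of_pos (by norm_num)]
  refine Real.exp_le_exp.2 ?_
  have := Real.log_two_gt_d9
  nlinarith

/-- With hearing probability `c₁ / (8 * c₀)` and at most `2 * c₀ * log n` rounds, the moment is at
most `exp (c₁ / 4 * log n) ≤ 2 ^ (c₁ / 2 * log n)`. This is half of the exponent that the threshold
`c₁ * log n` provides. -/
theorem upper_tail_le (hn : 2 ≤ n) {c₀ c₁ s : ℝ} (hc₀ : 1 ≤ c₀) (hc₁ : 0 < c₁) (hs : s ≤ c₁ / 2) :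
    (2 : ℝ) ^ (-(c₁ * Real.logb 2 n)) * (1 + c₁ / (8 * c₀)) ^ ⌈c₀ * Real.logb 2 n⌉₊ ≤
      (n : ℝ) ^ (-s) := by
  have hL := NoSConstants.one_le_logb hn
  set L := Real.logb 2 n with hLdef
  have hc0 : 0 < c₀ := by linarith
  have h1 : (1 + c₁ / (8 * c₀)) ^ ⌈c₀ * L⌉₊ ≤ 2 ^ (c₁ / 2 * L) := by
    calc (1 + c₁ / (8 * c₀)) ^ ⌈c₀ * L⌉₊
        ≤ Real.exp (c₁ / (8 * c₀)) ^ ⌈c₀ * L⌉₊ :=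
          pow_le_pow_left₀ (by positivity) (by linarith [Real.add_one_le_exp (c₁ / (8 * c₀))]) _
      _ = Real.exp (⌈c₀ * L⌉₊ * (c₁ / (8 * c₀))) := by rw [← Real.exp_nat_mul]
      _ ≤ Real.exp (c₁ / 4 * L) := by
          refine Real.exp_le_exp.2 ?_
          have h2 : (⌈c₀ * L⌉₊ : ℝ) ≤ 2 * c₀ * L := by
            have := (Nat.ceil_lt_add_one (mul_nonneg hc0.le (by linarith : 0 ≤ L))).le
            nlinarith
          calc (⌈c₀ * L⌉₊ : ℝ) * (c₁ / (8 * c₀)) ≤ 2 * c₀ * L * (c₁ / (8 * c₀)) := by gcongr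
            _ = c₁ / 4 * L := by field_simp; ring
      _ ≤ 2 ^ (2 * (c₁ / 4 * L)) := exp_le_two_rpow (by positivity)
      _ = 2 ^ (c₁ / 2 * L) := by congr 1; ring
  calc (2 : ℝ) ^ (-(c₁ * L)) * (1 + c₁ / (8 * c₀)) ^ ⌈c₀ * L⌉₊
      ≤ 2 ^ (-(c₁ * L)) * 2 ^ (c₁ / 2 * L) := by gcongr
    _ = 2 ^ (-(c₁ / 2) * L) := by rw [← Real.rpow_add (by norm_num)]; congr 1; ring
    _ ≤ 2 ^ (-s * L) := Real.rpow_le_rpow_of_exponent_le (by norm_num) (by nlinarith)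
    _ = (n : ℝ) ^ (-s) := two_rpow_mul_logb hn _

/-- With hearing probability `4 * c₁ / c₀` the expected count is four times the threshold. The
moment decays like `2 ^ (-2 * c₁ * log n)`, and the threshold gives back only half of this exponent.
-/
theorem lower_tail_le (hn : 2 ≤ n) {c₀ c₁ s : ℝ} (hc₀ : 1 ≤ c₀) (hc₁ : 0 < c₁) (hs : s ≤ c₁ / 2)
    (h1 : 4 * c₁ / c₀ ≤ 1) :
    (2 : ℝ) ^ (c₁ * Real.logb 2 n) * (1 - 4 * c₁ / c₀ / 2) ^ ⌈c₀ * Real.logb 2 n⌉₊ ≤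
      (n : ℝ) ^ (-s) := by
  have hL := NoSConstants.one_le_logb hn
  set L := Real.logb 2 n with hLdef
  have hc0 : 0 < c₀ := by linarith
  have h1 : (1 - 4 * c₁ / c₀ / 2) ^ ⌈c₀ * L⌉₊ ≤ 2 ^ (-(2 * c₁ * L)) := by
    calc (1 - 4 * c₁ / c₀ / 2) ^ ⌈c₀ * L⌉₊
        ≤ Real.exp (-(4 * c₁ / c₀ / 2)) ^ ⌈c₀ * L⌉₊ :=
          pow_le_pow_left₀ (by linarith) (by linarith [Real.add_one_le_exp (-(4 * c₁ / c₀ / 2))]) _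
      _ = Real.exp (⌈c₀ * L⌉₊ * (-(4 * c₁ / c₀ / 2))) := by rw [← Real.exp_nat_mul]
      _ ≤ Real.exp (-(2 * c₁ * L)) := by
          refine Real.exp_le_exp.2 ?_
          have h2 : c₀ * L ≤ ⌈c₀ * L⌉₊ := Nat.le_ceil _
          have h3 : c₀ * L * (4 * c₁ / c₀ / 2) ≤ ⌈c₀ * L⌉₊ * (4 * c₁ / c₀ / 2) := by gcongr
          have h4 : c₀ * L * (4 * c₁ / c₀ / 2) = 2 * c₁ * L := by field_simp; ring
          linarith
      _ ≤ 2 ^ (-(2 * c₁ * L)) := exp_neg_le_two_rpow (by positivity)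
  calc (2 : ℝ) ^ (c₁ * L) * (1 - 4 * c₁ / c₀ / 2) ^ ⌈c₀ * L⌉₊
      ≤ 2 ^ (c₁ * L) * 2 ^ (-(2 * c₁ * L)) := by gcongr
    _ = 2 ^ (-c₁ * L) := by rw [← Real.rpow_add (by norm_num)]; congr 1; ring
    _ ≤ 2 ^ (-s * L) := Real.rpow_le_rpow_of_exponent_le (by norm_num) (by nlinarith)
    _ = (n : ℝ) ^ (-s) := two_rpow_mul_logb hn _

end Chernoff

/-! ### A DensityTest followed by a Playoff -/

section Block

variable {Msg : Type} {X : Type*} [MetricSpace X] {n : ℕ} {M : SINRParams} {pos : Fin n → X}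
  {k : NoSConstants} {m : Msg}

/-- The part of the configuration that is not random in round `i` of a test. Before the test, the
active stations `V` have the colors `χ`. -/
def InTest (m : Msg) (k : NoSConstants) (V : Finset (Fin n)) (χ : Fin n → Option ℝ) (c : ℝ)
    (t i : ℕ) (cfg : Fin n → Option (NoSState Msg)) : Prop :=
  InPhase m (t + i) V cfg ∧ ∀ v ∈ V, (χ v ≠ none → colorOf (cfg v) = χ v) ∧
    (χ v = none → (i < k.testLen n → colorOf (cfg v) = none) ∧
      (i = k.densityLen n ∨ i = k.testLen n → countOf (cfg v) = 0) ∧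
      (i = k.testLen n → colorOf (cfg v) = none ∨ colorOf (cfg v) = some c))

/-- The stations of `V` without a color. -/
noncomputable def uncolored (V : Finset (Fin n)) (χ : Fin n → Option ℝ) : Finset (Fin n) :=
  open Classical in V.filter fun v => χ v = none

theorem mem_uncolored {V : Finset (Fin n)} {χ : Fin n → Option ℝ} {v : Fin n} :
    v ∈ uncolored V χ ↔ v ∈ V ∧ χ v = none := by
  simp [uncolored]

/-- Block `b` of the first part of a phase begins in round `t`. -/
structure BlockStart (k : NoSConstants) (n t b : ℕ) : Prop where
  mod_eq : t % k.phaseLen n = b * k.testLen n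
  le : (b + 1) * k.testLen n ≤ k.part1Len n

variable {t b : ℕ} {V : Finset (Fin n)} {χ : Fin n → Option ℝ} {c : ℝ}

theorem BlockStart.mod_add (h : BlockStart k n t b) (hk : k.Positive) (hn : 2 ≤ n) {i : ℕ}
    (hi : i < k.testLen n) :
    (t + i) % k.phaseLen n = b * k.testLen n + i ∧
      b * k.testLen n + i < k.part1Len n ∧
      (t + i) % k.phaseLen n + 1 ≠ k.phaseLen n ∧ (t + i) % k.phaseLen n % k.testLen n = i := by
  have h2 := NoSConstants.part2Len_pos hk hn
  have h3 := h.le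
  rw [add_mul, one_mul] at h3
  have hlt : b * k.testLen n + i < k.part1Len n := by omega
  have hlt' : b * k.testLen n + i + 1 < k.phaseLen n := by
    rw [NoSConstants.phaseLen]; omega
  have h1 : (t + i) % k.phaseLen n = b * k.testLen n + i := by
    rw [Nat.add_mod, h.mod_eq, Nat.mod_eq_of_lt (a := i) (by omega), Nat.mod_eq_of_lt (by omega)]
  refine ⟨h1, hlt, by omega, ?_⟩
  rw [h1, Nat.mul_comm, Nat.mul_add_mod, Nat.mod_eq_of_lt hi]

theorem prob_block (k : NoSConstants) (n b : ℕ) {i : ℕ} (hi : i < k.testLen n) :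
    k.prob n (b * k.testLen n + i) = 2 ^ (b / k.c') * k.pStart n := by
  rw [NoSConstants.prob, Nat.mul_comm k.c', ← Nat.div_div_eq_div_mul, Nat.mul_comm b,
    Nat.mul_add_div (by omega), Nat.div_eq_of_lt hi, add_zero]

theorem InTest.running_eq {i : ℕ} {cfg : Fin n → Option (NoSState Msg)}
    (h : InTest m k V χ c t i cfg) (hi : i < k.testLen n) : running V cfg = uncolored V χ := by
  ext v
  rw [mem_running, mem_uncolored]
  refine and_congr_right fun hv => ⟨fun hc => ?_, fun hc => ((h.2 v hv).2 hc).1 hi⟩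
  by_contra hne
  rw [(h.2 v hv).1 hne] at hc
  exact hne hc

variable (M pos) in
theorem InTest.next (hk : k.Positive) (hn : 2 ≤ n) (hb : BlockStart k n t b) {i : ℕ}
    (hi : i < k.testLen n) {cfg : Fin n → Option (NoSState Msg)}
    (h : InTest m k V χ (2 ^ (b / k.c') * k.pStart n) t i cfg) {T : Finset (Fin n)} (hT : T ⊆ V) :
    InTest m k V χ (2 ^ (b / k.c') * k.pStart n) t (i + 1) (nosNext M pos k cfg T) := by
  obtain ⟨e1, e2, e3, e4⟩ := hb.mod_add hk hn hi
  have hpl := NoSConstants.playoffLen_pos hk hn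
  have htl : k.testLen n = k.densityLen n + k.playoffLen n := rfl
  refine ⟨h.1.next e3, fun v hv => ⟨fun hc => ?_, fun hc => ?_⟩⟩
  · have h1 := (h.2 v hv).1 hc
    rw [h.1.color_next e3 hv (Or.inr (by rwa [h1])), h1]
  · have hcol := ((h.2 v hv).2 hc).1 hi
    by_cases hi1 : i + 1 = k.densityLen n
    · obtain ⟨h1, h2, -⟩ := h.1.density_next (pos := pos) hT e3 (by omega) hv hcol (by omega)
      exact ⟨fun _ => h1, fun _ => h2, fun _ => Or.inl h1⟩
    · by_cases hi2 : i + 1 = k.testLen n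
      · obtain ⟨h1, h2, -⟩ := h.1.playoff_next (pos := pos) hT e3 (by omega) hv hcol (by omega)
          (by omega)
        rw [e1, prob_block k n b hi] at h2
        exact ⟨fun h => absurd hi2 (by omega), fun _ => h1, fun _ => h2⟩
      · obtain ⟨h1, -, -⟩ := h.1.count_next (pos := pos) hT e3 (by omega) hv hcol (by omega)
          (by omega)
        exact ⟨fun _ => h1, fun h => absurd h (by omega), fun _ => Or.inl h1⟩

/-- The transmission probability of density tests in block `b`. -/
noncomputable def densityProb (k : NoSConstants) (n b : ℕ) : unitInterval :=
  Set.projIcc 0 1 zero_le_one (2 ^ (b / k.c') * k.pStart n)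

/-- The transmission probability of playoffs in block `b`. -/
noncomputable def playoffProb (k : NoSConstants) (n b : ℕ) : unitInterval :=
  Set.projIcc 0 1 zero_le_one (2 ^ (b / k.c') * k.pStart n * k.cEps)

theorem InTest.nosTx_eq (hk : k.Positive) (hn : 2 ≤ n) (hb : BlockStart k n t b) {i : ℕ}
    (hi : i < k.testLen n) {cfg : Fin n → Option (NoSState Msg)}
    (h : InTest m k V χ c t i cfg) :
    nosTx M k cfg = uniformOn (uncolored V χ)
      (if i < k.densityLen n then densityProb k n b else playoffProb k n b) := by
  obtain ⟨e1, e2, e3, e4⟩ := hb.mod_add hk hn hi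
  rw [h.1.nosTx_part1 (by omega), h.running_eq hi, e4, e1, prob_block k n b hi]
  split_ifs <;> rfl

theorem subset_of_uniformOn {S T V : Finset (Fin n)} {y : unitInterval} (hS : S ⊆ V)
    (hT : ∀ v ∈ T, uniformOn S y v ≠ 0) : T ⊆ V :=
  fun v hv => hS (mem_of_uniformOn_ne_zero (hT v hv))

theorem uncolored_subset : uncolored V χ ⊆ V := fun _ hv => (mem_uncolored.1 hv).1

/-- The outcome of block `b`, which holds with high probability. -/
def BlockOutcome (M : SINRParams) (pos : Fin n → X) (k : NoSConstants) (V : Finset (Fin n))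
    (χ : Fin n → Option ℝ) (b : ℕ) (cfg : Fin n → Option (NoSState Msg)) (v : Fin n) : Prop :=
  ((rprob (uniformOn (uncolored V χ) (densityProb k n b)) (fun T => M.Hears pos T v) ≤
        k.c₁ / (8 * k.c₀) ∨
      rprob (uniformOn (uncolored V χ) (playoffProb k n b)) (fun T => M.Hears pos T v) ≤
        k.c₃ / (8 * k.c₂)) → colorOf (cfg v) = none) ∧
    (4 * k.c₁ / k.c₀ ≤
        rprob (uniformOn (uncolored V χ) (densityProb k n b)) (fun T => M.Hears pos T v) ∧
      4 * k.c₃ / k.c₂ ≤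
        rprob (uniformOn (uncolored V χ) (playoffProb k n b)) (fun T => M.Hears pos T v) →
      colorOf (cfg v) ≠ none)

/-- Given the colors before the block, the transmission probabilities of both tests are fixed, since
nobody quits before the last round. Each station fails with probability at most `3 * n^(-s)`: one
tail bound for not quitting wrongly, two for passing both tests. Between the two thresholds nothing
is claimed. -/
theorem leads_block (hk : k.Positive) (hn : 2 ≤ n) (hb : BlockStart k n t b) {s : ℝ}
    (hc₀ : 1 ≤ k.c₀) (hc₂ : 1 ≤ k.c₂) (hs₁ : s ≤ k.c₁ / 2) (hs₃ : s ≤ k.c₃ / 2)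
    (V : Finset (Fin n)) (χ : Fin n → Option ℝ) :
    Leads (nosTx M k) (nosNext M pos k) (k.testLen n)
      (fun cfg : Fin n → Option (NoSState Msg) =>
        InTest m k V χ (2 ^ (b / k.c') * k.pStart n) t 0 cfg ∧
          ∀ v ∈ uncolored V χ, countOf (cfg v) = 0)
      (fun cfg => InTest m k V χ (2 ^ (b / k.c') * k.pStart n) t (k.testLen n) cfg ∧
        ∀ v ∈ uncolored V χ, BlockOutcome M pos k V χ b cfg v)
      (n * (3 * (n : ℝ) ^ (-s))) := by
  set p₀ : ℝ := 2 ^ (b / k.c') * k.pStart n with hp₀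
  set δ : ℝ := (n : ℝ) ^ (-s) with hδ
  have hδ0 : 0 ≤ δ := by positivity
  set S := uncolored V χ with hS
  set qD := uniformOn S (densityProb k n b) with hqD
  set qP := uniformOn S (playoffProb k n b) with hqP
  have hdl := NoSConstants.densityLen_pos hk hn
  have hpl := NoSConstants.playoffLen_pos hk hn
  have htl : k.testLen n = k.densityLen n + k.playoffLen n := rfl
  have hkc1 : 0 < k.c₁ := hk.2.1
  have hkc3 : 0 < k.c₃ := hk.2.2.2.1
  have hTV : ∀ {y : unitInterval} {T : Finset (Fin n)}, (∀ v ∈ T, uniformOn S y v ≠ 0) → T ⊆ V :=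
    fun h => subset_of_uniformOn uncolored_subset h
  have htxD : ∀ i < k.densityLen n, ∀ cfg : Fin n → Option (NoSState Msg),
      InTest m k V χ p₀ t i cfg → nosTx M k cfg = qD := fun i hi cfg h => by
    rw [h.nosTx_eq hk hn hb (by omega), if_pos hi]
  have htxP : ∀ i < k.playoffLen n, ∀ cfg : Fin n → Option (NoSState Msg),
      InTest m k V χ p₀ t (k.densityLen n + i) cfg → nosTx M k cfg = qP := fun i hi cfg h => by
    rw [h.nosTx_eq hk hn hb (by omega), if_neg (by omega)]
  have hstepV : ∀ i < k.testLen n, ∀ cfg : Fin n → Option (NoSState Msg),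
      InTest m k V χ p₀ t i cfg → ∀ T : Finset (Fin n), (∀ v ∈ T, nosTx M k cfg v ≠ 0) →
      T ⊆ V ∧ InTest m k V χ p₀ t (i + 1) (nosNext M pos k cfg T) := fun i hi cfg h T hT =>
    have := h.1.subset_of_tx hT
    ⟨this, h.next M pos hk hn hb hi this⟩
  set P0 : (Fin n → Option (NoSState Msg)) → Prop := fun cfg =>
    InTest m k V χ p₀ t 0 cfg ∧ ∀ v ∈ S, countOf (cfg v) = 0 with hP0
  have hdet1 : Leads (nosTx M k) (nosNext M pos k) (k.densityLen n) P0
      (InTest m k V χ p₀ t (k.densityLen n)) 0 :=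
    (Leads.of_invariant (I := fun i => InTest m k V χ p₀ t i) fun i hi cfg h T hT =>
      (hstepV i (by omega) cfg h T hT).2).mono (fun _ h => h.1) (fun _ h => h) le_rfl
  have hdet2 : Leads (nosTx M k) (nosNext M pos k) (k.playoffLen n)
      (InTest m k V χ p₀ t (k.densityLen n)) (InTest m k V χ p₀ t (k.testLen n)) 0 :=
    Leads.of_invariant (I := fun i => InTest m k V χ p₀ t (k.densityLen n + i))
      fun i hi cfg h T hT => (hstepV _ (by omega) cfg h T hT).2
  have hone : ∀ v ∈ S, Leads (nosTx M k) (nosNext M pos k) (k.testLen n) P0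
      (fun cfg => BlockOutcome M pos k V χ b cfg v) (3 * δ) := by
    intro v hv
    obtain ⟨hvV, hvχ⟩ := mem_uncolored.1 hv
    have hcol : ∀ {i cfg}, InTest m k V χ p₀ t i cfg → i < k.testLen n → colorOf (cfg v) = none :=
      fun h hi => ((h.2 v hvV).2 hvχ).1 hi
    have hDstep : ∀ i, i + 1 < k.densityLen n → ∀ cfg : Fin n → Option (NoSState Msg),
        InTest m k V χ p₀ t i cfg → ∀ T : Finset (Fin n), (∀ v ∈ T, qD v ≠ 0) →
        InTest m k V χ p₀ t (i + 1) (nosNext M pos k cfg T) ∧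
          (countOf (nosNext M pos k cfg T v) : ℝ) =
            countOf (cfg v) + ind (M.Hears pos T v) := by
      intro i hi cfg h T hT
      obtain ⟨e1, e2, e3, e4⟩ := hb.mod_add hk hn (i := i) (by omega)
      exact ⟨h.next M pos hk hn hb (by omega) (hTV hT), (h.1.count_next (hTV hT) e3 (by omega) hvV
        (hcol h (by omega)) (by omega) (by omega)).2.2⟩
    have hDlast : ∀ i, i + 1 = k.densityLen n → ∀ cfg : Fin n → Option (NoSState Msg),
        InTest m k V χ p₀ t i cfg → ∀ T : Finset (Fin n), (∀ v ∈ T, qD v ≠ 0) →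
        (denseOf (nosNext M pos k cfg T v) = true ↔
          k.c₁ * Real.logb 2 n ≤ countOf (cfg v) + ind (M.Hears pos T v)) := by
      intro i hi cfg h T hT
      obtain ⟨e1, e2, e3, e4⟩ := hb.mod_add hk hn (i := i) (by omega)
      exact (h.1.density_next (hTV hT) e3 (by omega) hvV (hcol h (by omega)) (by omega)).2.2
    have hPstep : ∀ i, i + 1 < k.playoffLen n → ∀ cfg : Fin n → Option (NoSState Msg),
        InTest m k V χ p₀ t (k.densityLen n + i) cfg → ∀ T : Finset (Fin n), T ⊆ V →
        InTest m k V χ p₀ t (k.densityLen n + (i + 1)) (nosNext M pos k cfg T) ∧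
        denseOf (nosNext M pos k cfg T v) = denseOf (cfg v) ∧
          (countOf (nosNext M pos k cfg T v) : ℝ) =
            countOf (cfg v) + ind (M.Hears pos T v) := by
      intro i hi cfg h T hT
      obtain ⟨e1, e2, e3, e4⟩ := hb.mod_add hk hn (i := k.densityLen n + i) (by omega)
      exact ⟨h.next M pos hk hn hb (by omega) hT, (h.1.count_next hT e3 (by omega) hvV
        (hcol h (by omega)) (by omega) (by omega)).2⟩
    have hPlast : ∀ i, i + 1 = k.playoffLen n → ∀ cfg : Fin n → Option (NoSState Msg),
        InTest m k V χ p₀ t (k.densityLen n + i) cfg → ∀ T : Finset (Fin n), T ⊆ V →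
        (colorOf (nosNext M pos k cfg T v) ≠ none ↔ denseOf (cfg v) = true ∧
          k.c₃ * Real.logb 2 n ≤ countOf (cfg v) + ind (M.Hears pos T v)) := by
      intro i hi cfg h T hT
      obtain ⟨e1, e2, e3, e4⟩ := hb.mod_add hk hn (i := k.densityLen n + i) (by omega)
      exact (h.1.playoff_next hT e3 (by omega) hvV (hcol h (by omega)) (by omega) (by omega)).2.2
    have hzero : ∀ {cfg}, InTest m k V χ p₀ t (k.densityLen n) cfg → countOf (cfg v) = 0 :=
      fun h => ((h.2 v hvV).2 hvχ).2.1 (Or.inl rfl)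
    have hlo : Leads (nosTx M k) (nosNext M pos k) (k.testLen n) P0
        (fun cfg => (rprob qD (fun T => M.Hears pos T v) ≤ k.c₁ / (8 * k.c₀) ∨
          rprob qP (fun T => M.Hears pos T v) ≤ k.c₃ / (8 * k.c₂)) → colorOf (cfg v) = none) δ := by
      -- The hearing probabilities are fixed numbers here, so the cases can be separated before
      -- taking expectations, and one unlikely pass is enough to prevent quitting.
      by_cases hD : rprob qD (fun T => M.Hears pos T v) ≤ k.c₁ / (8 * k.c₀)
      · have h1 : Leads (nosTx M k) (nosNext M pos k) (k.densityLen n) P0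
            (fun cfg => denseOf (cfg v) = false) δ := fun cfg hcfg => by
          refine (expect_iterate_mono _ _ (fun ω => ind_mono fun h => Bool.not_eq_false _ ▸ h) _
            _).trans ((expect_count_ge_le (B := fun cfg => denseOf (cfg v) = true)
            (cnt := fun cfg => countOf (cfg v)) hdl htxD hDstep
            (fun i hi cfg h T hT => (hDlast i hi cfg h T hT).1) hD hcfg.1 (hcfg.2 v hv)).trans
            (upper_tail_le hn hc₀ hkc1 hs₁))
        -- A failed DensityTest excludes quitting deterministically. The final round needs its own
        -- clause in the invariant because it resets the flag.
        have h2 : Leads (nosTx M k) (nosNext M pos k) (k.playoffLen n)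
            (fun cfg => InTest m k V χ p₀ t (k.densityLen n) cfg ∧ denseOf (cfg v) = false)
            (fun cfg => colorOf (cfg v) = none) 0 := by
          refine (Leads.of_invariant (I := fun i cfg => (i < k.playoffLen n →
            InTest m k V χ p₀ t (k.densityLen n + i) cfg ∧ denseOf (cfg v) = false) ∧
            (i = k.playoffLen n → colorOf (cfg v) = none)) fun i hi cfg h T hT => ?_).mono
            (fun cfg h => ⟨fun _ => h, fun h => absurd h (by omega)⟩) (fun cfg h => h.2 rfl) le_rfl
          obtain ⟨h1, h2⟩ := h.1 hi
          have hTV' := h1.1.subset_of_tx hT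
          refine ⟨fun hi' => ?_, fun hi' => ?_⟩
          · obtain ⟨h3, h4, -⟩ := hPstep i hi' cfg h1 T hTV'
            exact ⟨h3, h4.trans h2⟩
          · by_contra hne
            have := ((hPlast i hi' cfg h1 T hTV').1 hne).1
            rw [h2] at this
            exact Bool.false_ne_true this
        exact (((hdet1.and h1).trans h2 le_rfl).mono (fun _ h => h) (fun _ h _ => h) (by linarith))
      · by_cases hP : rprob qP (fun T => M.Hears pos T v) ≤ k.c₃ / (8 * k.c₂)
        · have h1 : Leads (nosTx M k) (nosNext M pos k) (k.playoffLen n)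
              (InTest m k V χ p₀ t (k.densityLen n)) (fun cfg => colorOf (cfg v) = none) δ :=
            fun cfg hcfg =>
            (expect_count_ge_le (B := fun cfg => colorOf (cfg v) ≠ none)
              (J := fun i => InTest m k V χ p₀ t (k.densityLen n + i))
              (cnt := fun cfg => countOf (cfg v)) hpl htxP
              (fun i hi cfg h T hT => by
                obtain ⟨h1, -, h2⟩ := hPstep i hi cfg h T (hTV hT)
                exact ⟨h1, h2⟩)
              (fun i hi cfg h T hT hne => ((hPlast i hi cfg h T (hTV hT)).1 hne).2) hP hcfg
              (hzero hcfg)).trans (upper_tail_le hn hc₂ hkc3 hs₃)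
          exact ((hdet1.trans h1 hδ0).mono (fun _ h => h) (fun _ h _ => h) (by linarith))
        · refine (hdet1.trans hdet2 le_rfl).mono (fun _ h => h) (fun _ _ h => ?_) (by linarith)
          exact absurd h (not_or.2 ⟨hD, hP⟩)
    have hhi : Leads (nosTx M k) (nosNext M pos k) (k.testLen n) P0
        (fun cfg => (4 * k.c₁ / k.c₀ ≤ rprob qD (fun T => M.Hears pos T v) ∧
          4 * k.c₃ / k.c₂ ≤ rprob qP (fun T => M.Hears pos T v)) → colorOf (cfg v) ≠ none)
        (2 * δ) := by
      by_cases hDP : 4 * k.c₁ / k.c₀ ≤ rprob qD (fun T => M.Hears pos T v) ∧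
          4 * k.c₃ / k.c₂ ≤ rprob qP (fun T => M.Hears pos T v)
      · obtain ⟨hD, hP⟩ := hDP
        have h1 : Leads (nosTx M k) (nosNext M pos k) (k.densityLen n) P0
            (fun cfg => denseOf (cfg v) = true) δ := fun cfg hcfg =>
          (expect_count_le_le (B := fun cfg => ¬denseOf (cfg v) = true)
            (cnt := fun cfg => countOf (cfg v)) hdl htxD hDstep
            (fun i hi cfg h T hT hne => (not_le.1 (mt (hDlast i hi cfg h T hT).2 hne)).le)
            hD hcfg.1 (hcfg.2 v hv)).trans
            (lower_tail_le hn hc₀ hkc1 hs₁ (hD.trans (rprob_le_one _ _)))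
        have h2 : Leads (nosTx M k) (nosNext M pos k) (k.playoffLen n)
            (fun cfg => InTest m k V χ p₀ t (k.densityLen n) cfg ∧ denseOf (cfg v) = true)
            (fun cfg => colorOf (cfg v) ≠ none) δ := fun cfg hcfg =>
          (expect_count_le_le (B := fun cfg => ¬colorOf (cfg v) ≠ none)
            (J := fun i cfg => InTest m k V χ p₀ t (k.densityLen n + i) cfg ∧
              denseOf (cfg v) = true)
            (cnt := fun cfg => countOf (cfg v)) hpl (fun i hi cfg h => htxP i hi cfg h.1)
            (fun i hi cfg h T hT => by
              obtain ⟨h1, h2, h3⟩ := hPstep i hi cfg h.1 T (hTV hT)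
              exact ⟨⟨h1, h2.trans h.2⟩, h3⟩)
            (fun i hi cfg h T hT hne => by
              have := mt (hPlast i hi cfg h.1 T (hTV hT)).2 hne
              rw [not_and] at this
              exact (not_le.1 (this h.2)).le)
            hP hcfg (hzero hcfg.1)).trans
            (lower_tail_le hn hc₂ hkc3 hs₃ (hP.trans (rprob_le_one _ _)))
        exact (((hdet1.and h1).trans h2 hδ0).mono (fun _ h => h) (fun _ h _ => h) (by linarith))
      · refine (hdet1.trans hdet2 le_rfl).mono (fun _ h => h) (fun _ _ h => ?_) (by linarith)
        exact absurd h hDP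
    exact (hlo.and hhi).mono (fun _ h => h) (fun _ h => h) (by linarith)
  have hall := (hdet1.trans hdet2 le_rfl).and (Leads.forall_finset S hone)
  refine hall.mono (fun _ h => h) (fun _ h => h) ?_
  have : (S.card : ℝ) ≤ n := by
    exact_mod_cast (Finset.card_le_univ S).trans (Fintype.card_fin n).le
  have := mul_le_mul_of_nonneg_right this (by positivity : 0 ≤ 3 * δ)
  linarith

end Block

/-! ### StabilizeProbability -/

/-- The constraints on the constants of NoSBroadcast under which a phase succeeds with probability
at least `1 - O(n ^ (3 - s))`. -/
structure Tuned (M : SINRParams) (γ κ : ℝ) (k : NoSConstants) (s : ℝ) : Prop where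
  β_ge : 1 ≤ M.β
  noise_pos : 0 < M.noise
  γ_lt : γ < M.α
  α_pos : 0 < M.α
  κ_pos : 0 < κ
  ε_pos : 0 < M.ε
  positive : k.Positive
  C₂_eq : k.C₂ = 1 / 4
  cEps_ge : 1 ≤ k.cEps
  C₁_le : k.C₁ ≤ 1 / 2
  density_num : 1 + M.β * (2 * SINRParams.farConst M.α γ κ * k.C₁) ≤ (1 / 2) ^ (-M.α)
  playoff_num : ∃ ρ l : ℕ, 2 ≤ ρ ∧ ρ + 1 ≤ 2 ^ l ∧
    (∀ x : ℝ, 0 < x → x ≤ (1 / 2) ^ (l + 4) →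
      1 + M.β * (2 * SINRParams.farConst M.α γ κ * (((4 * ρ : ℕ) : ℝ) ^ (γ - M.α) *
        (x / 4) ^ (-M.α) + ((2 ^ l - 1) * x) ^ (-M.α) * (k.cEps * k.C₁))) ≤ (2 * x) ^ (-M.α)) ∧
    2 * κ * 8 ^ γ * (κ * ((2 ^ (l + 2) : ℕ) : ℝ) ^ γ) ≤ k.cEps * k.C₁ ∧
    4 * k.c₃ / k.c₂ ≤ 3 / 8 * Real.exp (-(2 * (κ * ((4 * ρ : ℕ) : ℝ) ^ γ)))
  density_le : 4 * k.c₁ / k.c₀ ≤ 3 / 16 * (k.C₁ / (2 * κ * 8 ^ γ))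
  near_num : 2 ^ (1 + (M.ε / 2) ^ (-M.α)) *
    Real.exp (-(k.cEps * (k.c₁ / (8 * k.c₀))) / 2) ≤ k.c₃ / (8 * k.c₂) / 2
  repetitions : k.cEps * (κ * 2 ^ γ * k.C₁) < k.c'
  c₀_ge : 1 ≤ k.c₀
  c₂_ge : 1 ≤ k.c₂
  s_le₁ : s ≤ k.c₁ / 2
  s_le₃ : s ≤ k.c₃ / 2
  c_ge : 2 * k.pMax ≤ k.c * M.ε
  part2_num : ∃ μ : ℝ, 0 < μ ∧ μ ≤ 1 / 2 ∧
    1 + M.β * (2 * SINRParams.farConst M.α γ κ * μ) ≤ (1 - M.ε / 2) ^ (-M.α) ∧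
    ∀ n : ℕ, 2 ≤ n → ((k.loops n : ℝ) + 3) * k.C₁ ≤ μ * (k.c * M.ε * Real.logb 2 n)
  s_le_cT : s ≤ k.c₃ / (8 * k.c₂) / (2 * k.cEps) / (4 * (k.c * M.ε)) * k.cT

namespace NoSConstants

variable {k : NoSConstants} {n : ℕ}

theorem pStart_pos (hk : k.Positive) (hn : 2 ≤ n) : 0 < k.pStart n :=
  div_pos hk.2.2.2.2.2.1 (by positivity)

theorem pMax_pos (hk : k.Positive) : 0 < k.pMax :=
  div_pos hk.2.2.2.2.2.2.1 hk.2.2.2.2.1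

theorem pow_mul_pStart_lt (hk : k.Positive) (hn : 2 ≤ n) {i : ℕ} (hi : i < k.loops n) :
    2 ^ i * k.pStart n < k.pMax := by
  have h1 : (i : ℝ) < Real.logb 2 (k.pMax / k.pStart n) := Nat.lt_ceil.1 hi
  have h0 : 0 < k.pMax / k.pStart n := div_pos (pMax_pos hk) (pStart_pos hk hn)
  rw [Real.lt_logb_iff_rpow_lt (by norm_num) h0, Real.rpow_natCast,
    lt_div_iff₀ (pStart_pos hk hn)] at h1
  exact h1

theorem pMax_le_pow_mul_pStart (hk : k.Positive) (hn : 2 ≤ n) :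
    k.pMax ≤ 2 ^ k.loops n * k.pStart n := by
  have h0 : 0 < k.pMax / k.pStart n := div_pos (pMax_pos hk) (pStart_pos hk hn)
  have h1 : Real.logb 2 (k.pMax / k.pStart n) ≤ (k.loops n : ℝ) := Nat.le_ceil _
  rw [Real.logb_le_iff_le_rpow (by norm_num) h0, Real.rpow_natCast,
    div_le_iff₀ (pStart_pos hk hn)] at h1
  exact h1

end NoSConstants

section Stabilize

open SINRParams

variable {Msg : Type} {X : Type*} [MetricSpace X] {n : ℕ} {M : SINRParams} {pos : Fin n → X}
  {k : NoSConstants} {m : Msg} {γ κ s : ℝ}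

/-- The color of a station, or the current value `2 ^ i * pStart` if it has not quit. -/
noncomputable def curProb (k : NoSConstants) (i : ℕ) (cfg : Fin n → Option (NoSState Msg))
    (v : Fin n) : ℝ :=
  (colorOf (cfg v)).getD (2 ^ i * k.pStart n)

/-- The total color that is guaranteed near every station. -/
noncomputable def NoSConstants.nearProb (k : NoSConstants) : ℝ :=
  k.c₃ / (8 * k.c₂) / (2 * k.cEps)

/-- The invariant of StabilizeProbability, before the repetition `j` of the tests in iteration `i`
of the loop, in a phase that starts in round `t`. -/
structure Stable (M : SINRParams) (pos : Fin n → X) (γ κ : ℝ) (k : NoSConstants) (m : Msg)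
    (V : Finset (Fin n)) (t i j : ℕ) (cfg : Fin n → Option (NoSState Msg)) : Prop where
  inPhase : InPhase m (t + (i * k.c' + j) * k.testLen n) V cfg
  count : ∀ v ∈ running V cfg, countOf (cfg v) = 0
  color : ∀ v ∈ V, ∀ c, colorOf (cfg v) = some c → 0 ≤ c ∧ c ≤ 2 ^ i * k.pStart n
  ball : ∀ x, 2 ^ i * k.pStart n * ((nbhd pos (running V cfg) x 1).card : ℝ) ≤ k.C₁
  total : ∀ x, ∑ v ∈ nbhd pos V x 1, curProb k i cfg v ≤ (i + 1) * k.C₁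
  near : ∀ v ∈ V, colorOf (cfg v) ≠ none → 2 ^ i * k.pStart n ≤ 2 * k.pMax ∧
    k.nearProb ≤ ∑ w ∈ nbhd pos V (pos v) (M.ε / 2), curProb k i cfg w
  progress : ∀ x, 2 ^ i * k.pStart n * ((nbhd pos (running V cfg) x 1).card : ℝ) ≤ k.C₁ / 2 ∨
    k.cEps * (2 ^ i * k.pStart n * ((nbhd pos (running V cfg) x 2).card : ℝ)) ≤
      k.cEps * (κ * 2 ^ γ * k.C₁) - j

variable {V : Finset (Fin n)} {t i j : ℕ} {cfg : Fin n → Option (NoSState Msg)}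

theorem curProb_of_running {v : Fin n} (hv : v ∈ running V cfg) :
    curProb k i cfg v = 2 ^ i * k.pStart n := by
  rw [curProb, (mem_running.1 hv).2, Option.getD_none]

theorem Stable.curProb_nonneg (h : Stable M pos γ κ k m V t i j cfg) (hk : k.Positive)
    (hn : 2 ≤ n) {v : Fin n} (hv : v ∈ V) : 0 ≤ curProb k i cfg v := by
  rcases hc : colorOf (cfg v) with _ | c
  · rw [curProb, hc, Option.getD_none]
    have := NoSConstants.pStart_pos hk hn
    positivity
  · rw [curProb, hc, Option.getD_some]
    exact (h.color v hv c hc).1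

theorem sum_curProb_running {A : Finset (Fin n)} (hA : A ⊆ running V cfg) :
    ∑ v ∈ A, curProb k i cfg v = 2 ^ i * k.pStart n * A.card := by
  rw [Finset.sum_congr rfl fun v hv => curProb_of_running (hA hv), Finset.sum_const,
    nsmul_eq_mul, mul_comm]

theorem nbhd_subset {Q : Finset (Fin n)} {x : X} {r : ℝ} : nbhd pos Q x r ⊆ Q :=
  fun _ h => (mem_nbhd.1 h).1

/-- Initially even all `n` stations together have mass `n * pStart = C₁ / 2`. -/
theorem stable_start (hk : k.Positive) (hn : 2 ≤ n) (h : InPhase m t V cfg)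
    (hcol : ∀ v ∈ V, colorOf (cfg v) = none) (hcnt : ∀ v ∈ V, countOf (cfg v) = 0) :
    Stable M pos γ κ k m V t 0 0 cfg := by
  have hC₁ : 0 < k.C₁ := hk.2.2.2.2.2.1
  have hrun : running V cfg = V := by
    ext v
    rw [mem_running]
    exact ⟨fun h => h.1, fun h => ⟨h, hcol v h⟩⟩
  have hball : ∀ x, 2 ^ 0 * k.pStart n * ((nbhd pos V x 1).card : ℝ) ≤ k.C₁ / 2 := by
    intro x
    have h1 : ((nbhd pos V x 1).card : ℝ) ≤ n := by
      exact_mod_cast (Finset.card_le_univ _).trans (Fintype.card_fin n).le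
    have hp := NoSConstants.pStart_pos hk hn
    have h2 : k.pStart n * n = k.C₁ / 2 := by
      have : (n : ℝ) ≠ 0 := by positivity
      rw [NoSConstants.pStart]
      field_simp
    rw [pow_zero, one_mul, ← h2]
    gcongr
  refine ⟨by simpa using h, fun v hv => hcnt v (mem_running.1 hv).1, fun v hv c hc => ?_,
    fun x => ?_, fun x => ?_, fun v hv hc => absurd (hcol v hv) hc, fun x => Or.inl ?_⟩
  · rw [hcol v hv] at hc
    exact absurd hc.symm (Option.some_ne_none c)
  · rw [hrun]; linarith [hball x]
  · rw [sum_curProb_running (by rw [hrun]; exact nbhd_subset)]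
    have := hball x
    push_cast
    linarith
  · rw [hrun]; exact hball x

/-- After `c'` repetitions the second alternative of `progress` would make a nonnegative mass
negative, by `repetitions`. So every unit ball has running mass at most `C₁ / 2`: doubling restores
the bound `C₁`, adds at most `C₁ / 2` to the total, and covering a ball of radius `2` by unit balls
starts the countdown of `progress` anew. -/
theorem Stable.double (hX : BoundedGrowth X γ κ) (hk : Tuned M γ κ k s) (hn : 2 ≤ n)
    (hi : i < k.loops n) (h : Stable M pos γ κ k m V t i k.c' cfg) :
    Stable M pos γ κ k m V t (i + 1) 0 cfg := by
  have hC₁ : 0 < k.C₁ := hk.positive.2.2.2.2.2.1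
  have hcE : 0 < k.cEps := hk.positive.2.2.2.2.1
  have hp := NoSConstants.pStart_pos hk.positive hn
  have hκ := hk.κ_pos
  have h2 : (2 : ℝ) ^ (i + 1) * k.pStart n = 2 * (2 ^ i * k.pStart n) := by ring
  have hp0 : 0 < 2 ^ i * k.pStart n := by positivity
  have hhalf : ∀ x, 2 ^ i * k.pStart n * ((nbhd pos (running V cfg) x 1).card : ℝ) ≤
      k.C₁ / 2 := by
    intro x
    refine (h.progress x).resolve_right fun hle => ?_
    have h3 : 0 ≤ k.cEps * (2 ^ i * k.pStart n * ((nbhd pos (running V cfg) x 2).card : ℝ)) := by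
      positivity
    linarith [hk.repetitions]
  have hball : ∀ x, 2 ^ (i + 1) * k.pStart n * ((nbhd pos (running V cfg) x 1).card : ℝ) ≤
      k.C₁ := by
    intro x
    rw [h2]
    linarith [hhalf x]
  have hmono : ∀ v, curProb k i cfg v ≤ curProb k (i + 1) cfg v := by
    intro v
    rcases hc : colorOf (cfg v) with _ | c
    · simp only [curProb, hc, Option.getD_none]
      linarith
    · simp only [curProb, hc, Option.getD_some, le_refl]
  refine ⟨?_, h.count, fun v hv c hc => ?_, hball, fun x => ?_, fun v hv hc => ⟨?_, ?_⟩,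
    fun x => Or.inr ?_⟩
  · have := h.inPhase
    rwa [show (i + 1) * k.c' + 0 = i * k.c' + k.c' by ring]
  · have := h.color v hv c hc
    exact ⟨this.1, by linarith [this.2]⟩
  · have hsum : ∑ v ∈ nbhd pos V x 1, curProb k (i + 1) cfg v =
        ∑ v ∈ nbhd pos V x 1, curProb k i cfg v +
          2 ^ i * k.pStart n * ((nbhd pos (running V cfg) x 1).card : ℝ) := by
      rw [← sum_curProb_running (k := k) (i := i) (nbhd_subset (pos := pos) (x := x) (r := 1))]
      have hfil : nbhd pos (running V cfg) x 1 =
          (nbhd pos V x 1).filter fun v => v ∈ running V cfg := by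
        ext v
        simp only [mem_nbhd, Finset.mem_filter, mem_running]
        tauto
      rw [hfil, Finset.sum_filter, ← Finset.sum_add_distrib]
      refine Finset.sum_congr rfl fun v hv => ?_
      split_ifs with hr
      · rw [curProb_of_running hr, curProb_of_running hr]
        ring
      · have hc : colorOf (cfg v) ≠ none := fun hc =>
          hr (mem_running.2 ⟨nbhd_subset hv, hc⟩)
        obtain ⟨c, hc⟩ := Option.ne_none_iff_exists'.1 hc
        simp only [curProb, hc, Option.getD_some, add_zero]
    rw [hsum]
    have h3 := h.total x
    have h4 := hhalf x
    push_cast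
    linarith
  · have := NoSConstants.pow_mul_pStart_lt hk.positive hn hi
    linarith
  · exact (h.near v hv hc).2.trans (Finset.sum_le_sum fun w _ => hmono w)
  · have := sum_nbhd_le hX (pos := pos) (Q := running V cfg)
      (w := fun _ => 2 ^ (i + 1) * k.pStart n) (fun _ => by positivity)
      one_pos hC₁.le (fun y => by
        rw [Finset.sum_const, nsmul_eq_mul, mul_comm]
        exact hball y) x (a := 2) (by norm_num)
    rw [Finset.sum_const, nsmul_eq_mul, mul_comm, Nat.cast_ofNat, mul_one] at this
    rw [Nat.cast_zero, sub_zero]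
    exact mul_le_mul_of_nonneg_left this hcE.le

theorem coe_densityProb (hk : Tuned M γ κ k s) (hn : 2 ≤ n) {b : ℕ} (hb : b / k.c' < k.loops n) :
    (densityProb k n b : ℝ) = 2 ^ (b / k.c') * k.pStart n := by
  have h1 := NoSConstants.pow_mul_pStart_lt hk.positive hn hb
  have h2 := NoSConstants.pStart_pos hk.positive hn
  have h3 : k.pMax ≤ 1 := by
    have := hk.cEps_ge
    rw [NoSConstants.pMax, hk.C₂_eq, div_le_one (by linarith)]
    linarith
  rw [densityProb, Set.projIcc_of_mem zero_le_one ⟨by positivity, by linarith⟩]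

/-- Inside the loop `p_v < pMax = C₂ / cEps`, and `C₂ = 1/4` is chosen so that Playoff probabilities
stay below `1/4` and the truncation to `[0, 1]` is inactive. -/
theorem coe_playoffProb (hk : Tuned M γ κ k s) (hn : 2 ≤ n) {b : ℕ} (hb : b / k.c' < k.loops n) :
    (playoffProb k n b : ℝ) = 2 ^ (b / k.c') * k.pStart n * k.cEps ∧
      (playoffProb k n b : ℝ) ≤ 1 / 4 := by
  have h1 := NoSConstants.pow_mul_pStart_lt hk.positive hn hb
  have h2 := NoSConstants.pStart_pos hk.positive hn
  have hcE := hk.cEps_ge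
  have h3 : 2 ^ (b / k.c') * k.pStart n * k.cEps ≤ 1 / 4 := by
    rw [NoSConstants.pMax, hk.C₂_eq, lt_div_iff₀ (by linarith)] at h1
    exact h1.le
  have h4 : (playoffProb k n b : ℝ) = 2 ^ (b / k.c') * k.pStart n * k.cEps := by
    rw [playoffProb, Set.projIcc_of_mem zero_le_one ⟨by positivity, by linarith⟩]
  exact ⟨h4, h4 ▸ h3⟩

/-- A station that passes both tests has a large total transmission probability near it. -/
theorem nearProb_le_of_hears (hinj : Function.Injective pos) (hk : Tuned M γ κ k s) (hn : 2 ≤ n)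
    {b : ℕ} (hb : b / k.c' < k.loops n) (S : Finset (Fin n)) {v : Fin n}
    (hD : k.c₁ / (8 * k.c₀) <
      rprob (uniformOn S (densityProb k n b)) fun T => M.Hears pos T v)
    (hP : k.c₃ / (8 * k.c₂) <
      rprob (uniformOn S (playoffProb k n b)) fun T => M.Hears pos T v) :
    k.nearProb ≤ 2 ^ (b / k.c') * k.pStart n * (nbhd pos S (pos v) (M.ε / 2)).card := by
  have hcE : 0 < k.cEps := hk.positive.2.2.2.2.1
  have h1 := rprob_hears_le_sum (pos := pos) hk.β_ge hk.noise_pos hk.α_pos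
    (uniformOn S (densityProb k n b)) (Q := S) (fun v hv => mem_of_uniformOn_ne_zero hv) v
  have h2 := rprob_hears_le_near_add (pos := pos) hk.β_ge hk.noise_pos hk.α_pos
    (uniformOn S (playoffProb k n b)) (Q := S) (fun v hv => mem_of_uniformOn_ne_zero hv) v hinj
    (r := M.ε / 2) (by linarith [hk.ε_pos])
  rw [sum_uniformOn _ nbhd_subset, coe_densityProb hk hn hb] at h1
  rw [sum_uniformOn _ nbhd_subset, sum_uniformOn _ nbhd_subset,
    (coe_playoffProb hk hn hb).1] at h2
  set p := 2 ^ (b / k.c') * k.pStart n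
  set a : ℝ := ((nbhd pos S (pos v) 1).card : ℝ)
  set a' : ℝ := ((nbhd pos S (pos v) (M.ε / 2)).card : ℝ)
  -- The passed DensityTest bounds the mass of the unit ball from below. Multiplied by `cEps`, it
  -- makes the exponential term at most half of the Playoff threshold, by `near_num`; the other half
  -- must come from stations within `ε / 2`.
  have h3 : Real.exp (-(p * k.cEps * a) / 2) ≤
      Real.exp (-(k.cEps * (k.c₁ / (8 * k.c₀))) / 2) := by
    refine Real.exp_le_exp.2 ?_
    have := mul_le_mul_of_nonneg_left (hD.le.trans h1) hcE.le
    linarith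
  have h4 := mul_le_mul_of_nonneg_left h3
    (by positivity : (0 : ℝ) ≤ 2 ^ (1 + (M.ε / 2) ^ (-M.α)))
  have h5 := hk.near_num
  rw [NoSConstants.nearProb, div_le_iff₀ (by positivity)]
  linarith

/-- One block either finds the unit ball already at mass at most `C₁ / 2`, which persists because
the running set shrinks, or it makes a set of Playoff mass at least `1` in the ball of radius `2`
quit. -/
theorem Stable.leads_succ (hX : BoundedGrowth X γ κ) (hinj : Function.Injective pos)
    (hk : Tuned M γ κ k s) (hn : 2 ≤ n) (ht : t % k.phaseLen n = 0) (hi : i < k.loops n)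
    (hj : j < k.c') :
    Leads (nosTx M k) (nosNext M pos k) (k.testLen n) (Stable M pos γ κ k m V t i j)
      (Stable M pos γ κ k m V t i (j + 1)) (n * (3 * (n : ℝ) ^ (-s))) := by
  intro cfg h
  set b := i * k.c' + j with hb
  have hbi : b / k.c' = i := by
    rw [hb, Nat.mul_comm, Nat.mul_add_div (by omega), Nat.div_eq_of_lt hj, add_zero]
  have hbl : b / k.c' < k.loops n := by omega
  have hble : (b + 1) * k.testLen n ≤ k.part1Len n := by
    rw [NoSConstants.part1Len, ← mul_assoc]
    refine Nat.mul_le_mul_right _ ?_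
    have : (i + 1) * k.c' ≤ k.loops n * k.c' := Nat.mul_le_mul_right _ hi
    rw [add_mul, one_mul] at this
    omega
  have hstart : BlockStart k n (t + b * k.testLen n) b := by
    refine ⟨?_, hble⟩
    have h2 := NoSConstants.part2Len_pos hk.positive hn
    rw [add_mul, one_mul] at hble
    have h3 : b * k.testLen n < k.phaseLen n := by rw [NoSConstants.phaseLen]; omega
    rw [Nat.add_mod, ht, zero_add, Nat.mod_mod, Nat.mod_eq_of_lt h3]
  set χ : Fin n → Option ℝ := fun v => colorOf (cfg v) with hχ
  have hS : uncolored V χ = running V cfg := rfl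
  have hdl := NoSConstants.densityLen_pos hk.positive hn
  have hpl := NoSConstants.playoffLen_pos hk.positive hn
  have htl : k.testLen n = k.densityLen n + k.playoffLen n := rfl
  have hmain := leads_block (M := M) (pos := pos) (m := m) hk.positive hn hstart hk.c₀_ge hk.c₂_ge
    hk.s_le₁ hk.s_le₃ V χ
  rw [hbi] at hmain
  refine (hmain.mono (fun _ h => h) (fun cfg' h' => ?_) le_rfl) cfg
    ⟨⟨h.inPhase, fun v hv => ⟨fun _ => rfl, fun hc => ⟨fun _ => hc, fun h => absurd h (by omega),
      fun _ => Or.inl hc⟩⟩⟩, h.count⟩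
  obtain ⟨⟨hphase, hcolors⟩, hout⟩ := h'
  have hp := NoSConstants.pStart_pos hk.positive hn
  set p := 2 ^ i * k.pStart n with hpdef
  have hp0 : 0 < p := by positivity
  have hcE : 0 < k.cEps := hk.positive.2.2.2.2.1
  have hsub : running V cfg' ⊆ running V cfg := by
    intro v hv
    obtain ⟨hvV, hc⟩ := mem_running.1 hv
    refine mem_running.2 ⟨hvV, ?_⟩
    by_contra hne
    rw [(hcolors v hvV).1 hne] at hc
    exact hne hc
  -- A station quits with the current value as its color, so `curProb` does not change during a
  -- block and the clauses `total` and `near` are inherited.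
  have hcur : ∀ v ∈ V, curProb k i cfg' v = curProb k i cfg v := by
    intro v hv
    by_cases hc : χ v = none
    · have h1 : colorOf (cfg v) = none := hc
      rcases ((hcolors v hv).2 hc).2.2 rfl with h2 | h2
      · simp only [curProb, h1, h2]
      · simp only [curProb, h1, h2, Option.getD_some, Option.getD_none]
        rfl
    · have h1 : colorOf (cfg' v) = colorOf (cfg v) := (hcolors v hv).1 hc
      simp only [curProb, h1]
  have hcursum : ∀ x r, ∑ v ∈ nbhd pos V x r, curProb k i cfg' v =
      ∑ v ∈ nbhd pos V x r, curProb k i cfg v :=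
    fun x r => Finset.sum_congr rfl fun v hv => hcur v (nbhd_subset hv)
  have hpcE : ∀ x r, p * ((nbhd pos (running V cfg') x r).card : ℝ) ≤
      p * ((nbhd pos (running V cfg) x r).card : ℝ) := fun x r => by
    refine mul_le_mul_of_nonneg_left (Nat.cast_le.2 (Finset.card_le_card ?_)) hp0.le
    exact nbhd_mono hsub le_rfl
  refine ⟨?_, fun v hv => ?_, fun v hv c hc => ?_, fun x => (hpcE x 1).trans (h.ball x), fun x => ?_,
    fun v hv hc => ?_, fun x => ?_⟩
  · rwa [show t + (i * k.c' + (j + 1)) * k.testLen n = t + b * k.testLen n + k.testLen n by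
      rw [hb]; ring]
  · obtain ⟨hvV, -⟩ := mem_running.1 hv
    exact ((hcolors v hvV).2 (mem_running.1 (hsub hv)).2).2.1 (Or.inr rfl)
  · by_cases hcn : χ v = none
    · rcases ((hcolors v hv).2 hcn).2.2 rfl with h2 | h2
      · rw [h2] at hc
        exact absurd hc.symm (Option.some_ne_none c)
      · rw [h2] at hc
        obtain rfl := Option.some.inj hc
        exact ⟨hp0.le, le_rfl⟩
    · rw [(hcolors v hv).1 hcn] at hc
      exact h.color v hv c hc
  · rw [hcursum]; exact h.total x
  · rw [hcursum]
    by_cases hcn : χ v = none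
    · have hvS : v ∈ uncolored V χ := mem_uncolored.2 ⟨hv, hcn⟩
      have h1 := mt (hout v hvS).1 hc
      rw [not_or, not_le, not_le] at h1
      have h2 := nearProb_le_of_hears hinj hk hn hbl _ h1.1 h1.2
      rw [hbi, hS] at h2
      refine ⟨?_, h2.trans ?_⟩
      · have := NoSConstants.pow_mul_pStart_lt hk.positive hn hi
        linarith [NoSConstants.pMax_pos hk.positive]
      · rw [← sum_curProb_running nbhd_subset]
        exact Finset.sum_le_sum_of_subset_of_nonneg
          (nbhd_mono (fun w hw => (mem_running.1 hw).1) le_rfl)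
          fun w hw _ => h.curProb_nonneg hk.positive hn (nbhd_subset hw)
    · exact h.near v hv hcn
  · by_cases hle : p * ((nbhd pos (running V cfg) x 1).card : ℝ) ≤ k.C₁ / 2
    · exact Or.inl ((hpcE x 1).trans hle)
    right
    have hprog := (h.progress x).resolve_left hle
    obtain ⟨ρ, l, hρ, hl, hnum2, hnum3, hplay⟩ := hk.playoff_num
    have hpD := coe_densityProb hk hn hbl
    obtain ⟨hpP, hpP4⟩ := coe_playoffProb hk hn hbl
    rw [hbi] at hpD hpP
    obtain ⟨B, hBsub, hB1, hB⟩ := exists_subset_receives hk.β_ge hk.noise_pos hk.γ_lt hk.α_pos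
      hk.κ_pos hX hinj (running V cfg) (p := densityProb k n b) (y := playoffProb k n b)
      (cE := k.cEps) hcE (by rw [hpD, hpP]; ring) hpP4 hk.positive.2.2.2.2.2.1 hk.C₁_le
      (fun y => by rw [hpD]; exact h.ball y) hρ hl hk.density_num hnum2 hnum3 (x₀ := x)
      (by rw [hpD]; exact not_le.1 hle)
    rw [hpD] at hB1
    -- The stations of `B` are above the upper thresholds of both tests, so the outcome of the block
    -- forces them to quit.
    have hquit : ∀ u ∈ B, u ∉ running V cfg' := by
      intro u hu hu'
      obtain ⟨hu1, hu2⟩ := hB u hu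
      have huS : u ∈ uncolored V χ := nbhd_subset (hBsub hu)
      refine (hout u huS).2 ⟨?_, ?_⟩ (mem_running.1 hu').2
      · exact hk.density_le.trans (hu1.trans (rprob_mono _ fun T _ h => Or.inr h))
      · exact hplay.trans (hu2.trans (rprob_mono _ fun T _ h => Or.inr h))
    have hcard : ((nbhd pos (running V cfg') x 2).card : ℝ) + B.card ≤
        (nbhd pos (running V cfg) x 2).card := by
      rw [← Nat.cast_add, ← Finset.card_union_of_disjoint]
      · exact Nat.cast_le.2 (Finset.card_le_card (Finset.union_subset (nbhd_mono hsub le_rfl)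
          hBsub))
      · exact Finset.disjoint_left.2 fun u hu hu' => hquit u hu' (nbhd_subset hu)
    have h1 := mul_le_mul_of_nonneg_left hcard (mul_pos hcE hp0).le
    push_cast
    linarith

theorem leads_stabilize (hX : BoundedGrowth X γ κ) (hinj : Function.Injective pos)
    (hk : Tuned M γ κ k s) (hn : 2 ≤ n) (ht : t % k.phaseLen n = 0) :
    Leads (nosTx M k) (nosNext M pos k) (k.part1Len n) (Stable M pos γ κ k m V t 0 0)
      (Stable M pos γ κ k m V t (k.loops n) 0)
      (k.loops n * (k.c' * (n * (3 * (n : ℝ) ^ (-s))))) := by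
  refine Leads.iterate (I := fun i => Stable M pos γ κ k m V t i 0) (by positivity)
    fun i hi => ?_
  exact (Leads.iterate (I := fun j => Stable M pos γ κ k m V t i j) (by positivity)
    fun j hj => Stable.leads_succ hX hinj hk hn ht hi hj).mono (fun _ h => h)
    (fun _ h => h.double hX hk hn hi) le_rfl

/-- The colors at the end of StabilizeProbability. -/
noncomputable def finalProb (k : NoSConstants) (cfg : Fin n → Option (NoSState Msg))
    (v : Fin n) : ℝ :=
  (colorOf (cfg v)).getD (2 * k.pMax)

/-- If the loop has no iteration, `pStart` may exceed `2 * pMax`. The bound is therefore taken from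
`near`, which asserts it only when some station has quit. -/
theorem Stable.finalProb_mem (hk : Tuned M γ κ k s)
    (h : Stable M pos γ κ k m V t (k.loops n) 0 cfg) {v : Fin n} (hv : v ∈ V) :
    0 ≤ finalProb k cfg v ∧ finalProb k cfg v ≤ 2 * k.pMax := by
  have := NoSConstants.pMax_pos hk.positive
  rcases hc : colorOf (cfg v) with _ | c
  · rw [finalProb, hc, Option.getD_none]
    exact ⟨by linarith, le_rfl⟩
  · rw [finalProb, hc, Option.getD_some]
    obtain ⟨h1, h2⟩ := h.color v hv c hc
    exact ⟨h1, h2.trans (h.near v hv (by simp [hc])).1⟩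

/-- A station that has not quit jumps from at least `pMax` to `2 * pMax`, so its color is at most
twice its current value. As the running mass is at most `C₁`, this is covered by adding `2 * C₁` to
the bound for the current values. -/
theorem Stable.sum_finalProb_le (hk : Tuned M γ κ k s) (hn : 2 ≤ n)
    (h : Stable M pos γ κ k m V t (k.loops n) 0 cfg) (x : X) :
    ∑ v ∈ nbhd pos V x 1, finalProb k cfg v ≤ ((k.loops n : ℝ) + 3) * k.C₁ := by
  have hpm := NoSConstants.pMax_le_pow_mul_pStart hk.positive hn
  have h1 : ∑ v ∈ nbhd pos V x 1, finalProb k cfg v ≤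
      ∑ v ∈ nbhd pos V x 1, curProb k (k.loops n) cfg v +
        2 * ∑ v ∈ nbhd pos (running V cfg) x 1, curProb k (k.loops n) cfg v := by
    have hfil : nbhd pos (running V cfg) x 1 =
        (nbhd pos V x 1).filter fun v => v ∈ running V cfg := by
      ext v
      simp only [mem_nbhd, Finset.mem_filter, mem_running]
      tauto
    rw [hfil, Finset.sum_filter, Finset.mul_sum, ← Finset.sum_add_distrib]
    refine Finset.sum_le_sum fun v hv => ?_
    split_ifs with hr
    · rw [curProb_of_running hr, finalProb, (mem_running.1 hr).2, Option.getD_none]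
      have := NoSConstants.pMax_pos hk.positive
      linarith
    · have hc : colorOf (cfg v) ≠ none := fun hc =>
        hr (mem_running.2 ⟨nbhd_subset hv, hc⟩)
      obtain ⟨c, hc⟩ := Option.ne_none_iff_exists'.1 hc
      simp [curProb, finalProb, hc]
  rw [sum_curProb_running nbhd_subset] at h1
  linarith [h.total x, h.ball x]

/-- A station that never quit suffices alone: its color is `2 * pMax = 1 / (2 * cEps)`, and `c₃ / (8
* c₂) ≤ 1`. Near a station that quit, passing to final colors only increases the terms, since `2 ^ i
* pStart ≤ 2 * pMax`. -/
theorem Stable.nearProb_le_sum (hk : Tuned M γ κ k s)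
    (h : Stable M pos γ κ k m V t (k.loops n) 0 cfg) {v : Fin n} (hv : v ∈ V) :
    k.nearProb ≤ ∑ w ∈ nbhd pos V (pos v) (M.ε / 2), finalProb k cfg w := by
  by_cases hc : colorOf (cfg v) = none
  · have h1 : k.nearProb ≤ finalProb k cfg v := by
      rw [finalProb, hc, Option.getD_none, NoSConstants.nearProb, NoSConstants.pMax, hk.C₂_eq]
      obtain ⟨ρ, l, -, -, -, -, hplay⟩ := hk.playoff_num
      have h2 : Real.exp (-(2 * (κ * ((4 * ρ : ℕ) : ℝ) ^ γ))) ≤ 1 := by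
        rw [Real.exp_le_one_iff]
        have := hk.κ_pos
        have : 0 ≤ 2 * (κ * ((4 * ρ : ℕ) : ℝ) ^ γ) := by positivity
        linarith
      have h3 : k.c₃ / (8 * k.c₂) = (4 * k.c₃ / k.c₂) / 32 := by
        have : k.c₂ ≠ 0 := by linarith [hk.c₂_ge]
        field_simp
        ring
      have hcE : 0 < k.cEps := hk.positive.2.2.2.2.1
      have h4 : 2 * (1 / 4 / k.cEps) = 1 / (2 * k.cEps) := by field_simp; norm_num
      rw [h4]
      exact div_le_div_of_nonneg_right (by linarith) (by positivity)
    refine h1.trans (Finset.single_le_sum (f := fun w => finalProb k cfg w)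
      (fun w hw => (h.finalProb_mem hk (nbhd_subset hw)).1) (mem_nbhd.2 ⟨hv, ?_⟩))
    rw [dist_self]
    linarith [hk.ε_pos]
  · obtain ⟨h1, h2⟩ := h.near v hv hc
    refine h2.trans (Finset.sum_le_sum fun w _ => ?_)
    rcases hw : colorOf (cfg w) with _ | c
    · simpa only [curProb, finalProb, hw, Option.getD_none] using h1
    · simp only [curProb, finalProb, hw, Option.getD_some, le_refl]

end Stabilize

/-! ### The second part of a phase -/

section Spread

open SINRParams

variable {Msg : Type} {X : Type*} [MetricSpace X] {n : ℕ} {M : SINRParams} {pos : Fin n → X}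
  {k : NoSConstants} {m : Msg} {γ κ s : ℝ} {V : Finset (Fin n)} {t i : ℕ}
  {cfg : Fin n → Option (NoSState Msg)} {T : Finset (Fin n)}

/-- Waking in the last round of a phase is no exception: such a station sees that the next round
starts a phase and is active at once, like all others. -/
theorem Sync.fresh_next (h : Sync m t cfg) (ht : t % k.phaseLen n + 1 = k.phaseLen n) {v : Fin n}
    {st : NoSState Msg} (hst : nosNext M pos k cfg T v = some st) :
    st = NoSState.fresh m (t + 1) := by
  have hmod : (t + 1) % k.phaseLen n = 0 := by
    rw [Nat.add_mod, ← Nat.add_mod_right]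
    have h1 : t % k.phaseLen n + 1 % k.phaseLen n = k.phaseLen n ∨
        1 % k.phaseLen n = 0 ∧ t % k.phaseLen n = 0 := by
      rcases Nat.lt_or_ge 1 (k.phaseLen n) with h | h
      · left; rw [Nat.mod_eq_of_lt h]; exact ht
      · right
        have : k.phaseLen n = 1 := by omega
        rw [this]
        exact ⟨rfl, Nat.mod_one _⟩
    rcases h1 with h1 | ⟨h1, h2⟩
    · rw [h1]; simp
    · rw [h1, h2]; simp
  rcases hv : cfg v with _ | st'
  · rw [nosNext_of_none hv] at hst
    obtain ⟨q, hq, rfl⟩ := Option.map_eq_some_iff.1 hst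
    obtain ⟨rfl, -⟩ := h.received_eq hq
    simp [nosWake, NoSState.fresh, hmod]
  · rw [nosNext_of_some hv] at hst
    obtain rfl := Option.some.inj hst
    obtain ⟨h1, h2⟩ := h v st' hv
    rw [nosUpdate, h2, if_pos ht, h1]

/-- The part of the configuration that is not random in round `i` of the second part of a phase,
which begins in round `t`. -/
def InSpread (m : Msg) (k : NoSConstants) (V : Finset (Fin n)) (χ : Fin n → Option ℝ)
    (t i : ℕ) (cfg : Fin n → Option (NoSState Msg)) : Prop :=
  Sync m (t + i) cfg ∧ (∀ v ∈ V, cfg v ≠ none) ∧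
    (i < k.part2Len n → InPhase m (t + i) V cfg ∧ ∀ v ∈ V, colorOf (cfg v) = χ v) ∧
    (i = k.part2Len n → ∀ v st, cfg v = some st → st = NoSState.fresh m (t + i))

variable {χ : Fin n → Option ℝ}

theorem spread_mod (ht : t % k.phaseLen n = k.part1Len n) (hi : i < k.part2Len n) :
    (t + i) % k.phaseLen n = k.part1Len n + i := by
  have h : k.phaseLen n = k.part1Len n + k.part2Len n := rfl
  rw [Nat.add_mod, ht, Nat.mod_eq_of_lt (a := i) (by omega), Nat.mod_eq_of_lt (by omega)]

variable (M pos) in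
theorem InSpread.next (ht : t % k.phaseLen n = k.part1Len n) (hi : i < k.part2Len n)
    (h : InSpread m k V χ t i cfg) :
    InSpread m k V χ t (i + 1) (nosNext M pos k cfg T) := by
  obtain ⟨h1, h2, h3, -⟩ := h
  have hph : k.phaseLen n = k.part1Len n + k.part2Len n := rfl
  have hmod := spread_mod ht hi
  refine ⟨h1.next, fun v hv => nosNext_ne_none (h2 v hv), fun hi' => ?_, fun hi' v st hst => ?_⟩
  · obtain ⟨h4, h5⟩ := h3 hi
    refine ⟨h4.next (by omega), fun v hv => ?_⟩
    rw [h4.color_next (by omega) hv (Or.inl (by omega)), h5 v hv]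
  · exact h1.fresh_next (by omega) hst

/-- The transmission probabilities in the second part of a phase. -/
noncomputable def spreadProb (M : SINRParams) (k : NoSConstants) (V : Finset (Fin n))
    (cfg : Fin n → Option (NoSState Msg)) (v : Fin n) : unitInterval :=
  open Classical in
  if v ∈ V then
    Set.projIcc 0 1 zero_le_one (finalProb k cfg v / (k.c * M.ε * Real.logb 2 n))
  else 0

theorem InSpread.nosTx_eq (ht : t % k.phaseLen n = k.part1Len n) (hi : i < k.part2Len n)
    {cfg₀ : Fin n → Option (NoSState Msg)}
    (h : InSpread m k V (fun v => colorOf (cfg₀ v)) t i cfg) :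
    nosTx M k cfg = spreadProb M k V cfg₀ := by
  obtain ⟨h3, h4⟩ := h.2.2.1 hi
  have hmod := spread_mod ht hi
  funext v
  by_cases hv : v ∈ V
  · rw [h3.nosTx_part2 (by omega) hv, spreadProb, if_pos hv, finalProb, h4 v hv]
  · rw [h3.nosTx_of_notMem hv, spreadProb, if_neg hv]

theorem Stable.coe_spreadProb (hk : Tuned M γ κ k s) (hn : 2 ≤ n)
    (h : Stable M pos γ κ k m V t (k.loops n) 0 cfg) {v : Fin n} (hv : v ∈ V) :
    (spreadProb M k V cfg v : ℝ) = finalProb k cfg v / (k.c * M.ε * Real.logb 2 n) := by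
  obtain ⟨h1, h2⟩ := h.finalProb_mem hk hv
  have hc : 0 < k.c * M.ε := mul_pos hk.positive.2.2.2.2.2.2.2.1 hk.ε_pos
  have hL := NoSConstants.one_le_logb hn
  rw [spreadProb, if_pos hv, Set.projIcc_of_mem]
  refine ⟨by positivity, ?_⟩
  rw [div_le_one (by positivity)]
  have := hk.c_ge
  nlinarith

/-- In every round of the second part of a phase, a neighbor of an active station receives the
message with probability at least of order `1 / log n`. -/
theorem Stable.rprob_receives_ge (hX : BoundedGrowth X γ κ) (hinj : Function.Injective pos)
    (hk : Tuned M γ κ k s) (hn : 2 ≤ n)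
    (h : Stable M pos γ κ k m V t (k.loops n) 0 cfg) {u v : Fin n} (hu : u ∉ V) (hv : v ∈ V)
    (huv : dist (pos v) (pos u) ≤ 1 - M.ε) :
    k.nearProb / (4 * (k.c * M.ε)) / Real.logb 2 n ≤
      rprob (spreadProb M k V cfg) fun T => M.Receives' pos T u := by
  have hc : 0 < k.c * M.ε := mul_pos hk.positive.2.2.2.2.2.2.2.1 hk.ε_pos
  have hL := NoSConstants.one_le_logb hn
  obtain ⟨μ, hμ, hμ1, hnum, hloops⟩ := hk.part2_num
  have hcL : 0 < k.c * M.ε * Real.logb 2 n := by positivity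
  have hsum : ∀ x r, ∑ z ∈ nbhd pos V x r, (spreadProb M k V cfg z : ℝ) =
      (∑ z ∈ nbhd pos V x r, finalProb k cfg z) / (k.c * M.ε * Real.logb 2 n) := fun x r => by
    rw [Finset.sum_div]
    exact Finset.sum_congr rfl fun z hz => h.coe_spreadProb hk hn (nbhd_subset hz)
  -- The senders are the active stations within `ε / 2` of `v`, hence within `1 - ε / 2` of `u`. The
  -- remaining slack below the range `1` absorbs interference of mass `μ` per unit ball.
  have := rprob_receives_ge_of_unit_balls hk.β_ge hk.noise_pos hk.γ_lt hk.α_pos hk.κ_pos hX hinj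
    (spreadProb M k V cfg) hμ hμ1 (fun x => by
      calc ∑ z ∈ nbhd pos Finset.univ x 1, (spreadProb M k V cfg z : ℝ)
          = ∑ z ∈ nbhd pos V x 1, (spreadProb M k V cfg z : ℝ) := by
            symm
            refine Finset.sum_subset (nbhd_mono (Finset.subset_univ V) le_rfl) fun w hw hw' => ?_
            rw [spreadProb, if_neg]
            · rfl
            · exact fun hwV => hw' (mem_nbhd.2 ⟨hwV, (mem_nbhd.1 hw).2⟩)
        _ ≤ μ := by
            rw [hsum, div_le_iff₀ hcL]
            exact (h.sum_finalProb_le hk hn x).trans (hloops n hn)) (u := u)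
    (W := nbhd pos V (pos v) (M.ε / 2)) (r := 1 - M.ε / 2) (by linarith [hk.ε_pos])
    (fun w hw => ⟨fun h => hu (h ▸ nbhd_subset hw), by
      have h1 := dist_triangle (pos w) (pos v) (pos u)
      have h2 := (mem_nbhd.1 hw).2
      linarith⟩) hnum
  refine le_trans ?_ this
  rw [hsum]
  have h1 := div_le_div_of_nonneg_right (h.nearProb_le_sum hk hv) hcL.le
  calc k.nearProb / (4 * (k.c * M.ε)) / Real.logb 2 n
      = k.nearProb / (k.c * M.ε * Real.logb 2 n) / 4 := by rw [div_div, div_div]; congr 1; ring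
    _ ≤ _ := by linarith

theorem NoSConstants.nearProb_pos (hk : k.Positive) : 0 < k.nearProb := by
  obtain ⟨-, -, h2, h3, hE, -⟩ := hk
  rw [NoSConstants.nearProb]
  positivity

/-- Active stations keep their colors and newly woken ones stay silent, so every round offers a
sleeping neighbour the same chance `lam / log n`. Over `cT * log² n` rounds the failure probability
is at most `exp (-lam * cT * log n) ≤ n^(-s)`, and a union bound over the stations finishes. -/
theorem leads_spread (hX : BoundedGrowth X γ κ) (hinj : Function.Injective pos)
    (hk : Tuned M γ κ k s) (hn : 2 ≤ n) (ht : t % k.phaseLen n = 0) :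
    Leads (nosTx M k) (nosNext M pos k) (k.part2Len n)
      (Stable (Msg := Msg) M pos γ κ k m V t (k.loops n) 0)
      (fun cfg => (∀ v st, cfg v = some st → st = NoSState.fresh m (t + k.phaseLen n)) ∧
        (∀ v ∈ V, cfg v ≠ none) ∧
        ∀ u ∈ Finset.univ, (∃ v ∈ V, dist (pos v) (pos u) ≤ 1 - M.ε) → cfg u ≠ none)
      (n * (n : ℝ) ^ (-s)) := by
  intro cfg₀ h
  set t₁ := t + k.part1Len n with ht₁
  have h2 := NoSConstants.part2Len_pos hk.positive hn
  have hph : k.phaseLen n = k.part1Len n + k.part2Len n := rfl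
  have htmod : t₁ % k.phaseLen n = k.part1Len n := by
    rw [ht₁, Nat.add_mod, ht, zero_add, Nat.mod_mod, Nat.mod_eq_of_lt (by omega)]
  have htime : t + (k.loops n * k.c' + 0) * k.testLen n = t₁ := by
    rw [ht₁, NoSConstants.part1Len]; ring
  set χ : Fin n → Option ℝ := fun v => colorOf (cfg₀ v) with hχ
  have hphase := h.inPhase
  rw [htime] at hphase
  have hI₀ : InSpread m k V χ t₁ 0 cfg₀ := by
    refine ⟨hphase.1, fun v hv => ?_, fun _ => ⟨hphase, fun v hv => rfl⟩, fun h => by omega⟩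
    obtain ⟨st, hst, -⟩ := hphase.exists_state hv
    simp [hst]
  have hdet : Leads (nosTx M k) (nosNext M pos k) (k.part2Len n) (InSpread m k V χ t₁ 0)
      (InSpread m k V χ t₁ (k.part2Len n)) 0 :=
    Leads.of_invariant (I := fun i => InSpread m k V χ t₁ i)
      fun i hi cfg h T hT => h.next M pos htmod hi
  have hL := NoSConstants.one_le_logb hn
  have hc : 0 < k.c * M.ε := mul_pos hk.positive.2.2.2.2.2.2.2.1 hk.ε_pos
  have hη := NoSConstants.nearProb_pos hk.positive
  set lam := k.nearProb / (4 * (k.c * M.ε)) with hlam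
  have hlam0 : 0 < lam := by positivity
  have hone : ∀ u ∈ Finset.univ, Leads (nosTx M k) (nosNext M pos k) (k.part2Len n)
      (fun cfg => cfg = cfg₀)
      (fun cfg => (∃ v ∈ V, dist (pos v) (pos u) ≤ 1 - M.ε) → cfg u ≠ none)
      ((n : ℝ) ^ (-s)) := by
    intro u _
    by_cases huV : u ∈ V
    · exact hdet.mono (fun cfg h => h ▸ hI₀) (fun cfg h _ => h.2.1 u huV) (by positivity)
    by_cases hex : ∃ v ∈ V, dist (pos v) (pos u) ≤ 1 - M.ε
    · obtain ⟨v, hv, huv⟩ := hex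
      have hrec := h.rprob_receives_ge hX hinj hk hn huV hv huv
      rintro cfg rfl
      -- The potential is the indicator that `u` still sleeps; each round multiplies it by the
      -- indicator that `u` receives nothing.
      have hpot := expect_iterate_le_of_potential (p := nosTx M k) (nx := nosNext M pos k)
        (I := fun i => InSpread m k V χ t₁ i) (ℓ := k.part2Len n)
        (φ := fun cfg' : Fin n → Option (NoSState Msg) => ind (cfg' u = none))
        (B := fun cfg' => cfg' u = none) (q := spreadProb M k V cfg)
        (g := fun T => ind (¬M.Receives' pos T u)) (r := Real.exp (-(lam / Real.logb 2 n)))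
        (fun _ => ind_nonneg _) (by
          simp_rw [ind_not]
          rw [rexp_sub, rexp_const]
          have h3 : lam / Real.logb 2 n ≤ rexp (spreadProb M k V cfg)
              fun T => ind (M.Receives' pos T u) := hrec
          have h4 := Real.add_one_le_exp (-(lam / Real.logb 2 n))
          linarith) (Real.exp_pos _).le (fun i hi cfg' h' => h'.nosTx_eq htmod hi)
        (fun i hi cfg' h' T hT => ⟨h'.next M pos htmod (by omega), ?_⟩)
        (fun i hi cfg' h' T hT => ?_) (k.part2Len n - 1) 0 (by omega) cfg hI₀
      · rw [Nat.sub_add_cancel h2] at hpot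
        have hnot : (fun cfg' : Fin n → Option (NoSState Msg) =>
            ind ¬((∃ v ∈ V, dist (pos v) (pos u) ≤ 1 - M.ε) → cfg' u ≠ none)) =
            fun cfg' => ind (cfg' u = none) := by
          funext cfg'
          congr 1
          simp only [ne_eq, Classical.not_imp, not_not, eq_iff_iff, and_iff_right_iff_imp]
          exact fun _ => ⟨v, hv, huv⟩
        rw [hnot]
        refine hpot.trans ?_
        refine (mul_le_of_le_one_left (by positivity) (ind_le_one _)).trans ?_
        rw [← Real.exp_nat_mul, ← two_rpow_mul_logb hn]
        have hcT := hk.positive.2.2.2.2.2.2.2.2.1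
        have h5 : lam * k.cT * Real.logb 2 n ≤ k.part2Len n * (lam / Real.logb 2 n) := by
          have h6 : k.cT * Real.logb 2 n ^ 2 ≤ k.part2Len n := Nat.le_ceil _
          calc lam * k.cT * Real.logb 2 n
              = k.cT * Real.logb 2 n ^ 2 * (lam / Real.logb 2 n) := by field_simp
            _ ≤ _ := by gcongr
        calc Real.exp (k.part2Len n * -(lam / Real.logb 2 n))
            ≤ Real.exp (-(lam * k.cT * Real.logb 2 n)) := Real.exp_le_exp.2 (by linarith)
          _ ≤ 2 ^ (-(lam * k.cT * Real.logb 2 n)) := exp_neg_le_two_rpow (by positivity)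
          _ ≤ 2 ^ (-s * Real.logb 2 n) := by
              refine Real.rpow_le_rpow_of_exponent_le (by norm_num) ?_
              have h7 : s ≤ lam * k.cT := hk.s_le_cT
              nlinarith
      all_goals
        obtain ⟨h3, h4⟩ := h'.2.2.1 (by omega)
        have hTV : T ⊆ V := by
          refine h3.subset_of_tx (M := M) (k := k) fun v hv => ?_
          rw [h'.nosTx_eq htmod (by omega)]
          exact hT v hv
        rcases hcu : cfg' u with _ | st
        · rw [ind_of rfl, one_mul]
          refine ind_mono fun hnone hr => ?_
          rw [nosNext_of_none hcu] at hnone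
          rw [← h3.received_isSome (k := k) hTV] at hr
          rw [Option.map_eq_none_iff] at hnone
          rw [hnone] at hr
          exact Bool.false_ne_true hr
        · rw [ind_of_not (nosNext_ne_none (by simp [hcu]))]
          exact mul_nonneg (ind_nonneg _) (ind_nonneg _)
    · exact hdet.mono (fun cfg h => h ▸ hI₀) (fun cfg h h' => absurd h' hex) (by positivity)
  have hall := Leads.forall_finset Finset.univ hone
  rw [Finset.card_univ, Fintype.card_fin] at hall
  have hboth := (hdet.mono (I' := fun cfg => cfg = cfg₀) (fun cfg h => h ▸ hI₀)
    (fun _ h => h) le_rfl).and hall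
  refine hboth.mono (fun _ h => h) (fun cfg h => ⟨fun v st hst => ?_, h.1.2.1, h.2⟩) (by linarith)
    cfg₀ rfl
  have := h.1.2.2.2 rfl v st hst
  rwa [show t₁ + k.part2Len n = t + k.phaseLen n by omega] at this

/-! ### Phases -/

/-- The beginning of a phase in which the stations in `R` are awake. -/
def PhaseStart (m : Msg) (t : ℕ) (R : Fin n → Prop) (cfg : Fin n → Option (NoSState Msg)) : Prop :=
  (∀ v st, cfg v = some st → st = NoSState.fresh m t) ∧ ∀ v, R v → cfg v ≠ none

/-- The active set is the set of all awake stations in the given initial configuration, possibly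
larger than `R`. Fixing that configuration makes the set deterministic, as the analysis of both
parts requires. -/
theorem leads_phase (hX : BoundedGrowth X γ κ) (hinj : Function.Injective pos)
    (hk : Tuned M γ κ k s) (hn : 2 ≤ n) (ht : t % k.phaseLen n = 0) {R R' : Fin n → Prop}
    (hR : ∀ u, R' u → R u ∨ ∃ v, R v ∧ dist (pos v) (pos u) ≤ 1 - M.ε) :
    Leads (nosTx M k) (nosNext M pos k) (k.phaseLen n) (PhaseStart m t R)
      (PhaseStart m (t + k.phaseLen n) R')
      (k.loops n * (k.c' * (n * (3 * (n : ℝ) ^ (-s)))) + n * (n : ℝ) ^ (-s)) := by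
  classical
  intro cfg h
  set V : Finset (Fin n) := Finset.univ.filter fun v => cfg v ≠ none with hV
  have hmem : ∀ v, v ∈ V ↔ cfg v ≠ none := fun v => by simp [hV]
  have hstate : ∀ v, cfg v = none ∨ cfg v = some (NoSState.fresh m t) := fun v => by
    rcases hc : cfg v with _ | st
    · exact Or.inl rfl
    · exact Or.inr (by rw [h.1 v st hc])
  have hphase : InPhase m t V cfg := by
    refine ⟨fun v st hst => ?_, fun v => ?_⟩
    · rw [h.1 v st hst]
      exact ⟨rfl, rfl⟩
    · rw [hmem]
      rcases hstate v with hc | hc <;> simp [hc, activeOf, NoSState.fresh]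
  have hstart : Stable M pos γ κ k m V t 0 0 cfg :=
    stable_start hk.positive hn hphase
      (fun v _ => by rcases hstate v with hc | hc <;> simp [hc, colorOf, NoSState.fresh])
      (fun v _ => by rcases hstate v with hc | hc <;> simp [hc, countOf, NoSState.fresh])
  have := (leads_stabilize (V := V) (m := m) hX hinj hk hn ht).trans
    (leads_spread (V := V) (m := m) hX hinj hk hn ht) (by positivity)
  refine (this.mono (fun _ h => h) (fun cfg' h' => ⟨h'.1, fun u hu => ?_⟩) le_rfl) cfg hstart
  rcases hR u hu with hu | ⟨v, hv, hvu⟩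
  · exact h'.2.1 u ((hmem u).2 (h.2 u hu))
  · exact h'.2.2 u (Finset.mem_univ u) ⟨v, (hmem v).2 (h.2 v hv), hvu⟩

/-- After `D` phases, where `D` is the diameter, all stations are informed with high probability,
and this does not change later. -/
theorem leads_informed (hX : BoundedGrowth X γ κ) (hinj : Function.Injective pos)
    (hk : Tuned M γ κ k s) (hn : 2 ≤ n) (hconn : (M.commGraph pos).Connected) (src : Fin n)
    {t : ℕ} (ht : (M.commGraph pos).diam * k.phaseLen n ≤ t) :
    Leads (nosTx M k) (nosNext M pos k) t
      (fun cfg => cfg = fun v => if v = src then some (NoSState.fresh m 0) else none)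
      (fun cfg => ∀ v, ∃ st, cfg v = some st ∧ st.msg = m)
      ((M.commGraph pos).diam *
        (k.loops n * (k.c' * (n * (3 * (n : ℝ) ^ (-s)))) + n * (n : ℝ) ^ (-s))) := by
  set G := M.commGraph pos with hG
  have : Nonempty (Fin n) := ⟨src⟩
  -- After `a` phases every station joined to the source by a walk of length at most `a` is awake;
  -- the first edge of a longer walk supplies the neighbour that was awake one phase earlier.
  have hphases := Leads.iterate (p := nosTx M k) (nx := nosNext M pos k)
    (I := fun a => PhaseStart m (a * k.phaseLen n) fun v => ∃ w : G.Walk v src, w.length ≤ a)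
    (a := k.phaseLen n) (b := G.diam)
    (δ := k.loops n * (k.c' * (n * (3 * (n : ℝ) ^ (-s)))) + n * (n : ℝ) ^ (-s)) (by positivity)
    (fun a _ => by
      have := leads_phase (m := m) hX hinj hk hn (t := a * k.phaseLen n) (by simp)
        (R := fun v => ∃ w : G.Walk v src, w.length ≤ a)
        (R' := fun v => ∃ w : G.Walk v src, w.length ≤ a + 1) (by
          rintro u ⟨w, hw⟩
          cases w with
          | nil => exact Or.inl ⟨SimpleGraph.Walk.nil, Nat.zero_le _⟩
          | @cons _ v _ hadj w =>
            rw [SimpleGraph.Walk.length_cons] at hw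
            refine Or.inr ⟨v, ⟨w, by omega⟩, ?_⟩
            rw [dist_comm]
            exact hadj.2)
      rwa [show a * k.phaseLen n + k.phaseLen n = (a + 1) * k.phaseLen n by ring] at this)
  -- After `D` phases nothing random is left to prove: awake stations stay awake and keep the
  -- message, at any number of further rounds.
  set I : ℕ → (Fin n → Option (NoSState Msg)) → Prop := fun i cfg =>
    Sync m (G.diam * k.phaseLen n + i) cfg ∧ ∀ v, cfg v ≠ none with hI
  have hkeep := Leads.of_invariant (p := nosTx M k) (nx := nosNext M pos k) (I := I)
    (a := t - G.diam * k.phaseLen n)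
    (fun i _ cfg h T _ => ⟨h.1.next, fun v => nosNext_ne_none (h.2 v)⟩)
  have hmid : ∀ cfg, PhaseStart m (G.diam * k.phaseLen n)
      (fun v => ∃ w : G.Walk v src, w.length ≤ G.diam) cfg → I 0 cfg := by
    intro cfg h
    refine ⟨fun v st hst => ?_, fun v => h.2 v ?_⟩
    · rw [h.1 v st hst]
      exact ⟨rfl, rfl⟩
    · obtain ⟨w, hw⟩ := hconn.exists_walk_length_eq_dist v src
      exact ⟨w, hw ▸ SimpleGraph.dist_le_diam (SimpleGraph.connected_iff_ediam_ne_top.1 hconn)⟩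
  have htot := (hphases.mono (fun _ h => h) hmid le_rfl).trans hkeep le_rfl
  rw [Nat.add_sub_cancel' ht] at htot
  refine htot.mono (fun cfg h => ?_) (fun cfg h v => ?_) (by linarith)
  · subst h
    refine ⟨fun v st hst => ?_, fun v hv => ?_⟩
    · dsimp only at hst
      split_ifs at hst
      rw [Nat.zero_mul]
      exact (Option.some.inj hst).symm
    · obtain ⟨w, hw⟩ := hv
      have hw0 : w.length = 0 := by omega
      have := SimpleGraph.Walk.eq_of_length_eq_zero hw0
      simp [this]
  · obtain ⟨st, hst⟩ := Option.ne_none_iff_exists'.1 (h.2 v)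
    exact ⟨st, hst, (h.1 v st hst).1⟩

/-- In every configuration that can occur after `t` rounds, the stations agree on the time. -/
theorem sync_of_mem_support {src : Fin n} {t : ℕ}
    {cfg : (NoSBroadcast Msg k M.ε n).Config n}
    (h : cfg ∈ ((NoSBroadcast Msg k M.ε n).run M pos src m t).support) :
    Sync (Msg := Msg) m t cfg := by
  induction t generalizing cfg with
  | zero =>
    intro v st hst
    have h' : cfg = (NoSBroadcast Msg k M.ε n).initConfig src m :=
      (PMF.mem_support_pure_iff _ _).1 h
    rw [h'] at hst
    have hst' : (if v = src then some (NoSState.fresh m 0) else none) = some st := hst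
    split_ifs at hst'
    rw [← Option.some.inj hst']
    exact ⟨rfl, rfl⟩
  | succ t ih =>
    obtain ⟨cfg', h1, h2⟩ := (PMF.mem_support_bind_iff _ _ _).1 h
    obtain ⟨T, -, rfl⟩ := (PMF.mem_support_map_iff _ _ _).1 h2
    exact (ih h1).next (M := M) (pos := pos) (k := k) (T := T)

theorem diam_le (G : SimpleGraph (Fin n)) (h : G.Connected) : G.diam ≤ n := by
  have : Nonempty (Fin n) := h.nonempty
  obtain ⟨u, v, huv⟩ := G.exists_dist_eq_diam
  rw [← huv]
  obtain ⟨w, hw⟩ := h.exists_isPath u v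
  have := hw.length_lt
  rw [Fintype.card_fin] at this
  exact (SimpleGraph.dist_le w).trans this.le

end Spread

/-! ### Length of a phase, total failure probability and size of the attached number -/

section Conclusion

variable {M : SINRParams} {γ κ s : ℝ} {k : NoSConstants}

/-- The length of a phase is `O(log² n)`. -/
theorem NoSConstants.phaseLen_le (hk : k.Positive) {A : ℝ} (hA : 0 ≤ A) {n : ℕ} (hn : 2 ≤ n)
    (hloops : (k.loops n : ℝ) ≤ A * Real.logb 2 n) :
    (k.phaseLen n : ℝ) ≤
      (A * k.c' * (k.c₀ + k.c₂ + 2) + k.cT + 1) * Real.logb 2 n ^ 2 := by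
  have hL := NoSConstants.one_le_logb hn
  set L := Real.logb 2 n with hLdef
  obtain ⟨h0, -, h2, -, -, -, -, -, hT, -⟩ := hk
  have hd : (k.densityLen n : ℝ) ≤ (k.c₀ + 1) * L := by
    have := (Nat.ceil_lt_add_one (mul_nonneg h0.le (by linarith : 0 ≤ L))).le
    calc (k.densityLen n : ℝ) ≤ k.c₀ * L + 1 := this
      _ ≤ (k.c₀ + 1) * L := by linarith
  have hp : (k.playoffLen n : ℝ) ≤ (k.c₂ + 1) * L := by
    have := (Nat.ceil_lt_add_one (mul_nonneg h2.le (by linarith : 0 ≤ L))).le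
    calc (k.playoffLen n : ℝ) ≤ k.c₂ * L + 1 := this
      _ ≤ (k.c₂ + 1) * L := by linarith
  have h2' : (k.part2Len n : ℝ) ≤ (k.cT + 1) * L ^ 2 := by
    have := (Nat.ceil_lt_add_one (mul_nonneg hT.le (by positivity : 0 ≤ L ^ 2))).le
    have hL2 : 1 ≤ L ^ 2 := one_le_pow₀ hL
    calc (k.part2Len n : ℝ) ≤ k.cT * L ^ 2 + 1 := this
      _ ≤ (k.cT + 1) * L ^ 2 := by linarith
  have h1' : (k.part1Len n : ℝ) ≤ A * L * (k.c' * ((k.c₀ + k.c₂ + 2) * L)) := by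
    rw [NoSConstants.part1Len, NoSConstants.testLen]
    push_cast
    have : (k.densityLen n : ℝ) + k.playoffLen n ≤ (k.c₀ + k.c₂ + 2) * L := by linarith
    gcongr
  rw [NoSConstants.phaseLen]
  push_cast
  linarith

/-- Since `log n ≤ n`, the clock is at most `K * n^3`, so its size is at most `log K + 3 * log n +
1`. The condition `K ≥ 8` gives `log K ≤ K / 2` and absorbs the remaining `4 * log n` into the other
half of `K * log n`. -/
theorem size_le_of_le {K : ℝ} (hK : 8 ≤ K) {n t : ℕ} (hn : 2 ≤ n)
    (ht : (t : ℝ) ≤ K * n * Real.logb 2 n ^ 2) : (Nat.size t : ℝ) ≤ K * Real.logb 2 n := by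
  have hL := NoSConstants.one_le_logb hn
  have hn0 : (0 : ℝ) < n := by positivity
  rcases Nat.eq_zero_or_pos t with rfl | ht0
  · simp only [Nat.size_zero, Nat.cast_zero]
    positivity
  have hLn : Real.logb 2 n ≤ n := by
    rw [Real.logb_le_iff_le_rpow (by norm_num) hn0, Real.rpow_natCast]
    exact_mod_cast Nat.lt_two_pow_self.le
  have ht2 : (t : ℝ) ≤ K * (n : ℝ) ^ 3 := by
    have : Real.logb 2 n ^ 2 ≤ (n : ℝ) ^ 2 := pow_le_pow_left₀ (by linarith) hLn 2
    calc (t : ℝ) ≤ K * n * Real.logb 2 n ^ 2 := ht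
      _ ≤ K * n * (n : ℝ) ^ 2 := by gcongr
      _ = _ := by ring
  have h1 : 2 ^ (Nat.size t - 1) ≤ t := by
    rw [← Nat.lt_size]
    have := Nat.size_pos.2 ht0
    omega
  have h2 : ((Nat.size t - 1 : ℕ) : ℝ) ≤ Real.logb 2 (K * (n : ℝ) ^ 3) := by
    rw [Real.le_logb_iff_rpow_le (by norm_num) (by positivity), Real.rpow_natCast]
    refine le_trans ?_ ht2
    exact_mod_cast h1
  have h3 : Real.logb 2 (K * (n : ℝ) ^ 3) = Real.logb 2 K + 3 * Real.logb 2 n := by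
    rw [Real.logb_mul (by linarith) (by positivity), Real.logb_pow]
    norm_num
  have h4 : Real.logb 2 K ≤ K / 2 := by
    rw [Real.logb_le_iff_le_rpow (by norm_num) (by linarith)]
    have h5 : (2 : ℝ) ^ (K / 2) = 16 * 2 ^ (K / 2 - 4) := by
      rw [show (16 : ℝ) = 2 ^ (4 : ℝ) by norm_num, ← Real.rpow_add (by norm_num)]
      congr 1; ring
    have h6 : 1 + (K / 2 - 4) * Real.log 2 ≤ (2 : ℝ) ^ (K / 2 - 4) := by
      rw [Real.rpow_def_of_pos (by norm_num)]
      have := Real.add_one_le_exp (Real.log 2 * (K / 2 - 4))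
      linarith
    have h7 := Real.log_two_gt_d9
    nlinarith
  have h8 : (Nat.size t : ℝ) ≤ ((Nat.size t - 1 : ℕ) : ℝ) + 1 := by
    exact_mod_cast (by omega : Nat.size t ≤ Nat.size t - 1 + 1)
  rw [h3] at h2
  nlinarith

/-- The total failure probability is at most `1 / n`. -/
theorem failure_le {A : ℝ} (hA : 0 ≤ A) {n : ℕ} (hn : 2 ≤ n)
    (hloops : (k.loops n : ℝ) ≤ A * Real.logb 2 n) (hs : 3 * A * k.c' + 1 ≤ 2 ^ (s - 4))
    (hs4 : 4 ≤ s) {D : ℕ} (hD : D ≤ n) :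
    (D : ℝ) * (k.loops n * (k.c' * (n * (3 * (n : ℝ) ^ (-s)))) + n * (n : ℝ) ^ (-s)) ≤
      1 / n := by
  have hn0 : (0 : ℝ) < n := by positivity
  have hLn : Real.logb 2 n ≤ n := by
    rw [Real.logb_le_iff_le_rpow (by norm_num) hn0, Real.rpow_natCast]
    exact_mod_cast Nat.lt_two_pow_self.le
  have hn1 : (1 : ℝ) ≤ n := by exact_mod_cast (by omega : 1 ≤ n)
  have hl : (k.loops n : ℝ) ≤ A * n := hloops.trans (mul_le_mul_of_nonneg_left hLn hA)
  have hD' : (D : ℝ) ≤ n := by exact_mod_cast hD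
  have hδ : (0 : ℝ) ≤ (n : ℝ) ^ (-s) := by positivity
  calc (D : ℝ) * (k.loops n * (k.c' * (n * (3 * (n : ℝ) ^ (-s)))) + n * (n : ℝ) ^ (-s))
      ≤ n * (A * n * (k.c' * (n * (3 * (n : ℝ) ^ (-s)))) + n * (n : ℝ) * (n : ℝ) ^ (-s)) := by
        have : (n : ℝ) ≤ n * n := le_mul_of_one_le_left hn0.le hn1
        gcongr
    _ = (3 * A * k.c' + 1) * ((n : ℝ) ^ 3 * (n : ℝ) ^ (-s)) := by ring
    _ ≤ (n : ℝ) ^ (s - 4) * ((n : ℝ) ^ 3 * (n : ℝ) ^ (-s)) := by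
        refine mul_le_mul_of_nonneg_right (hs.trans ?_) (by positivity)
        exact Real.rpow_le_rpow (by norm_num) (by exact_mod_cast hn) (by linarith)
    _ = 1 / n := by
        rw [← Real.rpow_natCast, ← Real.rpow_add hn0, ← Real.rpow_add hn0, one_div,
          ← Real.rpow_neg_one]
        congr 1
        push_cast
        ring

/-- `K₀` bounds the phase length in units of `log² n`, and the extra `8` serves the bound on the
number of bits. For `n = 1` the logarithm vanishes: the probability bound reads `0`, and the only
admissible time in the second claim is `0`. -/
theorem broadcast_of_tuned (hk : Tuned M γ κ k s) {A : ℝ} (hA : 0 ≤ A)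
    (hloops : ∀ n : ℕ, 2 ≤ n → (k.loops n : ℝ) ≤ A * Real.logb 2 n)
    (hs : 3 * A * k.c' + 1 ≤ 2 ^ (s - 4)) (hs4 : 4 ≤ s) :
    ∃ K : ℝ, 0 < K ∧
      ∀ (X : Type*) [MetricSpace X], BoundedGrowth X γ κ →
      ∀ (n : ℕ) (pos : Fin n → X), Function.Injective pos → (M.commGraph pos).Connected →
      ∀ (s : Fin n) (Msg : Type) (m : Msg),
        (∀ t : ℕ, K * (M.commGraph pos).diam * Real.logb 2 n ^ 2 ≤ t →
          1 - 1 / (n : ℝ) ≤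
            (((NoSBroadcast Msg k M.ε n).run M pos s m t).toOuterMeasure
              {cfg | (NoSBroadcast Msg k M.ε n).Informed m cfg}).toReal) ∧
        (∀ t : ℕ, (t : ℝ) ≤ K * (M.commGraph pos).diam * Real.logb 2 n ^ 2 →
          ∀ cfg ∈ ((NoSBroadcast Msg k M.ε n).run M pos s m t).support, ∀ v st, cfg v = some st →
            (Nat.size ((NoSBroadcast Msg k M.ε n).packet st).2 : ℝ) ≤ K * Real.logb 2 n) := by
  have hc₀ := hk.c₀_ge
  have hc₂ := hk.c₂_ge
  have hcT := hk.positive.2.2.2.2.2.2.2.2.1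
  set K₀ : ℝ := A * k.c' * (k.c₀ + k.c₂ + 2) + k.cT + 1 with hK₀
  have hK₀0 : 0 < K₀ := by positivity
  refine ⟨K₀ + 8, by positivity, fun X _ hX n pos hinj hconn src Msg m => ⟨fun t ht => ?_,
    fun t ht cfg hcfg v st hst => ?_⟩⟩
  · rcases Nat.lt_or_ge n 2 with hn | hn
    · have hn1 : n = 1 := by
        have := src.pos
        omega
      subst hn1
      simp
    · have hL := NoSConstants.one_le_logb hn
      have hlen := NoSConstants.phaseLen_le hk.positive hA hn (hloops n hn)
      rw [← hK₀] at hlen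
      have hD : (M.commGraph pos).diam * k.phaseLen n ≤ t := by
        have h1 : ((M.commGraph pos).diam : ℝ) * k.phaseLen n ≤ t := by
          refine le_trans ?_ ht
          calc ((M.commGraph pos).diam : ℝ) * k.phaseLen n
              ≤ (M.commGraph pos).diam * ((K₀ + 8) * Real.logb 2 n ^ 2) := by
                refine mul_le_mul_of_nonneg_left (hlen.trans ?_) (Nat.cast_nonneg _)
                exact mul_le_mul_of_nonneg_right (by linarith) (by positivity)
            _ = _ := by ring
        exact_mod_cast h1
      have hlead := leads_informed (m := m) hX hinj hk hn hconn src hD _ rfl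
      have hfail := hlead.trans
        (failure_le hA hn (hloops n hn) hs hs4 (diam_le (M.commGraph pos) hconn))
      rw [toReal_run_eq]
      set Q : (Fin n → Option (NoSState Msg)) → Prop := fun cfg =>
        ∀ v, ∃ st, cfg v = some st ∧ st.msg = m with hQ
      set cfg₀ : Fin n → Option (NoSState Msg) :=
        fun v => if v = src then some (NoSState.fresh m 0) else none with hcfg₀
      have hsum : (expect (nosTx M k) (nosNext M pos k))^[t] (fun cfg => ind (Q cfg)) cfg₀ +
          (expect (nosTx M k) (nosNext M pos k))^[t] (fun cfg => ind (¬Q cfg)) cfg₀ = 1 := by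
        rw [← expect_iterate_add, show (fun cfg => ind (Q cfg) + ind (¬Q cfg)) = fun _ => (1 : ℝ) from
          funext fun cfg => by rw [ind_not]; ring, expect_iterate_const]
      have hgoal : (expect (NoSBroadcast Msg k M.ε n).txProbs
          ((NoSBroadcast Msg k M.ε n).next M pos))^[t]
          (fun cfg => ind ((NoSBroadcast Msg k M.ε n).Informed m cfg))
          ((NoSBroadcast Msg k M.ε n).initConfig src m) =
          (expect (nosTx M k) (nosNext M pos k))^[t] (fun cfg => ind (Q cfg)) cfg₀ := rfl
      rw [hgoal]
      linarith
  · have hclock : st.clock = t := (sync_of_mem_support hcfg v st hst).2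
    have hpk : ((NoSBroadcast Msg k M.ε n).packet st).2 = t := hclock
    rw [hpk]
    rcases Nat.lt_or_ge n 2 with hn | hn
    · have hn1 : n = 1 := by
        have := src.pos
        omega
      subst hn1
      have ht0 : t = 0 := by
        simp only [Nat.cast_one, Real.logb_one] at ht
        have : (t : ℝ) ≤ 0 := by simpa using ht
        exact Nat.le_zero.1 (by exact_mod_cast this)
      simp [ht0]
    · refine size_le_of_le (by linarith) hn (ht.trans ?_)
      have : ((M.commGraph pos).diam : ℝ) ≤ n := by
        exact_mod_cast diam_le (M.commGraph pos) hconn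
      gcongr

end Conclusion

/-! ### The choice of the constants -/

section Constants

open Filter Topology

theorem exists_nat_mul_rpow_le {a : ℝ} (ha : a < 0) (b : ℝ) {e : ℝ} (he : 0 < e) :
    ∃ ρ : ℕ, 2 ≤ ρ ∧ b * ((4 * ρ : ℕ) : ℝ) ^ a ≤ e := by
  have h1 : Tendsto (fun y : ℝ => b * y ^ a) atTop (𝓝 (b * 0)) := by
    have := tendsto_rpow_neg_atTop (neg_pos.2 ha)
    rw [neg_neg] at this
    exact this.const_mul b
  rw [mul_zero] at h1
  have h2 : Tendsto (fun ρ : ℕ => ((4 * ρ : ℕ) : ℝ)) atTop atTop :=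
    tendsto_natCast_atTop_atTop.comp (tendsto_id.const_mul_atTop' (by norm_num))
  obtain ⟨ρ, h, hρ⟩ := (((h1.comp h2).eventually (ge_mem_nhds he)).and (eventually_ge_atTop 2)).exists
  exact ⟨ρ, hρ, h⟩

/-- With `y = 2^l`, the mass `cEps * C₁ = G * y^((γ+α)/2)` grows more slowly than `y^α`, so far
interference at distance about `y` times the scale vanishes as `y` grows. It still tends to
infinity, which kills the exponential term. All requirements hold for large `y`, hence for one
common `l`. -/
theorem exists_pow_scale {α γ b G e θ η B C : ℝ} (hγ : 0 ≤ γ) (hα : γ < α) (hG : 0 < G)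
    (hb : 0 ≤ b) (he : 0 < e) (hθ : 0 < θ) (hη : 0 < η) (r : ℕ) :
    ∃ l : ℕ, r ≤ 2 ^ l ∧ ((2 : ℝ) ^ l) ^ (-α) ≤ e ∧
      b * (G * ((2 : ℝ) ^ l) ^ ((γ + α) / 2)) * ((2 : ℝ) ^ l - 1) ^ (-α) ≤ e ∧
      B * Real.exp (-(η * ((2 : ℝ) ^ l) ^ ((γ + α) / 2))) ≤ θ ∧
      C ≤ G * ((2 : ℝ) ^ l) ^ ((γ + α) / 2) := by
  have hα0 : 0 < α := by linarith
  have hδ : 0 < (γ + α) / 2 := by linarith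
  have hpow := tendsto_rpow_atTop hδ
  have e1 : ∀ᶠ y : ℝ in atTop, (r : ℝ) ≤ y := eventually_ge_atTop _
  have e2 : ∀ᶠ y : ℝ in atTop, y ^ (-α) ≤ e :=
    (tendsto_rpow_neg_atTop hα0).eventually (ge_mem_nhds he)
  have e3 : ∀ᶠ y : ℝ in atTop, b * (G * y ^ ((γ + α) / 2)) * (y - 1) ^ (-α) ≤ e := by
    have h1 : Tendsto (fun y : ℝ => b * G * 2 ^ α * y ^ (-((α - γ) / 2))) atTop
        (𝓝 (b * G * 2 ^ α * 0)) :=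
      (tendsto_rpow_neg_atTop (by linarith)).const_mul _
    rw [mul_zero] at h1
    filter_upwards [h1.eventually (ge_mem_nhds he), eventually_ge_atTop 2] with y hy hy2
    refine le_trans ?_ hy
    have hy0 : 0 < y := by linarith
    have h2 : (y - 1) ^ (-α) ≤ 2 ^ α * y ^ (-α) := by
      calc (y - 1) ^ (-α) ≤ (y / 2) ^ (-α) :=
            Real.rpow_le_rpow_of_nonpos (by linarith) (by linarith) (by linarith)
        _ = 2 ^ α * y ^ (-α) := by
            rw [Real.div_rpow hy0.le (by norm_num), Real.rpow_neg (by norm_num : (0 : ℝ) ≤ 2),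
              div_inv_eq_mul, mul_comm]
    calc b * (G * y ^ ((γ + α) / 2)) * (y - 1) ^ (-α)
        ≤ b * (G * y ^ ((γ + α) / 2)) * (2 ^ α * y ^ (-α)) := by gcongr
      _ = b * G * 2 ^ α * (y ^ ((γ + α) / 2) * y ^ (-α)) := by ring
      _ = _ := by
          rw [← Real.rpow_add hy0]
          congr 2
          ring
  have e4 : ∀ᶠ y : ℝ in atTop, B * Real.exp (-(η * y ^ ((γ + α) / 2))) ≤ θ := by
    have h1 : Tendsto (fun y : ℝ => B * Real.exp (-(η * y ^ ((γ + α) / 2)))) atTop (𝓝 (B * 0)) :=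
      (Real.tendsto_exp_neg_atTop_nhds_zero.comp (hpow.const_mul_atTop hη)).const_mul B
    rw [mul_zero] at h1
    exact h1.eventually (ge_mem_nhds hθ)
  have e5 : ∀ᶠ y : ℝ in atTop, C ≤ G * y ^ ((γ + α) / 2) :=
    (hpow.const_mul_atTop hG).eventually_ge_atTop C
  obtain ⟨l, h1, h2, h3, h4, h5⟩ := ((tendsto_pow_atTop_atTop_of_one_lt (one_lt_two (α := ℝ))).eventually
    (e1.and (e2.and (e3.and (e4.and e5))))).exists
  exact ⟨l, by exact_mod_cast h1, h2, h3, h4, h5⟩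

/-- Noise, interference from the light neighbourhood and interference from beyond it each get one
third of the signal `(2 * x)^(-α)`. For the noise this uses `x ≤ 1 / y`. -/
theorem one_add_interference_le {α β H R y c x : ℝ} (hα : 0 < α) (hy : 1 < y)
    (hy1 : y ^ (-α) ≤ 2 ^ (-α) / 3) (hR : β * (2 * H) * 4 ^ α * R ≤ 2 ^ (-α) / 3)
    (hc : β * (2 * H) * c * (y - 1) ^ (-α) ≤ 2 ^ (-α) / 3) (hx : 0 < x) (hxy : x ≤ 1 / y) :
    1 + β * (2 * H * (R * (x / 4) ^ (-α) + ((y - 1) * x) ^ (-α) * c)) ≤ (2 * x) ^ (-α) := by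
  have h1 : 1 ≤ 2 ^ (-α) / 3 * x ^ (-α) := by
    have h2 : x ^ α ≤ 2 ^ (-α) / 3 := by
      refine le_trans ?_ hy1
      rw [Real.rpow_neg (by linarith), ← Real.inv_rpow (by linarith), ← one_div]
      exact Real.rpow_le_rpow hx.le hxy hα.le
    have h3 : x ^ α * x ^ (-α) = 1 := by rw [← Real.rpow_add hx, add_neg_cancel, Real.rpow_zero]
    rw [← h3]
    gcongr
  have h4 : (x / 4) ^ (-α) = 4 ^ α * x ^ (-α) := by
    rw [Real.div_rpow hx.le (by norm_num), Real.rpow_neg (by norm_num : (0 : ℝ) ≤ 4),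
      div_inv_eq_mul, mul_comm]
  rw [h4, Real.mul_rpow (by linarith) hx.le, Real.mul_rpow (by norm_num) hx.le]
  have hx0 : 0 < x ^ (-α) := Real.rpow_pos_of_pos hx _
  have h5 := mul_le_mul_of_nonneg_right hR hx0.le
  have h6 := mul_le_mul_of_nonneg_right hc hx0.le
  linarith

/-- The loop of StabilizeProbability has `O(log n)` iterations. -/
theorem NoSConstants.loops_le (k : NoSConstants) (h₁ : 0 < k.C₁) (h₂ : 0 < k.C₂)
    (hE : 0 < k.cEps) {n : ℕ} (hn : 2 ≤ n) :
    (k.loops n : ℝ) ≤ (|Real.logb 2 (2 * k.C₂ / (k.cEps * k.C₁))| + 2) * Real.logb 2 n := by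
  have hL := NoSConstants.one_le_logb hn
  have hn0 : (0 : ℝ) < n := by positivity
  have h3 : k.pMax / k.pStart n = 2 * k.C₂ / (k.cEps * k.C₁) * n := by
    rw [NoSConstants.pMax, NoSConstants.pStart]
    field_simp
  rw [NoSConstants.loops, h3, Real.logb_mul (by positivity) (by positivity)]
  set B := Real.logb 2 (2 * k.C₂ / (k.cEps * k.C₁))
  have h4 : (⌈B + Real.logb 2 n⌉₊ : ℝ) ≤ ⌈|B| + Real.logb 2 n⌉₊ := by
    exact_mod_cast Nat.ceil_mono (by linarith [le_abs_self B])
  have h5 := Nat.ceil_lt_add_one (add_nonneg (abs_nonneg B) (by linarith : 0 ≤ Real.logb 2 n))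
  nlinarith [abs_nonneg B]

theorem exists_small_pos {b t a : ℝ} (hb : 0 < b) (ht : 1 < t) (ha : 0 < a) :
    ∃ μ : ℝ, 0 < μ ∧ μ ≤ a ∧ 1 + b * μ ≤ t := by
  refine ⟨min a ((t - 1) / b), lt_min ha (div_pos (by linarith) hb), min_le_left _ _, ?_⟩
  have : b * min a ((t - 1) / b) ≤ b * ((t - 1) / b) :=
    mul_le_mul_of_nonneg_left (min_le_right _ _) hb.le
  rw [mul_div_cancel₀ _ hb.ne'] at this
  linarith

theorem one_lt_rpow_neg {x α : ℝ} (hx : 0 < x) (hx1 : x < 1) (hα : 0 < α) : 1 < x ^ (-α) :=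
  Real.one_lt_rpow_of_pos_of_lt_one_of_neg hx hx1 (by linarith)

/-- The choices are not circular: `C₁`, `μ` and `ρ` come from the model, then the hearing
probabilities `q` and `τ` of the two tests, then the scale `l` and with it `cEps`, then `c'` and
`A`. Only afterwards is `s` fixed. The test lengths `c₀`, `c₂` grow with `s`, but the ratios `c₁ /
c₀ = q / 4` and `c₃ / c₂ = τ / 4` do not depend on it, so nothing chosen earlier has to change. -/
theorem exists_tuned {M : SINRParams} {γ κ : ℝ} (hγ : 0 ≤ γ) (hκ : 0 < κ)
    (hα : γ < M.α) (hβ : 1 ≤ M.β) (hN : 0 < M.noise) (hε₀ : 0 < M.ε) (hε₁ : M.ε < 1) :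
    ∃ (k : NoSConstants) (A s : ℝ), Tuned M γ κ k s ∧ 0 ≤ A ∧
      (∀ n : ℕ, 2 ≤ n → (k.loops n : ℝ) ≤ A * Real.logb 2 n) ∧
      3 * A * k.c' + 1 ≤ 2 ^ (s - 4) ∧ 4 ≤ s := by
  have hα0 : 0 < M.α := by linarith
  have hH := SINRParams.farConst_pos hα hκ
  set H := SINRParams.farConst M.α γ κ with hHdef
  have hb : 0 < M.β * (2 * H) := by positivity
  obtain ⟨C₁, hC₁, hC₁2, hden⟩ := exists_small_pos hb
    (one_lt_rpow_neg (by norm_num : (0 : ℝ) < 1 / 2) (by norm_num) hα0) (by norm_num : (0 : ℝ) < 1 / 2)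
  obtain ⟨μ, hμ, hμ2, hnum⟩ := exists_small_pos hb
    (one_lt_rpow_neg (by linarith : 0 < 1 - M.ε / 2) (by linarith) hα0)
    (by norm_num : (0 : ℝ) < 1 / 2)
  have he : (0 : ℝ) < 2 ^ (-M.α) / 3 := by positivity
  obtain ⟨ρ, hρ, hR⟩ := exists_nat_mul_rpow_le (sub_neg.2 hα) (M.β * (2 * H) * 4 ^ M.α) he
  set q : ℝ := 3 / 16 * (C₁ / (2 * κ * 8 ^ γ)) with hq
  have hq0 : 0 < q := by positivity
  set τ : ℝ := 3 / 8 * Real.exp (-(2 * (κ * ((4 * ρ : ℕ) : ℝ) ^ γ))) with hτ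
  have hτ0 : 0 < τ := by positivity
  set G : ℝ := 2 * κ * 8 ^ γ * (κ * 4 ^ γ) with hG
  have hG0 : 0 < G := by positivity
  obtain ⟨l, hl, hl1, hl2, hl3, hl4⟩ := exists_pow_scale (B := 2 ^ (1 + (M.ε / 2) ^ (-M.α)))
    (C := C₁) (θ := τ / 64) (η := G / C₁ * (q / 32) / 2) hγ hα hG0 hb.le he (by positivity)
    (by positivity) (ρ + 1)
  set y : ℝ := 2 ^ l with hy
  have hy1 : 1 < y := by
    have : ((ρ + 1 : ℕ) : ℝ) ≤ y := by rw [hy]; exact_mod_cast hl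
    have : (2 : ℝ) ≤ ρ := by exact_mod_cast hρ
    push_cast at *
    linarith
  -- Chosen so that `cE * C₁ = G * y^((γ+α)/2)`: at least `G * y^γ`, as the second pigeonhole of the
  -- descent needs, yet negligible against `y^α`.
  set cE : ℝ := G * y ^ ((γ + M.α) / 2) / C₁ with hcE
  have hcEC : cE * C₁ = G * y ^ ((γ + M.α) / 2) := div_mul_cancel₀ _ hC₁.ne'
  have hcE1 : 1 ≤ cE := by rwa [hcE, one_le_div hC₁]
  obtain ⟨c', hc'⟩ := exists_nat_gt (cE * (κ * 2 ^ γ * C₁))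
  have hc'0 : 0 < c' := by
    have : (0 : ℝ) < c' := lt_of_le_of_lt (by positivity) hc'
    exact_mod_cast this
  set A : ℝ := |Real.logb 2 (2 * (1 / 4) / (cE * C₁))| + 2 with hA
  have hA0 : 0 ≤ A := by positivity
  -- The union bound costs a factor `(3 * A * c' + 1) * n^3`. With `s = s₀ + 4` the constant is
  -- absorbed by `n^(s-4)`, and `1 / n` remains.
  obtain ⟨s₀, hs₀⟩ := ((tendsto_rpow_atTop_of_base_gt_one 2 one_lt_two).eventually_ge_atTop
    (3 * A * c' + 1)).and (eventually_ge_atTop 0) |>.exists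
  set s : ℝ := s₀ + 4 with hs
  have hs4 : 4 ≤ s := by linarith [hs₀.2]
  -- Long enough that `c₁ = q * c₀ / 4 ≥ 2 * s`, so the tail bound of DensityTest reaches `n^(-s)`;
  -- `c₂` plays the same role for Playoff.
  set c₀ : ℝ := max 1 (8 * s / q) with hc₀
  set c₂ : ℝ := max 1 (8 * s / τ) with hc₂
  have hc₀1 : 1 ≤ c₀ := le_max_left _ _
  have hc₂1 : 1 ≤ c₂ := le_max_left _ _
  have hsq : 8 * s ≤ q * c₀ := by
    rw [mul_comm q, ← div_le_iff₀ hq0]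
    exact le_max_right _ _
  have hsτ : 8 * s ≤ τ * c₂ := by
    rw [mul_comm τ, ← div_le_iff₀ hτ0]
    exact le_max_right _ _
  -- The first entry of the maximum keeps the probabilities of the second part at most `1`, the
  -- second brings the mass of unit balls down to `μ`.
  set c : ℝ := max (2 * (1 / 4 / cE)) ((A + 3) * C₁ / μ) / M.ε with hc
  have hcε : c * M.ε = max (2 * (1 / 4 / cE)) ((A + 3) * C₁ / μ) := div_mul_cancel₀ _ hε₀.ne'
  have hcE0 : 0 < cE := by linarith
  have hmax : 0 < max (2 * (1 / 4 / cE)) ((A + 3) * C₁ / μ) := lt_max_of_lt_left (by positivity)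
  set a : ℝ := q * c₀ / 4 with ha
  set d : ℝ := τ * c₂ / 4 with hd
  have hd0 : 0 < d := by positivity
  have hnear : 0 < d / (8 * c₂) / (2 * cE) / (4 * (c * M.ε)) := by
    rw [hcε]
    positivity
  refine ⟨⟨c₀, a, c₂, d, cE, C₁, 1 / 4, c, s / (d / (8 * c₂) / (2 * cE) / (4 * (c * M.ε))), c'⟩,
    A, s, ?_, hA0, fun n hn => ?_, ?_, hs4⟩
  · exact
    { β_ge := hβ
      noise_pos := hN
      γ_lt := hα
      α_pos := hα0
      κ_pos := hκ
      ε_pos := hε₀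
      positive := ⟨by positivity, by positivity, by positivity, hd0, hcE0, hC₁, by norm_num,
        div_pos hmax hε₀, div_pos (by linarith) hnear, hc'0⟩
      C₂_eq := rfl
      cEps_ge := hcE1
      C₁_le := hC₁2
      density_num := by
        rw [← mul_assoc]
        exact hden
      playoff_num := by
        refine ⟨ρ, l, hρ, hl, fun x hx hxl => ?_, ?_, ?_⟩
        · rw [← hy, ← hHdef]
          refine one_add_interference_le hα0 hy1 hl1 hR ?_ hx (hxl.trans ?_)
          · rw [hcEC]
            exact hl2
          · rw [hy, one_div_pow]
            gcongr
            · norm_num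
            · omega
        · show _ ≤ cE * C₁
          rw [hcEC, hG]
          have h1 : ((2 ^ (l + 2) : ℕ) : ℝ) ^ γ = 4 ^ γ * y ^ γ := by
            rw [← Real.mul_rpow (by norm_num) (by linarith), hy]
            congr 1
            push_cast
            ring
          rw [h1]
          have h2 : y ^ γ ≤ y ^ ((γ + M.α) / 2) := Real.rpow_le_rpow_of_exponent_le hy1.le (by linarith)
          calc 2 * κ * 8 ^ γ * (κ * (4 ^ γ * y ^ γ)) = 2 * κ * 8 ^ γ * (κ * 4 ^ γ) * y ^ γ := by ring
            _ ≤ _ := by gcongr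
        · show 4 * d / c₂ ≤ τ
          rw [hd]
          apply le_of_eq
          field_simp
      density_le := by
        show 4 * a / c₀ ≤ q
        rw [ha]
        apply le_of_eq
        field_simp
      near_num := by
        show 2 ^ (1 + (M.ε / 2) ^ (-M.α)) * Real.exp (-(cE * (a / (8 * c₀))) / 2) ≤ d / (8 * c₂) / 2
        have h1 : d / (8 * c₂) / 2 = τ / 64 := by
          rw [hd]
          field_simp
          norm_num
        have h2 : -(cE * (a / (8 * c₀))) / 2 =
            -(G / C₁ * (q / 32) / 2 * y ^ ((γ + M.α) / 2)) := by
          rw [hcE, ha]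
          field_simp
          norm_num
        rw [h1, h2]
        exact hl3
      repetitions := hc'
      c₀_ge := hc₀1
      c₂_ge := hc₂1
      s_le₁ := by
        show s ≤ a / 2
        linarith
      s_le₃ := by
        show s ≤ d / 2
        linarith
      c_ge := by
        show 2 * (1 / 4 / cE) ≤ c * M.ε
        rw [hcε]
        exact le_max_left _ _
      part2_num := by
        refine ⟨μ, hμ, hμ2, ?_, fun n hn => ?_⟩
        · rw [← mul_assoc]
          exact hnum
        · have hL := NoSConstants.one_le_logb hn
          have h1 := NoSConstants.loops_le
            ⟨c₀, a, c₂, d, cE, C₁, 1 / 4, c, s / (d / (8 * c₂) / (2 * cE) / (4 * (c * M.ε))), c'⟩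
            hC₁ (by norm_num) hcE0 hn
          have h2 : (A + 3) * C₁ ≤ μ * (c * M.ε) := by
            rw [hcε, mul_comm μ, ← div_le_iff₀ hμ]
            exact le_max_right _ _
          calc _ ≤ (A * Real.logb 2 n + 3 * Real.logb 2 n) * C₁ := by
                refine mul_le_mul_of_nonneg_right ?_ hC₁.le
                exact add_le_add h1 (by linarith)
            _ = (A + 3) * C₁ * Real.logb 2 n := by ring
            _ ≤ μ * (c * M.ε) * Real.logb 2 n :=
                mul_le_mul_of_nonneg_right h2 (by linarith)
            _ = _ := by ring
      s_le_cT := (mul_div_cancel₀ s hnear.ne').ge }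
  · exact NoSConstants.loops_le _ hC₁ (by norm_num) hcE0 hn
  · have : s - 4 = s₀ := by rw [hs]; ring
    rw [this]
    exact hs₀.1

end Constants

/-! ### Degenerate growth parameters and the main theorem -/

theorem BoundedGrowth.mono {X : Type*} [MetricSpace X] {γ κ κ' : ℝ} (h : BoundedGrowth X γ κ)
    (hκ : κ ≤ κ') : BoundedGrowth X γ κ' := by
  intro x d hd c hc
  obtain ⟨S, hS, hcov⟩ := h x d hd c hc
  exact ⟨S, hS.trans (mul_le_mul_of_nonneg_right hκ (by positivity)), hcov⟩

/-- A nonempty space does not have bounded growth of negative dimension. -/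
theorem BoundedGrowth.isEmpty {X : Type*} [MetricSpace X] {γ κ : ℝ} (h : BoundedGrowth X γ κ)
    (hγ : γ < 0) : IsEmpty X := by
  refine ⟨fun x => ?_⟩
  obtain ⟨ρ, hρ, hle⟩ := exists_nat_mul_rpow_le hγ κ (by norm_num : (0 : ℝ) < 1 / 2)
  obtain ⟨S, hS, hcov⟩ := h x 1 one_pos (4 * ρ) (by omega)
  have hx : x ∈ ⋃ y ∈ S, Metric.closedBall y 1 := hcov (Metric.mem_closedBall_self (by positivity))
  simp only [Set.mem_iUnion] at hx
  obtain ⟨y, hy, -⟩ := hx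
  have h1 : (1 : ℝ) ≤ S.card := by exact_mod_cast Finset.card_pos.2 ⟨y, hy⟩
  linarith

theorem mainTheorem1 (M : SINRParams) (γ κ : ℝ)
    (hα : γ < M.α) (hβ : 1 ≤ M.β) (hN : 0 < M.noise) (hε₀ : 0 < M.ε) (hε₁ : M.ε < 1) :
    ∃ (k : NoSConstants) (K : ℝ), k.Positive ∧ 0 < K ∧
      ∀ (X : Type*) [MetricSpace X], BoundedGrowth X γ κ →
      ∀ (n : ℕ) (pos : Fin n → X), Function.Injective pos → (M.commGraph pos).Connected →
      ∀ (s : Fin n) (Msg : Type) (m : Msg),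
        -- broadcast is completed within `K * D * log² n` rounds with high probability
        (∀ t : ℕ, K * (M.commGraph pos).diam * Real.logb 2 n ^ 2 ≤ t →
          1 - 1 / (n : ℝ) ≤
            (((NoSBroadcast Msg k M.ε n).run M pos s m t).toOuterMeasure
              {cfg | (NoSBroadcast Msg k M.ε n).Informed m cfg}).toReal) ∧
        -- up to that time at most `K * log n` additional bits are attached to the message
        (∀ t : ℕ, (t : ℝ) ≤ K * (M.commGraph pos).diam * Real.logb 2 n ^ 2 →
          ∀ cfg ∈ ((NoSBroadcast Msg k M.ε n).run M pos s m t).support, ∀ v st, cfg v = some st →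
            (Nat.size ((NoSBroadcast Msg k M.ε n).packet st).2 : ℝ) ≤ K * Real.logb 2 n) := by
  -- For `γ < 0` the space is empty and contains no source, so any constants do. Otherwise `κ` is
  -- replaced by `max κ 1` to make it positive.
  rcases lt_or_ge γ 0 with hγ | hγ
  · refine ⟨⟨1, 1, 1, 1, 1, 1, 1, 1, 1, 1⟩, 1, ?_, one_pos, fun X _ hX n pos _ _ s => ?_⟩
    · simp [NoSConstants.Positive]
    · exact ((hX.isEmpty hγ).false (pos s)).elim
  · obtain ⟨k, A, s, hk, hA, hloops, hs, hs4⟩ :=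
      exists_tuned hγ (lt_max_of_lt_right one_pos : 0 < max κ 1) hα hβ hN hε₀ hε₁
    obtain ⟨K, hK, h⟩ := broadcast_of_tuned hk hA hloops hs hs4
    exact ⟨k, K, hk.positive, hK, fun X _ hX => h X (hX.mono (le_max_left _ _))⟩
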